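/- Let $(M,g)$ be a compact connected smooth Riemannian manifold (without boundary), let $\lambda<0$, and let $\pi:M\to S^1$ be a smooth map, where $S^1$ is the unit circle in $\mathbb C$ with the metric $\frac1{|\lambda|}dt^2$, $t$ being the angle. The following are equivalent: (i) $\pi:(M,g)\to(S^1,\frac1{|\lambda|}dt^2)$ is a harmonic Riemannian submersion, that is, its tension field vanishes, its differential is surjective at every point, and its differential is isometric on the orthogonal complement of its kernel. (ii) $M$ is a mapping torus: there are a compact smooth manifold $M_0$ (not necessarily connected), a diffeomorphism $\eta:M_0\to M_0$, Riemannian metrics $g(t)$ on $M_0$ for $t\in[0,2\pi]$, and a diffeomorphism between $M$ and $$M_0\times_\eta[0,2\pi]=\frac{M_0\times[0,2\pi]}{(x,0)\sim(\eta(x),2\pi)}$$ (with the smooth structure of the quotient of $M_0\times\mathbb R$ by the $\mathbb Z$-action generated by $(x,t)\mapsto(\eta(x),t+2\pi)$), under which $g=g(t)+\frac1{|\lambda|}dt^2$ at the points $[x,t]$ with $t\in[0,2\pi]$; moreover $\eta^*g(2\pi)=g(0)$, the volume density of $g(t)$ on $M_0$ is constant in $t$, and $\pi([x,t])=e^{it}$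 for all $x\in M_0$, $t\in[0,2\pi]$. -/

import Mathlib

open scoped Manifold ContDiff
open Set

universe u

/-! ### Riemannian metrics, Riemannian submersions and harmonic maps -/

/-- Smooth Riemannian metrics on the smooth `n`-manifold `M`. -/
abbrev SmoothMetric (n : ℕ) (M : Type*) [TopologicalSpace M]
  [ChartedSpace (EuclideanSpace ℝ (Fin n)) M]
  [IsManifold (𝓡 n) ∞ M] :=
  Bundle.ContMDiffRiemannianMetric (𝓡 n) ∞ (EuclideanSpace ℝ (Fin n))
    (fun x : M => TangentSpace (𝓡 n) x)

section Riemannian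

variable {m n : ℕ}
  {M : Type*} [TopologicalSpace M] [ChartedSpace (EuclideanSpace ℝ (Fin m)) M]
  [IsManifold (𝓡 m) ∞ M]
  {N : Type*} [TopologicalSpace N] [ChartedSpace (EuclideanSpace ℝ (Fin n)) N]
  [IsManifold (𝓡 n) ∞ N]

/-- A Riemannian submersion: a smooth map whose differentials are surjective and are isometric on
the horizontal spaces `(ker dφ)^⊥`. -/
structure IsRiemannianSubmersion (g : SmoothMetric m M) (h : SmoothMetric n N) (φ : M → N) :
    Prop where
  smooth : ContMDiff (𝓡 m) (𝓡 n) ∞ φ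
  surjective : ∀ p : M, Function.Surjective (mfderiv (𝓡 m) (𝓡 n) φ p)
  isometric : ∀ (p : M) (v w : TangentSpace (𝓡 m) p),
    (∀ u : TangentSpace (𝓡 m) p, mfderiv (𝓡 m) (𝓡 n) φ p u = 0 → g.inner p v u = 0) →
    (∀ u : TangentSpace (𝓡 m) p, mfderiv (𝓡 m) (𝓡 n) φ p u = 0 → g.inner p w u = 0) →
    h.inner (φ p) (mfderiv (𝓡 m) (𝓡 n) φ p v) (mfderiv (𝓡 m) (𝓡 n) φ p w) = g.inner p v w

/-- The partial derivative `∂ᵢ u` at `y` of a function on `ℝᵐ`. -/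
noncomputable def partialDeriv (i : Fin m) (u : EuclideanSpace ℝ (Fin m) → ℝ)
    (y : EuclideanSpace ℝ (Fin m)) : ℝ :=
  fderiv ℝ u y (EuclideanSpace.single i 1)

/-- The matrix `(g_ij)` of the metric in the chart `e`, at the point with coordinates `y`. -/
noncomputable def metricMatrix (g : SmoothMetric m M)
    (e : OpenPartialHomeomorph M (EuclideanSpace ℝ (Fin m))) (y : EuclideanSpace ℝ (Fin m)) :
    Matrix (Fin m) (Fin m) ℝ :=
  Matrix.of fun i j => g.inner (e.symm y)
    (mfderiv (𝓡 m) (𝓡 m) e.symm y (EuclideanSpace.single i (1 : ℝ)))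
    (mfderiv (𝓡 m) (𝓡 m) e.symm y (EuclideanSpace.single j (1 : ℝ)))

/-- The Laplace-Beltrami operator
`Δu = ∑ i j, (1 / √|g|) ∂ⱼ (g^ij √|g| ∂ᵢ u)` in the chart `e`, where `|g| = det (g_ij)`. -/
noncomputable def laplaceBeltrami (g : SmoothMetric m M)
    (e : OpenPartialHomeomorph M (EuclideanSpace ℝ (Fin m)))
    (u : EuclideanSpace ℝ (Fin m) → ℝ) (y : EuclideanSpace ℝ (Fin m)) : ℝ :=
  ∑ i, ∑ j, 1 / √(metricMatrix g e y).det *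
    partialDeriv j (fun z => (metricMatrix g e z)⁻¹ i j * √(metricMatrix g e z).det *
      partialDeriv i u z) y

/-- The Christoffel symbol `Γ^c_ab` in the chart `e`. -/
noncomputable def christoffel (g : SmoothMetric m M)
    (e : OpenPartialHomeomorph M (EuclideanSpace ℝ (Fin m))) (c a b : Fin m)
    (y : EuclideanSpace ℝ (Fin m)) : ℝ :=
  1 / 2 * ∑ d, (metricMatrix g e y)⁻¹ c d *
    (partialDeriv a (fun z => metricMatrix g e z d b) y +
      partialDeriv b (fun z => metricMatrix g e z d a) y -
      partialDeriv d (fun z => metricMatrix g e z a b) y)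

/-- The component
`τ(φ)^c = Δ φ^c + ∑ i j a b, g^ij Γ^c_ab(φ) ∂ᵢφ^a ∂ⱼφ^b`
of the tension field of `φ : (M, g) → (N, h)` in the charts `e` of `M` and `f` of `N`. -/
noncomputable def tensionField (g : SmoothMetric m M) (h : SmoothMetric n N) (φ : M → N)
    (e : OpenPartialHomeomorph M (EuclideanSpace ℝ (Fin m)))
    (f : OpenPartialHomeomorph N (EuclideanSpace ℝ (Fin n)))
    (c : Fin n) (y : EuclideanSpace ℝ (Fin m)) : ℝ :=
  laplaceBeltrami g e (fun z => f (φ (e.symm z)) c) y +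
    ∑ i, ∑ j, ∑ a, ∑ b, (metricMatrix g e y)⁻¹ i j *
      christoffel h f c a b (f (φ (e.symm y))) *
      partialDeriv i (fun z => f (φ (e.symm z)) a) y *
      partialDeriv j (fun z => f (φ (e.symm z)) b) y

/-- A harmonic map: a smooth map whose tension field vanishes, in all charts of the smooth
structures. -/
structure IsHarmonicMap (g : SmoothMetric m M) (h : SmoothMetric n N) (φ : M → N) : Prop where
  smooth : ContMDiff (𝓡 m) (𝓡 n) ∞ φ
  tension_eq_zero : ∀ e ∈ IsManifold.maximalAtlas (𝓡 m) ∞ M,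
    ∀ f ∈ IsManifold.maximalAtlas (𝓡 n) ∞ N,
    ∀ p ∈ e.source, φ p ∈ f.source → ∀ c, tensionField g h φ e f c (e p) = 0

/-- The volume density of `g` at `x`, as a function of `m` tangent vectors: the volume
`√ det (g(vᵢ, vⱼ))` of the parallelepiped that they span. -/
noncomputable def volumeDensity (g : SmoothMetric m M) (x : M)
    (v : Fin m → TangentSpace (𝓡 m) x) : ℝ :=
  √(Matrix.of fun i j => g.inner x (v i) (v j)).det

end Riemannian

/-! ### The metric `c dt²` on the circle -/

theorem contMDiff_circle_coe : ContMDiff (𝓡 1) 𝓘(ℝ, ℂ) ∞ (fun z : Circle => (z : ℂ)) :=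
  haveI := finrank_real_complex_fact'
  contMDiff_coe_sphere

/-- The differential at `z` of the inclusion of the unit circle into `ℂ`. -/
noncomputable def circleInclusionDeriv (z : Circle) : TangentSpace (𝓡 1) z →L[ℝ] ℂ :=
  mfderiv (𝓡 1) 𝓘(ℝ, ℂ) (fun z : Circle => (z : ℂ)) z

theorem injective_circleInclusionDeriv (z : Circle) :
    Function.Injective (circleInclusionDeriv z) :=
  haveI := finrank_real_complex_fact'
  injective_mvfderiv_subtypeVal_sphere (E := ℂ) z

/-- The bilinear form `(v, w) ↦ c ⟨A v, A w⟩`. -/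
noncomputable def circleForm (c : ℝ) (A : EuclideanSpace ℝ (Fin 1) →L[ℝ] ℂ) :
    EuclideanSpace ℝ (Fin 1) →L[ℝ] EuclideanSpace ℝ (Fin 1) →L[ℝ] ℝ :=
  c • (innerSL ℝ : ℂ →L[ℝ] ℂ →L[ℝ] ℝ).bilinearComp A A

theorem circleForm_apply (c : ℝ) (A : EuclideanSpace ℝ (Fin 1) →L[ℝ] ℂ)
    (v w : EuclideanSpace ℝ (Fin 1)) : circleForm c A v w = c * inner ℝ (A v) (A w) := rfl

theorem contDiff_circleForm (c : ℝ) : ContDiff ℝ ∞ (circleForm c) := by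
  rw [contDiff_clm_apply_iff]; intro v
  rw [contDiff_clm_apply_iff]; intro w
  simp only [circleForm_apply]
  exact contDiff_const.mul (ContDiff.inner ℝ (by fun_prop) (by fun_prop))

/-- The scalar product `c dt²` on the tangent space of the circle at `z`. -/
noncomputable def circleFormAt (c : ℝ) (z : Circle) :
    TangentSpace (𝓡 1) z →L[ℝ] TangentSpace (𝓡 1) z →L[ℝ] ℝ :=
  circleForm c (circleInclusionDeriv z)

theorem circleFormAt_apply (c : ℝ) (z : Circle) (v w : TangentSpace (𝓡 1) z) :
    circleFormAt c z v w =
      c * inner ℝ (circleInclusionDeriv z v) (circleInclusionDeriv z w) := rfl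

/-- The metric `c dt²` on the circle, where `t` is the angle: `c` times the metric induced by the
inclusion into `ℂ`, for which `d/dt e^{it}` has length one, see `circleMetric_apply`. -/
noncomputable def circleMetric (c : ℝ) (hc : 0 < c) : SmoothMetric 1 Circle where
  inner z := circleFormAt c z
  symm z v w := by
    rw [circleFormAt_apply, circleFormAt_apply, real_inner_comm]
  pos z v hv := by
    have : circleInclusionDeriv z v ≠ 0 := fun h =>
      hv (injective_circleInclusionDeriv z (h.trans (map_zero _).symm))
    rw [circleFormAt_apply]
    exact mul_pos hc (real_inner_self_pos.2 this)
  isVonNBounded z := by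
    let A : EuclideanSpace ℝ (Fin 1) →L[ℝ] ℂ := circleInclusionDeriv z
    have hA : LinearMap.ker (A : EuclideanSpace ℝ (Fin 1) →ₗ[ℝ] ℂ) = ⊥ :=
      LinearMap.ker_eq_bot.2 (injective_circleInclusionDeriv z)
    obtain ⟨K, -, hK⟩ := LinearMap.exists_antilipschitzWith (A : EuclideanSpace ℝ (Fin 1) →ₗ[ℝ] ℂ) hA
    change Bornology.IsVonNBounded ℝ {v : EuclideanSpace ℝ (Fin 1) | c * inner ℝ (A v) (A v) < 1}
    rw [NormedSpace.isVonNBounded_iff, isBounded_iff_forall_norm_le]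
    refine ⟨K * (1 + 1 / c), fun v hv => ?_⟩
    have h1 : ‖v‖ ≤ K * ‖A v‖ := hK.le_mul_norm (f := A) (map_zero A) v
    have h2 : c * (‖A v‖ ^ 2) < 1 := by rw [← real_inner_self_eq_norm_sq]; exact hv
    have h3 : ‖A v‖ ^ 2 < 1 / c := by rw [lt_div_iff₀ hc]; linarith
    have h4 : ‖A v‖ ≤ 1 + 1 / c := by nlinarith [norm_nonneg (A v)]
    exact h1.trans (mul_le_mul_of_nonneg_left h4 K.2)
  contMDiff := by
    intro z
    refine (Bundle.contMDiffAt_section z).2 ?_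
    have h := (contMDiff_circle_coe z).mfderiv_const (m := ∞) (by simp)
    refine ((contDiff_circleForm c).contMDiff.contMDiffAt.comp z h).congr_of_eventuallyEq ?_
    filter_upwards [(trivializationAt (EuclideanSpace ℝ (Fin 1))
      (fun x : Circle => TangentSpace (𝓡 1) x) z).open_baseSet.mem_nhds
        (mem_baseSet_trivializationAt _ _ z)] with x hx
    ext v w
    refine (inCoordinates_apply_eq₂ hx hx (Set.mem_univ _)).trans ?_
    have key : ∀ u, inTangentCoordinates (𝓡 1) 𝓘(ℝ, ℂ) id (fun z : Circle => (z : ℂ))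
        (mfderiv (𝓡 1) 𝓘(ℝ, ℂ) (fun z : Circle => (z : ℂ))) z x u =
        circleInclusionDeriv x ((trivializationAt (EuclideanSpace ℝ (Fin 1))
          (fun x : Circle => TangentSpace (𝓡 1) x) z).symm x u) := by
      intro u
      refine (DFunLike.congr_fun (ContinuousLinearMap.inCoordinates_eq (σ := RingHom.id ℝ) hx
        (by rw [TangentBundle.trivializationAt_baseSet, chartAt_self_eq]; trivial)) u).trans ?_
      simp
      rfl
    refine Eq.trans ?_ (circleForm_apply _ _ _ _).symm
    rw [key, key]
    have hl : ∀ r : ℝ, (trivializationAt ℝ (Bundle.Trivial Circle ℝ) z).linearMapAt ℝ x r = r := by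
      simp
    exact hl _

theorem circleMetric_apply (c : ℝ) (hc : 0 < c) (t a b : ℝ) :
    (circleMetric c hc).inner (Circle.exp t)
      (mfderiv 𝓘(ℝ, ℝ) (𝓡 1) Circle.exp t a) (mfderiv 𝓘(ℝ, ℝ) (𝓡 1) Circle.exp t b) =
      c * (a * b) := by
  have h1 : HasMFDerivAt 𝓘(ℝ, ℝ) 𝓘(ℝ, ℂ) (fun s : ℝ => (Circle.exp s : ℂ)) t
      ((circleInclusionDeriv (Circle.exp t)).comp (mfderiv 𝓘(ℝ, ℝ) (𝓡 1) Circle.exp t)) :=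
    HasMFDerivAt.comp t
      ((contMDiff_circle_coe.mdifferentiable (by simp) (Circle.exp t)).hasMFDerivAt)
      ((contMDiff_circleExp (m := ∞)).mdifferentiable (by simp) t).hasMFDerivAt
  have h2 : HasDerivAt (fun s : ℝ => (Circle.exp s : ℂ)) (Circle.exp t * Complex.I) t := by
    simp only [Circle.coe_exp]
    have := ((Complex.ofRealCLM.hasDerivAt (x := t)).mul_const Complex.I).cexp
    simpa using this
  have h3 : ∀ a : ℝ, circleInclusionDeriv (Circle.exp t)
      (mfderiv 𝓘(ℝ, ℝ) (𝓡 1) Circle.exp t a) = a • (Circle.exp t * Complex.I : ℂ) := fun a => by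
    let L : ℝ →L[ℝ] ℂ :=
      (circleInclusionDeriv (Circle.exp t)).comp (mfderiv 𝓘(ℝ, ℝ) (𝓡 1) Circle.exp t)
    have h1' : HasFDerivAt (fun s : ℝ => (Circle.exp s : ℂ)) L t :=
      hasMFDerivAt_iff_hasFDerivAt.1 h1
    have h4 := h1'.unique h2.hasFDerivAt
    exact congrArg (fun L : ℝ →L[ℝ] ℂ => L a) h4
  change c * inner ℝ (circleInclusionDeriv (Circle.exp t)
      (mfderiv 𝓘(ℝ, ℝ) (𝓡 1) Circle.exp t a)) (circleInclusionDeriv (Circle.exp t)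
      (mfderiv 𝓘(ℝ, ℝ) (𝓡 1) Circle.exp t b)) = _
  rw [h3, h3, real_inner_smul_left, real_inner_smul_right, real_inner_self_eq_norm_sq]
  simp

/-! ### Mapping tori -/

section Torus

variable {F : Type u} [TopologicalSpace F]

/-- The identification `(x, 0) ~ (η x, 2π)` on `F × [0, 2π]`. -/
inductive MappingTorusRel (η : F ≃ₜ F) :
    F × Icc (0 : ℝ) (2 * Real.pi) → F × Icc (0 : ℝ) (2 * Real.pi) → Prop
  | glue (x : F) : MappingTorusRel η
      (x, ⟨0, left_mem_Icc.2 Real.two_pi_pos.le⟩) (η x, ⟨2 * Real.pi, right_mem_Icc.2 Real.two_pi_pos.le⟩)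

/-- The mapping torus `F × [0, 2π] / (x, 0) ~ (η x, 2π)`. -/
def MappingTorus (η : F ≃ₜ F) : Type u := Quot (MappingTorusRel η)

namespace MappingTorus

/-- The quotient topology. -/
instance (η : F ≃ₜ F) : TopologicalSpace (MappingTorus η) :=
  inferInstanceAs (TopologicalSpace (Quot (MappingTorusRel η)))

/-- The quotient map `(x, t) ↦ [x, t]`. -/
def mk (η : F ≃ₜ F) (p : F × Icc (0 : ℝ) (2 * Real.pi)) : MappingTorus η := Quot.mk _ p

/-- The integer `k` with `2πk ≤ t < 2π(k + 1)`. -/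
noncomputable def winding (t : ℝ) : ℤ := ⌊t / (2 * Real.pi)⌋

theorem sub_winding_mem (t : ℝ) :
    t - winding t * (2 * Real.pi) ∈ Icc (0 : ℝ) (2 * Real.pi) := by
  have h := Real.two_pi_pos
  have h1 := Int.floor_le (t / (2 * Real.pi))
  have h2 := (Int.lt_floor_add_one (t / (2 * Real.pi))).le
  rw [le_div_iff₀ h] at h1
  rw [div_le_iff₀ h] at h2
  exact ⟨by unfold winding; linarith, by unfold winding; linarith⟩

/-- The canonical covering map `F × ℝ → F ×_η [0, 2π]`: the extension of `(x, t) ↦ [x, t]` that is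
invariant under the deck transformation `(x, t) ↦ (η x, t + 2π)`. -/
noncomputable def cover (η : F ≃ₜ F) (p : F × ℝ) : MappingTorus η :=
  mk η ((η ^ (-winding p.2)) p.1, ⟨p.2 - winding p.2 * (2 * Real.pi), sub_winding_mem p.2⟩)

theorem mk_glue (η : F ≃ₜ F) (x : F) :
    mk η (x, ⟨0, left_mem_Icc.2 Real.two_pi_pos.le⟩) =
      mk η (η x, ⟨2 * Real.pi, right_mem_Icc.2 Real.two_pi_pos.le⟩) :=
  Quot.sound (MappingTorusRel.glue x)

/-- `cover` on the strip `2πk ≤ t ≤ 2π(k+1)`. -/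
theorem cover_eq (η : F ≃ₜ F) (k : ℤ) (p : F × ℝ)
    (h : p.2 - k * (2 * Real.pi) ∈ Icc (0 : ℝ) (2 * Real.pi)) :
    cover η p = mk η ((η ^ (-k)) p.1, ⟨p.2 - k * (2 * Real.pi), h⟩) := by
  have hp := Real.two_pi_pos
  obtain ⟨x, t⟩ := p
  rcases h.2.lt_or_eq with h2 | h2
  · have : winding t = k := by
      unfold winding
      rw [Int.floor_eq_iff, le_div_iff₀ hp, div_lt_iff₀ hp]
      have := h.1
      constructor <;> simp only at * <;> linarith
    subst this; rfl
  · have hw : winding t = k + 1 := by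
      unfold winding
      rw [Int.floor_eq_iff, le_div_iff₀ hp, div_lt_iff₀ hp]
      push_cast
      constructor <;> simp only at * <;> linarith
    have e1 : cover η (x, t) = mk η ((η ^ (-(k + 1))) x, ⟨0, left_mem_Icc.2 hp.le⟩) := by
      unfold cover
      congr 2
      · simp only [hw]
      · apply Subtype.ext
        simp only [hw] at *
        push_cast
        linarith
    rw [e1, mk_glue]
    congr 2
    · change (η * η ^ (-(k + 1))) x = _
      rw [← zpow_one_add]
      congr 2; ring
    · apply Subtype.ext
      exact h2.symm

/-- On `F × [0, 2π]` the covering map is the quotient map. -/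
theorem mk_eq_cover (η : F ≃ₜ F) (p : F × Icc (0 : ℝ) (2 * Real.pi)) :
    mk η p = cover η (p.1, p.2) := by
  rw [cover_eq η 0 (p.1, (p.2 : ℝ)) (by simp)]
  refine congrArg (mk η) (Prod.ext ?_ (Subtype.ext ?_)) <;> simp

theorem cover_surjective (η : F ≃ₜ F) : Function.Surjective (cover η) := by
  rintro ⟨p⟩
  exact ⟨_, (mk_eq_cover η p).symm⟩

theorem cover_eq_mk_iff (η : F ≃ₜ F) (p : F × ℝ) (r : F × Icc (0 : ℝ) (2 * Real.pi)) :
    cover η p = mk η r ↔ ∃ k : ℤ, p = ((η ^ k) r.1, (r.2 : ℝ) + k * (2 * Real.pi)) := by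
  constructor
  · intro h
    let R : F × Icc (0 : ℝ) (2 * Real.pi) → Prop :=
      fun r => ∃ k : ℤ, p = ((η ^ k) r.1, (r.2 : ℝ) + k * (2 * Real.pi))
    have hR : ∀ a b, MappingTorusRel η a b → R a = R b := by
      rintro _ _ ⟨x⟩
      apply propext
      constructor
      · rintro ⟨k, hk⟩
        refine ⟨k - 1, hk.trans (Prod.ext ?_ ?_)⟩
        · change _ = (η ^ (k - 1) * η) x
          rw [← zpow_add_one, sub_add_cancel]
        · simp; ring
      · rintro ⟨k, hk⟩
        refine ⟨k + 1, hk.trans (Prod.ext ?_ ?_)⟩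
        · rw [zpow_add_one]; rfl
        · simp; ring
    have h3 : Quot.lift R hR (cover η p) = Quot.lift R hR (mk η r) := by rw [h]
    have h4 : R ((η ^ (-winding p.2)) p.1, ⟨p.2 - winding p.2 * (2 * Real.pi), sub_winding_mem p.2⟩)
      = R r := h3
    change R r
    rw [← h4]
    refine ⟨winding p.2, Prod.ext ?_ ?_⟩
    · change _ = (η ^ (winding p.2) * η ^ (-winding p.2)) p.1
      rw [← zpow_add, add_neg_cancel]; rfl
    · simp
  · rintro ⟨k, rfl⟩
    rw [cover_eq η k _ (by simp)]
    congr 2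
    · change (η ^ (-k) * η ^ k) r.1 = _
      rw [← zpow_add, neg_add_cancel]; rfl
    · apply Subtype.ext; simp

/-- The fibres of `cover` are the orbits of the deck transformation. -/
theorem cover_eq_cover_iff (η : F ≃ₜ F) (p p' : F × ℝ) :
    cover η p = cover η p' ↔ ∃ k : ℤ, p' = ((η ^ k) p.1, p.2 + k * (2 * Real.pi)) := by
  obtain ⟨r, hr⟩ : ∃ r, mk η r = cover η p := Quot.exists_rep (cover η p)
  obtain ⟨l, hl⟩ := (cover_eq_mk_iff η p r).1 hr.symm
  rw [← hr, eq_comm]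
  refine (cover_eq_mk_iff η p' r).trans ?_
  constructor
  · rintro ⟨k, rfl⟩
    refine ⟨k - l, Prod.ext ?_ ?_⟩
    · rw [hl]; change _ = (η ^ (k - l) * η ^ l) r.1
      rw [← zpow_add, sub_add_cancel]
    · rw [hl]; push_cast; ring
  · rintro ⟨k, rfl⟩
    refine ⟨k + l, Prod.ext ?_ ?_⟩
    · rw [hl, zpow_add]; rfl
    · rw [hl]; push_cast; ring

theorem continuous_cover (η : F ≃ₜ F) : Continuous (cover η) := by
  have hp := Real.two_pi_pos
  have key : ∀ k : ℤ, ContinuousOn (cover η)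
      {p | p.2 - k * (2 * Real.pi) ∈ Icc (0 : ℝ) (2 * Real.pi)} := by
    intro k
    rw [continuousOn_iff_continuous_domRestrict]
    have : domRestrict {p : F × ℝ | p.2 - k * (2 * Real.pi) ∈ Icc (0 : ℝ) (2 * Real.pi)} (cover η) =
        fun p => mk η ((η ^ (-k)) p.1.1, ⟨p.1.2 - k * (2 * Real.pi), p.2⟩) := by
      funext p
      exact cover_eq η k p.1 p.2
    rw [this]
    refine continuous_quot_mk.comp ?_
    have := (η ^ (-k)).continuous
    fun_prop
  have closed : ∀ k : ℤ, IsClosed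
      {p : F × ℝ | p.2 - k * (2 * Real.pi) ∈ Icc (0 : ℝ) (2 * Real.pi)} := fun k =>
    isClosed_Icc.preimage (by fun_prop)
  rw [continuous_iff_continuousAt]
  intro p
  set k := ⌊p.2 / (2 * Real.pi)⌋
  have h1 := Int.floor_le (p.2 / (2 * Real.pi))
  have h2 := Int.lt_floor_add_one (p.2 / (2 * Real.pi))
  rw [le_div_iff₀ hp] at h1
  rw [div_lt_iff₀ hp] at h2
  refine ((key (k - 1)).union_of_isClosed (key k) (closed _) (closed _)).continuousAt ?_
  have : {q : F × ℝ | q.2 ∈ Ioo ((k - 1 : ℝ) * (2 * Real.pi)) ((k + 1) * (2 * Real.pi))} ∈ nhds p := by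
    refine IsOpen.mem_nhds (isOpen_Ioo.preimage continuous_snd) ?_
    exact ⟨by linarith, h2⟩
  filter_upwards [this] with q hq
  have hq1 := hq.1
  have hq2 := hq.2
  rcases le_total q.2 (k * (2 * Real.pi)) with h | h
  · left
    refine ⟨?_, ?_⟩ <;> push_cast <;> linarith
  · right
    refine ⟨?_, ?_⟩ <;> linarith

theorem isOpenMap_cover (η : F ≃ₜ F) : IsOpenMap (cover η) := by
  intro U hU
  change IsOpen (Quot.mk (MappingTorusRel η) ⁻¹' (cover η '' U))
  have : Quot.mk (MappingTorusRel η) ⁻¹' (cover η '' U) =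
      ⋃ k : ℤ, (fun r : F × Icc (0 : ℝ) (2 * Real.pi) =>
        (((η ^ k) r.1, (r.2 : ℝ) + k * (2 * Real.pi)) : F × ℝ)) ⁻¹' U := by
    ext r
    simp only [mem_preimage, mem_iUnion]
    constructor
    · rintro ⟨p, hp, h⟩
      obtain ⟨k, hk⟩ := (cover_eq_mk_iff η p r).1 h
      exact ⟨k, hk ▸ hp⟩
    · rintro ⟨k, hk⟩
      exact ⟨_, hk, (cover_eq_mk_iff η _ r).2 ⟨k, rfl⟩⟩
  rw [this]
  refine isOpen_iUnion fun k => hU.preimage ?_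
  have := (η ^ k).continuous
  fun_prop

theorem isLocalHomeomorph_cover (η : F ≃ₜ F) : IsLocalHomeomorph (cover η) := by
  rw [isLocalHomeomorph_iff_isOpenEmbedding_restrict]
  intro p
  have hp := Real.two_pi_pos
  let U : Set (F × ℝ) := {q | q.2 ∈ Ioo (p.2 - Real.pi) (p.2 + Real.pi)}
  have hU : IsOpen U := isOpen_Ioo.preimage continuous_snd
  refine ⟨U, hU.mem_nhds ⟨by linarith, by linarith⟩, ?_⟩
  refine Topology.IsOpenEmbedding.of_continuous_injective_isOpenMap
    ((continuous_cover η).comp continuous_subtype_val) ?_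
    ((isOpenMap_cover η).comp hU.isOpenMap_subtype_val)
  rintro ⟨a, ha⟩ ⟨b, hb⟩ hab
  obtain ⟨k, hk⟩ := (cover_eq_cover_iff η a b).1 hab
  have h1 := ha.1
  have h2 := ha.2
  have h3 := hb.1
  have h4 := hb.2
  rw [hk] at h3 h4
  simp only at h3 h4
  have k1 : (k : ℝ) < 1 := by nlinarith
  have k2 : (-1 : ℝ) < k := by nlinarith
  have k0 : k = 0 := by
    have : k < 1 := by exact_mod_cast k1
    have : -1 < k := by exact_mod_cast k2
    omega
  subst k0
  refine Subtype.ext ?_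
  change a = b
  rw [hk]
  simp

section Smooth

variable {n : ℕ} [ChartedSpace (EuclideanSpace ℝ (Fin n)) F]

/-- The charts of the mapping torus: local inverses of `cover` followed by charts of `F × ℝ`.
For a diffeomorphism `η` this is the unique smooth structure for which `cover` is a local
diffeomorphism, see `isManifold` and `isLocalDiffeomorph_cover`. -/
noncomputable instance (η : F ≃ₜ F) :
    ChartedSpace (ModelProd (EuclideanSpace ℝ (Fin n)) ℝ) (MappingTorus η) :=
  (isLocalHomeomorph_cover η).chartedSpace (cover_surjective η)

theorem contMDiff_zpow (η : F ≃ₘ^∞⟮𝓡 n, 𝓡 n⟯ F) (k : ℤ) :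
    ContMDiff (𝓡 n) (𝓡 n) ∞ (η.toHomeomorph ^ k : F ≃ₜ F) := by
  have h1 : ∀ (e : F ≃ₜ F), ContMDiff (𝓡 n) (𝓡 n) ∞ e → ∀ k : ℕ,
      ContMDiff (𝓡 n) (𝓡 n) ∞ (e ^ k : F ≃ₜ F) := by
    intro e he k
    induction k with
    | zero => exact contMDiff_id
    | succ k ih => rw [pow_succ]; exact ih.comp he
  rcases k with k | k
  · simpa using h1 _ η.contMDiff k
  · rw [zpow_negSucc, ← inv_pow]
    exact h1 _ η.symm.contMDiff (k + 1)

theorem contMDiffAt_localInverse_cover (η : F ≃ₘ^∞⟮𝓡 n, 𝓡 n⟯ F) (z p : F × ℝ)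
    (hp : cover η.toHomeomorph p ∈
      ((isLocalHomeomorph_cover η.toHomeomorph).localInverseAt z).source) :
    ContMDiffAt ((𝓡 n).prod 𝓘(ℝ, ℝ)) ((𝓡 n).prod 𝓘(ℝ, ℝ)) ∞
      (fun q => (isLocalHomeomorph_cover η.toHomeomorph).localInverseAt z
        (cover η.toHomeomorph q)) p := by
  set h := isLocalHomeomorph_cover η.toHomeomorph
  set L := h.localInverseAt z
  obtain ⟨k, hk⟩ := (cover_eq_cover_iff η.toHomeomorph p (L (cover η.toHomeomorph p))).1
    (h.apply_localInverseAt_of_mem hp).symm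
  let D : F × ℝ → F × ℝ := fun q => ((η.toHomeomorph ^ k) q.1, q.2 + k * (2 * Real.pi))
  have hD : ContMDiff ((𝓡 n).prod 𝓘(ℝ, ℝ)) ((𝓡 n).prod 𝓘(ℝ, ℝ)) ∞ D := by
    refine ((contMDiff_zpow η k).comp contMDiff_fst).prodMk ?_
    have : ContMDiff 𝓘(ℝ, ℝ) 𝓘(ℝ, ℝ) ∞ (fun t : ℝ => t + k * (2 * Real.pi)) :=
      contMDiff_iff_contDiff.2 (by fun_prop)
    exact this.comp contMDiff_snd
  refine hD.contMDiffAt.congr_of_eventuallyEq ?_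
  have e1 : ∀ᶠ q in nhds p, cover η.toHomeomorph q ∈ L.source :=
    (continuous_cover η.toHomeomorph).continuousAt.eventually (L.open_source.mem_nhds hp)
  have hDp : D p ∈ L.target := by
    change ((η.toHomeomorph ^ k) p.1, p.2 + k * (2 * Real.pi)) ∈ L.target
    rw [← hk]; exact L.map_source hp
  have e2 : ∀ᶠ q in nhds p, D q ∈ L.target :=
    hD.continuous.continuousAt.eventually (L.open_target.mem_nhds hDp)
  filter_upwards [e1, e2] with q h1 h2
  refine h.injOn_localInverseAt_target (L.map_source h1) h2 ?_
  rw [h.apply_localInverseAt_of_mem h1]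
  exact (cover_eq_cover_iff _ _ _).2 ⟨k, rfl⟩

theorem contMDiff_cover (η : F ≃ₘ^∞⟮𝓡 n, 𝓡 n⟯ F) :
    ContMDiff ((𝓡 n).prod 𝓘(ℝ, ℝ)) ((𝓡 n).prod 𝓘(ℝ, ℝ)) ∞ (cover η.toHomeomorph) := by
  intro p
  set h := isLocalHomeomorph_cover η.toHomeomorph
  set z := (cover_surjective η.toHomeomorph).hasRightInverse.choose (cover η.toHomeomorph p) with hz
  have hcz : cover η.toHomeomorph z = cover η.toHomeomorph p :=
    (cover_surjective η.toHomeomorph).hasRightInverse.choose_spec _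
  have hp : cover η.toHomeomorph p ∈ (h.localInverseAt z).source := by
    rw [← hcz]; exact h.apply_self_mem_localInverseAt_source
  have c1 := contMDiffAt_localInverse_cover η z p hp
  rw [contMDiffAt_iff_target]
  refine ⟨(continuous_cover _).continuousAt, ?_⟩
  have hz' : h.localInverseAt z (cover η.toHomeomorph p) = z := by
    rw [← hcz]; exact h.localInverseAt_apply_self
  have c2 : ContMDiffAt ((𝓡 n).prod 𝓘(ℝ, ℝ)) 𝓘(ℝ, EuclideanSpace ℝ (Fin n) × ℝ) ∞
      (extChartAt ((𝓡 n).prod 𝓘(ℝ, ℝ)) z) (h.localInverseAt z (cover η.toHomeomorph p)) := by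
    rw [hz']; exact contMDiffAt_extChartAt
  exact ContMDiffAt.comp (f := fun q => h.localInverseAt z (cover η.toHomeomorph q)) p c2 c1

variable [IsManifold (𝓡 n) ∞ F]

instance isManifold (η : F ≃ₘ^∞⟮𝓡 n, 𝓡 n⟯ F) :
    IsManifold ((𝓡 n).prod 𝓘(ℝ, ℝ)) ∞ (MappingTorus η.toHomeomorph) := by
  apply isManifold_of_contDiffOn
  rintro _ _ ⟨a, rfl⟩ ⟨b, rfl⟩
  set h := isLocalHomeomorph_cover η.toHomeomorph
  set s := (cover_surjective η.toHomeomorph).hasRightInverse.choose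
  rw [← contMDiffOn_iff_contDiffOn]
  rintro x ⟨hx, -⟩
  simp only [mem_preimage, OpenPartialHomeomorph.trans_source, OpenPartialHomeomorph.symm_source,
    OpenPartialHomeomorph.trans_target, mem_inter_iff,
    OpenPartialHomeomorph.coe_trans_symm, Function.comp_apply, h.localInverseAt_symm] at hx
  obtain ⟨⟨h1, h2⟩, h3, h4⟩ := hx
  have c0 := ((((𝓡 n).prod 𝓘(ℝ, ℝ)).contMDiffOn_symm (n := ∞)) x (by simp)).contMDiffAt
    (by simp)
  have c1 := (contMDiffOn_chart_symm (I := (𝓡 n).prod 𝓘(ℝ, ℝ)) (n := ∞) (x := s a)).contMDiffAt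
    ((chartAt _ (s a)).open_target.mem_nhds h1)
  have c2 := contMDiffAt_localInverse_cover η (s b) _ h3
  have c3 := (contMDiffOn_chart (I := (𝓡 n).prod 𝓘(ℝ, ℝ)) (n := ∞) (x := s b)).contMDiffAt
    ((chartAt _ (s b)).open_source.mem_nhds h4)
  have c4 := (((𝓡 n).prod 𝓘(ℝ, ℝ)).contMDiff (n := ∞)).contMDiffAt
    (x := chartAt (ModelProd (EuclideanSpace ℝ (Fin n)) ℝ) (s b) (h.localInverseAt (s b)
      (cover η.toHomeomorph ((chartAt (ModelProd (EuclideanSpace ℝ (Fin n)) ℝ) (s a)).symm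
        (((𝓡 n).prod 𝓘(ℝ, ℝ)).symm x)))))
  have d0 := c1.comp x c0
  have d1 := ContMDiffAt.comp
    (f := fun q => h.localInverseAt (s b) (cover η.toHomeomorph q)) _ (c4.comp _ c3) c2
  have := ContMDiffAt.comp (f := (chartAt (ModelProd (EuclideanSpace ℝ (Fin n)) ℝ) (s a)).symm ∘
    ((𝓡 n).prod 𝓘(ℝ, ℝ)).symm) x d1 d0
  refine (this.congr_of_eventuallyEq (Filter.Eventually.of_forall fun y => ?_)).contMDiffWithinAt
  simp only [Function.comp_apply, OpenPartialHomeomorph.coe_trans,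
    OpenPartialHomeomorph.coe_trans_symm, h.localInverseAt_symm]

theorem isLocalDiffeomorph_cover (η : F ≃ₘ^∞⟮𝓡 n, 𝓡 n⟯ F) :
    IsLocalDiffeomorph ((𝓡 n).prod 𝓘(ℝ, ℝ)) ((𝓡 n).prod 𝓘(ℝ, ℝ)) ∞ (cover η.toHomeomorph) := by
  intro z
  set h := isLocalHomeomorph_cover η.toHomeomorph
  have hs : ⇑(h.localInverseAt z).symm = cover η.toHomeomorph := h.localInverseAt_symm z
  refine ⟨{ (h.localInverseAt z).symm with
    contMDiffOn_toFun := ?_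
    contMDiffOn_invFun := ?_ }, h.self_mem_localInverseAt_target, fun x _ => (congrFun hs x).symm⟩
  · refine (contMDiff_cover η).contMDiffOn.congr fun x _ => congrFun hs x
  · intro y hy
    set w := (cover_surjective η.toHomeomorph).hasRightInverse.choose y with hw
    have hcw : cover η.toHomeomorph w = y :=
      (cover_surjective η.toHomeomorph).hasRightInverse.choose_spec _
    have hy' : y ∈ (h.localInverseAt w).source :=
      hcw.subst (motive := fun v => v ∈ (h.localInverseAt w).source)
        h.apply_self_mem_localInverseAt_source
    have hyw : h.localInverseAt w y = w :=
      hcw.subst (motive := fun v => h.localInverseAt w v = w) h.localInverseAt_apply_self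
    have c1 : ContMDiffAt ((𝓡 n).prod 𝓘(ℝ, ℝ)) 𝓘(ℝ, EuclideanSpace ℝ (Fin n) × ℝ) ∞
        (fun u => extChartAt ((𝓡 n).prod 𝓘(ℝ, ℝ)) w (h.localInverseAt w u)) y :=
      contMDiffAt_extChartAt (I := (𝓡 n).prod 𝓘(ℝ, ℝ)) (x := y)
    have c2 := (contMDiffOn_extChartAt_symm (I := (𝓡 n).prod 𝓘(ℝ, ℝ)) (n := ∞) w).contMDiffAt
      (extChartAt_target_mem_nhds (I := (𝓡 n).prod 𝓘(ℝ, ℝ)) w)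
    have c3 : ContMDiffAt ((𝓡 n).prod 𝓘(ℝ, ℝ)) ((𝓡 n).prod 𝓘(ℝ, ℝ)) ∞
        (h.localInverseAt w) y := by
      have c2' : ContMDiffAt 𝓘(ℝ, EuclideanSpace ℝ (Fin n) × ℝ) ((𝓡 n).prod 𝓘(ℝ, ℝ)) ∞
          (extChartAt ((𝓡 n).prod 𝓘(ℝ, ℝ)) w).symm
          (extChartAt ((𝓡 n).prod 𝓘(ℝ, ℝ)) w (h.localInverseAt w y)) := by
        rw [hyw]; exact c2
      refine (ContMDiffAt.comp (f := fun u => extChartAt ((𝓡 n).prod 𝓘(ℝ, ℝ)) w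
        (h.localInverseAt w u)) y c2' c1).congr_of_eventuallyEq ?_
      have : (h.localInverseAt w) ⁻¹' (extChartAt ((𝓡 n).prod 𝓘(ℝ, ℝ)) w).source ∈ nhds y := by
        refine ((h.localInverseAt w).continuousAt hy').preimage_mem_nhds ?_
        rw [hyw]; exact extChartAt_source_mem_nhds w
      filter_upwards [this] with u hu
      exact ((extChartAt ((𝓡 n).prod 𝓘(ℝ, ℝ)) w).left_inv hu).symm
    have c4 := contMDiffAt_localInverse_cover η z w (by rw [hcw]; exact hy)
    rw [← hyw] at c4
    refine ((c4.comp y c3).congr_of_eventuallyEq ?_).contMDiffWithinAt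
    filter_upwards [(h.localInverseAt w).open_source.mem_nhds hy'] with u hu
    simp only [Function.comp_apply]
    rw [h.apply_localInverseAt_of_mem hu]
    rfl

end Smooth

end MappingTorus
end Torus

/-! ### Jacobi's formula and Liouville's formula -/

section Liouville

/-! Write c = 1/|λ| and let α be the pullback of dt by π (`angleForm`). The vector field X with g(X,
·) = c α is orthogonal to ker dπ, and for a Riemannian submersion it satisfies α(X) = 1
(`IsRiemannianSubmersion.angleForm_dual`). By compactness X has a smooth global flow φ
(`exists_flow`), and π(φ_t p) = e^{it} π(p) (`proj_flow`). Let M₀ be the hypersurface π⁻¹(1). Then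
Φ(x, t) = φ_t(x) is a local diffeomorphism of M₀ × ℝ onto M. It sends ∂_t to X, which has squared
length c and is orthogonal to the slices, so the metric becomes g(t) + c dt²
(`IsAngleFlow.isHorizontalTube`). Two points have the same image exactly when they lie in one orbit
of (x, t) ↦ (η x, t + 2π), where η is φ_{-2π} on M₀ (`IsAngleFlow.tube_eq_iff`). Hence Φ descends to
a diffeomorphism from the mapping torus (`MappingTorus.exists_diffeomorph`).

Harmonicity is the condition on volumes. Locally π = e^{iθ} with grad θ = X/c. Since t is an affine
parameter of the circle, the Christoffel term cancels the second derivatives of the chart of the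
circle, and the tension field is div X up to a nonzero factor (`tensionField_circle`). By
Liouville's formula (`hasDerivAt_mul_det_fderiv`), div X is the logarithmic rate of change of volume
along the flow; on M₀ × ℝ the volume density is √c times that of g(t). So the tension field vanishes
exactly where the density of g(t) is stationary (`IsHorizontalTube.tensionField_eq_zero_iff`).

Both directions meet in `IsHorizontalTube`. For the converse, the covering of the mapping torus
composed with the given diffeomorphism is a horizontal tube (`MappingTorus.isHorizontalTube`), which
makes π a Riemannian submersion, and constancy of the density then gives harmonicity.

Two analytic facts are proved along the way: flows are smooth in time and initial point, by the
inverse function theorem in a space of continuous curves (`ContDiff.exists_local_flow`), and fibres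
of submersions to the circle are manifolds (`exists_sliceChart`). -/

theorem contDiff_matrix_det {m : ℕ} {n : WithTop ℕ∞} :
    ContDiff ℝ n (fun B : Fin m → Fin m → ℝ => (Matrix.of B).det) := by
  simp only [Matrix.det_apply, Matrix.of_apply]
  refine ContDiff.sum fun σ _ => ContDiff.const_smul _ (contDiff_prod fun i _ => ?_)
  fun_prop

/-- Jacobi's formula for the derivative of a determinant. -/
theorem hasDerivAt_det_of_mul {m : ℕ} {B : ℝ → Matrix (Fin m) (Fin m) ℝ}
    {C : Matrix (Fin m) (Fin m) ℝ} {t₀ : ℝ}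
    (hB : ∀ i j, HasDerivAt (fun t => B t i j) ((C * B t₀) i j) t₀) :
    HasDerivAt (fun t => (B t).det) (C.trace * (B t₀).det) t₀ := by
  let D : (Fin m → Fin m → ℝ) → ℝ := fun B => (Matrix.of B).det
  have hD : HasFDerivAt D (fderiv ℝ D (B t₀)) (B t₀) :=
    ((contDiff_matrix_det (n := 1)).differentiable (by simp) _).hasFDerivAt
  have hB' : HasDerivAt (F := Fin m → Fin m → ℝ) B (C * B t₀) t₀ :=
    hasDerivAt_pi.2 fun i => hasDerivAt_pi.2 fun j => hB i j
  have h1 : HasDerivAt (fun t => D (B t)) (fderiv ℝ D (B t₀) (C * B t₀)) t₀ :=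
    hD.comp_hasDerivAt t₀ hB'
  -- Only the velocity of the curve at `t₀` matters, so B may be replaced by an affine curve, on
  -- which the determinant is det(1 + sC) det B(t₀).
  let A : ℝ → (Fin m → Fin m → ℝ) := fun s => B t₀ + s • (C * B t₀)
  have hA : HasDerivAt A (C * B t₀) 0 := by
    refine hasDerivAt_pi.2 fun i => hasDerivAt_pi.2 fun j => ?_
    change HasDerivAt (fun s => B t₀ i j + s * (C * B t₀) i j) ((C * B t₀) i j) 0
    simpa using ((hasDerivAt_id (0 : ℝ)).mul_const ((C * B t₀) i j)).const_add (B t₀ i j)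
  have hA0 : A 0 = B t₀ := by
    simp only [A, zero_smul, add_zero]
    rfl
  have h2 : HasDerivAt (fun s => D (A s)) (fderiv ℝ D (B t₀) (C * B t₀)) 0 := by
    rw [← hA0] at hD
    rw [← hA0]
    rw [← hA0] at hA
    exact hD.comp_hasDerivAt 0 hA
  have h3 : (fun s => D (A s)) = fun s => (1 + s • C).det * (B t₀).det := by
    funext s
    rw [← Matrix.det_mul, add_mul, one_mul, smul_mul_assoc]
    rfl
  have h4 : HasDerivAt (fun s : ℝ => (1 + s • C).det * (B t₀).det)
      (C.trace * (B t₀).det) 0 := by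
    refine HasDerivAt.mul_const ?_ _
    rw [funext fun s : ℝ => Matrix.det_one_add_smul s C]
    have := ((((hasDerivAt_id (0 : ℝ)).const_mul C.trace).const_add 1).add
      ((Polynomial.hasDerivAt (Matrix.det (1 + (Polynomial.X : Polynomial ℝ) •
        C.map Polynomial.C)).divX.divX 0).mul ((hasDerivAt_id (0 : ℝ)).pow 2)))
    convert! this using 1; simp
  rw [h3] at h2
  rw [← h2.unique h4]
  exact h1

theorem EuclideanSpace.fderiv_coord {V : Type*} [NormedAddCommGroup V] [NormedSpace ℝ V] {m : ℕ}
    {f : V → EuclideanSpace ℝ (Fin m)} {x : V} (hf : DifferentiableAt ℝ f x) (i : Fin m) (u : V) :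
    fderiv ℝ (fun z => f z i) x u = fderiv ℝ f x u i := by
  have : HasFDerivAt (fun z => f z i) ((EuclideanSpace.proj i).comp (fderiv ℝ f x)) x :=
    (EuclideanSpace.proj (𝕜 := ℝ) i).hasFDerivAt.comp x hf.hasFDerivAt
  rw [this.fderiv]
  rfl

theorem EuclideanSpace.differentiableAt_coord {V : Type*} [NormedAddCommGroup V] [NormedSpace ℝ V]
    {m : ℕ} {f : V → EuclideanSpace ℝ (Fin m)} {x : V} (hf : DifferentiableAt ℝ f x) (i : Fin m) :
    DifferentiableAt ℝ (fun z => f z i) x :=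
  (EuclideanSpace.proj (𝕜 := ℝ) i).differentiableAt.comp x hf

theorem EuclideanSpace.eq_sum_single {m : ℕ} (v : EuclideanSpace ℝ (Fin m)) :
    v = ∑ k, v k • EuclideanSpace.single k (1 : ℝ) := by
  ext i
  simp [Finset.sum_apply, Pi.single_apply]

theorem EuclideanSpace.clm_apply_eq_sum {m : ℕ} {V : Type*} [AddCommGroup V] [Module ℝ V]
    [TopologicalSpace V] (L : EuclideanSpace ℝ (Fin m) →L[ℝ] V) (v : EuclideanSpace ℝ (Fin m)) :
    L v = ∑ k, v k • L (EuclideanSpace.single k 1) := by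
  conv_lhs => rw [EuclideanSpace.eq_sum_single v]
  simp

/-- Liouville's formula: along a family `ψ` of integral curves of `X`, the density `ρ` changes at
the rate of the divergence of `ρ X`. -/
theorem hasDerivAt_mul_det_fderiv {m : ℕ} {V : Type*} [NormedAddCommGroup V] [NormedSpace ℝ V]
    {ψ : V × ℝ → EuclideanSpace ℝ (Fin m)} {w₀ : V} {t₀ : ℝ} (hψ : ContDiffAt ℝ 2 ψ (w₀, t₀))
    {X : EuclideanSpace ℝ (Fin m) → EuclideanSpace ℝ (Fin m)}
    (hX : DifferentiableAt ℝ X (ψ (w₀, t₀)))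
    {ρ : EuclideanSpace ℝ (Fin m) → ℝ} (hρ : DifferentiableAt ℝ ρ (ψ (w₀, t₀)))
    (hflow : ∀ᶠ p in nhds (w₀, t₀), fderiv ℝ ψ p (0, 1) = X (ψ p)) (u : Fin m → V × ℝ) :
    HasDerivAt (fun t => ρ (ψ (w₀, t)) *
        (Matrix.of fun i j => fderiv ℝ ψ (w₀, t) (u j) i).det)
      ((∑ j, partialDeriv j (fun z => ρ z * X z j) (ψ (w₀, t₀))) *
        (Matrix.of fun i j => fderiv ℝ ψ (w₀, t₀) (u j) i).det) t₀ := by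
  set z₀ := ψ (w₀, t₀) with hz₀
  have hψ1 : DifferentiableAt ℝ ψ (w₀, t₀) := hψ.differentiableAt (by simp)
  have hψ2 : DifferentiableAt ℝ (fderiv ℝ ψ) (w₀, t₀) :=
    (hψ.fderiv_right (m := 1) (by norm_num)).differentiableAt (by simp)
  have hsymm : IsSymmSndFDerivAt ℝ ψ (w₀, t₀) := hψ.isSymmSndFDerivAt (by simp)
  have hline : HasDerivAt (fun t : ℝ => (w₀, t)) ((0, 1) : V × ℝ) t₀ :=
    (hasDerivAt_const t₀ w₀).prodMk (hasDerivAt_id t₀)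
  have hcurve : HasDerivAt (fun t => ψ (w₀, t)) (X z₀) t₀ := by
    rw [hz₀, ← hflow.self_of_nhds]
    exact hψ1.hasFDerivAt.comp_hasDerivAt t₀ hline
  have hρ' : HasDerivAt (fun t => ρ (ψ (w₀, t))) (fderiv ℝ ρ z₀ (X z₀)) t₀ :=
    hρ.hasFDerivAt.comp_hasDerivAt t₀ hcurve
  -- The variational equation: the flow equation is differentiated in the direction v, and symmetry
  -- of the second derivative exchanges v with ∂_t.
  have hA : ∀ v, HasDerivAt (fun t => fderiv ℝ ψ (w₀, t) v)
      (fderiv ℝ X z₀ (fderiv ℝ ψ (w₀, t₀) v)) t₀ := by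
    intro v
    have h1 : HasDerivAt (fun t => fderiv ℝ ψ (w₀, t))
        (fderiv ℝ (fderiv ℝ ψ) (w₀, t₀) (0, 1)) t₀ :=
      hψ2.hasFDerivAt.comp_hasDerivAt t₀ hline
    have h2 := h1.clm_apply (hasDerivAt_const t₀ v)
    have h3 : HasFDerivAt (fun p => fderiv ℝ ψ p (0, 1))
        ((fderiv ℝ X z₀).comp (fderiv ℝ ψ (w₀, t₀))) (w₀, t₀) :=
      (hX.hasFDerivAt.comp (w₀, t₀) hψ1.hasFDerivAt).congr_of_eventuallyEq hflow
    have h4 : HasFDerivAt (fun p => fderiv ℝ ψ p (0, 1))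
        ((fderiv ℝ (fderiv ℝ ψ) (w₀, t₀)).flip (0, 1)) (w₀, t₀) := by
      have := hψ2.hasFDerivAt.clm_apply (hasFDerivAt_const ((0, 1) : V × ℝ) (w₀, t₀))
      simpa using this
    have h5 : fderiv ℝ X z₀ (fderiv ℝ ψ (w₀, t₀) v) =
        fderiv ℝ (fderiv ℝ ψ) (w₀, t₀) v (0, 1) := by
      have := congrArg (fun L => L v) (h3.unique h4)
      simpa using this
    rw [h5, hsymm.eq]
    simpa using h2
  -- C is the matrix of DX, so the determinant grows at the rate tr C = div X.
  let C : Matrix (Fin m) (Fin m) ℝ :=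
    Matrix.of fun i k => fderiv ℝ X z₀ (EuclideanSpace.single k 1) i
  have hdet := hasDerivAt_det_of_mul
    (B := fun t => Matrix.of fun i j => fderiv ℝ ψ (w₀, t) (u j) i) (C := C) (t₀ := t₀) (by
      intro i j
      have h1 := (EuclideanSpace.proj (𝕜 := ℝ) i).hasFDerivAt.comp_hasDerivAt t₀ (hA (u j))
      have h2 : (C * Matrix.of fun i j => fderiv ℝ ψ (w₀, t₀) (u j) i) i j =
          fderiv ℝ X z₀ (fderiv ℝ ψ (w₀, t₀) (u j)) i := by
        rw [EuclideanSpace.clm_apply_eq_sum (fderiv ℝ X z₀)]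
        simp [Matrix.mul_apply, C, mul_comm]
      rw [h2]
      exact h1)
  refine (hρ'.mul hdet).congr_deriv ?_
  have hdiv : ∑ j, partialDeriv j (fun z => ρ z * X z j) z₀ =
      fderiv ℝ ρ z₀ (X z₀) + ρ z₀ * C.trace := by
    have : ∀ j, partialDeriv j (fun z => ρ z * X z j) z₀ =
        X z₀ j * fderiv ℝ ρ z₀ (EuclideanSpace.single j 1) + ρ z₀ * C j j := by
      intro j
      unfold partialDeriv
      rw [fderiv_fun_mul hρ (EuclideanSpace.differentiableAt_coord hX j)]
      simp only [add_apply, smul_apply, smul_eq_mul]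
      rw [EuclideanSpace.fderiv_coord hX, add_comm]
      rfl
    simp only [this, Finset.sum_add_distrib]
    rw [EuclideanSpace.clm_apply_eq_sum (fderiv ℝ ρ z₀) (X z₀), Matrix.trace, Finset.mul_sum]
    simp
  rw [hdiv]
  ring

end Liouville

/-! ### Smoothness of metric coefficients -/

section TangentLift

variable {EM : Type*} [NormedAddCommGroup EM] [NormedSpace ℝ EM]
  {HM : Type*} [TopologicalSpace HM] {IM : ModelWithCorners ℝ EM HM}
  {M : Type*} [TopologicalSpace M] [ChartedSpace HM M]
  {EN : Type*} [NormedAddCommGroup EN] [NormedSpace ℝ EN]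
  {HN : Type*} [TopologicalSpace HN] {IN : ModelWithCorners ℝ EN HN}
  {N : Type*} [TopologicalSpace N] [ChartedSpace HN N]
  {EP : Type*} [NormedAddCommGroup EP] [NormedSpace ℝ EP]
  {HP : Type*} [TopologicalSpace HP] {IP : ModelWithCorners ℝ EP HP}
  {P : Type*} [TopologicalSpace P] [ChartedSpace HP P]

/-- A smooth map acts smoothly on vector fields along maps. -/
theorem ContMDiffAt.mfderiv_lift [IsManifold IM ∞ M] [IsManifold IN ∞ N] {f : M → N} {b : P → M}
    {v : ∀ p, TangentSpace IM (b p)} {p : P} (hf : ContMDiffAt IM IN ∞ f (b p))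
    (hv : ContMDiffAt IP IM.tangent ∞ (fun q => (⟨b q, v q⟩ : TangentBundle IM M)) p) :
    ContMDiffAt IP IN.tangent ∞
      (fun q => (⟨f (b q), mfderiv IM IN f (b q) (v q)⟩ : TangentBundle IN N)) p := by
  have hb : ContMDiffAt IP IM ∞ b p := (Bundle.contMDiffAt_totalSpace.1 hv).1
  have h1 := (hf.mfderiv_const (m := ∞) (by simp)).comp p hb
  exact ContMDiffAt.clm_apply_of_inCoordinates (b₁ := b) (b₂ := f ∘ b)
    (ϕ := fun q => mfderiv IM IN f (b q)) h1 hv (hf.comp p hb)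

theorem contMDiffAt_lift_vectorSpace {V : Type*} [NormedAddCommGroup V] [NormedSpace ℝ V]
    {b v : P → V} {p : P} (hb : ContMDiffAt IP 𝓘(ℝ, V) ∞ b p) (hv : ContMDiffAt IP 𝓘(ℝ, V) ∞ v p) :
    ContMDiffAt IP 𝓘(ℝ, V).tangent ∞ (fun q => (⟨b q, v q⟩ : TangentBundle 𝓘(ℝ, V) V)) p := by
  refine Bundle.contMDiffAt_totalSpace.2 ⟨hb, hv.congr_of_eventuallyEq ?_⟩
  exact Filter.Eventually.of_forall fun q => by simp

/-- The vector fields along `b` obtained from constant vectors are smooth. -/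
theorem contMDiffAt_mfderiv_const {V : Type*} [NormedAddCommGroup V] [NormedSpace ℝ V]
    [IsManifold IN ∞ N] {b : V → N} {z : V} (hb : ContMDiffAt 𝓘(ℝ, V) IN ∞ b z) (v : V) :
    ContMDiffAt 𝓘(ℝ, V) IN.tangent ∞
      (fun q => (⟨b q, mfderiv 𝓘(ℝ, V) IN b q v⟩ : TangentBundle IN N)) z :=
  ContMDiffAt.mfderiv_lift (b := id) (v := fun _ => v) hb
    (contMDiffAt_lift_vectorSpace contMDiffAt_id contMDiffAt_const)

end TangentLift

/-! ### Gram matrices of a metric in charts -/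

section Metric

variable {m : ℕ} {M : Type*} [TopologicalSpace M] [ChartedSpace (EuclideanSpace ℝ (Fin m)) M]
  [IsManifold (𝓡 m) ∞ M]
  {EP : Type*} [NormedAddCommGroup EP] [NormedSpace ℝ EP]
  {HP : Type*} [TopologicalSpace HP] {IP : ModelWithCorners ℝ EP HP}
  {P : Type*} [TopologicalSpace P] [ChartedSpace HP P]

theorem SmoothMetric.contMDiffAt_inner (g : SmoothMetric m M) {b : P → M}
    {v w : ∀ p, TangentSpace (𝓡 m) (b p)} {p : P}
    (hv : ContMDiffAt IP (𝓡 m).tangent ∞ (fun q => (⟨b q, v q⟩ : TangentBundle (𝓡 m) M)) p)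
    (hw : ContMDiffAt IP (𝓡 m).tangent ∞ (fun q => (⟨b q, w q⟩ : TangentBundle (𝓡 m) M)) p) :
    ContMDiffAt IP 𝓘(ℝ, ℝ) ∞ (fun q => g.inner (b q) (v q) (w q)) p := by
  have hb : ContMDiffAt IP (𝓡 m) ∞ b p := (Bundle.contMDiffAt_totalSpace.1 hv).1
  have : ContMDiffAt IP ((𝓡 m).prod 𝓘(ℝ)) ∞
      (fun q => Bundle.TotalSpace.mk' ℝ (E := Bundle.Trivial M ℝ) (b q)
        (g.inner (b q) (v q) (w q))) p :=
    ContMDiffAt.clm_bundle_apply₂ (F₁ := EuclideanSpace ℝ (Fin m))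
      (F₂ := EuclideanSpace ℝ (Fin m)) (g.contMDiff.contMDiffAt.comp p hb) hv hw
  rw [Bundle.contMDiffAt_totalSpace] at this
  exact this.2

theorem SmoothMetric.contDiffAt_inner_mfderiv {V : Type*} [NormedAddCommGroup V] [NormedSpace ℝ V]
    (g : SmoothMetric m M) {b : V → M} {z : V} (hb : ContMDiffAt 𝓘(ℝ, V) (𝓡 m) ∞ b z) (v w : V) :
    ContDiffAt ℝ ∞ (fun q => g.inner (b q) (mfderiv 𝓘(ℝ, V) (𝓡 m) b q v)
      (mfderiv 𝓘(ℝ, V) (𝓡 m) b q w)) z :=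
  contMDiffAt_iff_contDiffAt.1 (g.contMDiffAt_inner (contMDiffAt_mfderiv_const hb v)
    (contMDiffAt_mfderiv_const hb w))

variable (g : SmoothMetric m M) {e : OpenPartialHomeomorph M (EuclideanSpace ℝ (Fin m))}
  {z : EuclideanSpace ℝ (Fin m)}

omit [IsManifold (𝓡 m) ∞ M] in
theorem mdifferentiable_of_mem_maximalAtlas (he : e ∈ IsManifold.maximalAtlas (𝓡 m) ∞ M) : e.MDifferentiable (𝓡 m) (𝓡 m) :=
  ⟨(contMDiffOn_of_mem_maximalAtlas he).mdifferentiableOn (by simp),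
    (contMDiffOn_symm_of_mem_maximalAtlas he).mdifferentiableOn (by simp)⟩

theorem contDiffAt_metricMatrix (he : e ∈ IsManifold.maximalAtlas (𝓡 m) ∞ M) (hz : z ∈ e.target)
    (i j : Fin m) : ContDiffAt ℝ ∞ (fun z => metricMatrix g e z i j) z :=
  g.contDiffAt_inner_mfderiv (contMDiffAt_symm_of_mem_maximalAtlas he hz) _ _

theorem SmoothMetric.inner_sum_sum {ι : Type*} [Fintype ι] {p : M} (a b : ι → ℝ)
    (s : ι → TangentSpace (𝓡 m) p) :
    g.inner p (∑ i, a i • s i) (∑ j, b j • s j) =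
      a ⬝ᵥ (Matrix.of fun i j => g.inner p (s i) (s j)).mulVec b := by
  simp only [map_sum, map_smul, sum_apply, smul_apply, smul_eq_mul, dotProduct, Matrix.mulVec,
    Matrix.of_apply, Finset.mul_sum]
  rw [Finset.sum_comm]
  refine Finset.sum_congr rfl fun i _ => Finset.sum_congr rfl fun j _ => ?_
  ring

theorem metricMatrix_dotProduct (p : EuclideanSpace ℝ (Fin m)) (a b : Fin m → ℝ) :
    a ⬝ᵥ (metricMatrix g e p).mulVec b = g.inner (e.symm p)
      (mfderiv (𝓡 m) (𝓡 m) e.symm p (WithLp.toLp 2 a))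
      (mfderiv (𝓡 m) (𝓡 m) e.symm p (WithLp.toLp 2 b)) := by
  have h : ∀ a : Fin m → ℝ, mfderiv (𝓡 m) (𝓡 m) e.symm p (WithLp.toLp 2 a) =
      ∑ i, a i • mfderiv (𝓡 m) (𝓡 m) e.symm p (EuclideanSpace.single i (1 : ℝ)) :=
    fun a => EuclideanSpace.clm_apply_eq_sum
      (V := EuclideanSpace ℝ (Fin m)) (mfderiv (𝓡 m) (𝓡 m) e.symm p) (WithLp.toLp 2 a)
  rw [h, h]
  exact (g.inner_sum_sum _ _ _).symm

/-- The quadratic form of the Gram matrix at a is the squared length of ∑ aᵢ sᵢ. The index type is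
arbitrary because the frames in use are indexed both by `Fin m` and by `Fin n ⊕ Fin 1`. -/
theorem SmoothMetric.gram_posDef {ι : Type*} [Fintype ι] {p : M}
    {s : ι → TangentSpace (𝓡 m) p} (hs : ∀ a : ι → ℝ, ∑ i, a i • s i = 0 → a = 0) :
    (Matrix.of fun i j => g.inner p (s i) (s j)).PosDef := by
  refine Matrix.PosDef.of_dotProduct_mulVec_pos ?_ fun a ha => ?_
  · ext i j
    simp [Matrix.conjTranspose_apply, g.symm p (s j)]
  · rw [star_trivial, ← g.inner_sum_sum]
    exact g.pos _ _ fun h => ha (hs a h)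

theorem metricMatrix_posDef (he : e ∈ IsManifold.maximalAtlas (𝓡 m) ∞ M) (hz : z ∈ e.target) :
    (metricMatrix g e z).PosDef := by
  refine g.gram_posDef fun a ha => ?_
  have h := EuclideanSpace.clm_apply_eq_sum
      (V := EuclideanSpace ℝ (Fin m)) (mfderiv (𝓡 m) (𝓡 m) e.symm z) (WithLp.toLp 2 a)
  have hinj := (mdifferentiable_of_mem_maximalAtlas he).symm.mfderiv_injective
    (x := z) (by simpa using hz)
  have h0 : (WithLp.toLp 2 a : EuclideanSpace ℝ (Fin m)) = 0 := hinj (by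
    refine Eq.trans (h.trans ha) (map_zero _).symm)
  simpa using h0

theorem metricMatrix_det_pos (he : e ∈ IsManifold.maximalAtlas (𝓡 m) ∞ M) (hz : z ∈ e.target) :
    0 < (metricMatrix g e z).det :=
  (metricMatrix_posDef g he hz).det_pos

theorem ContDiffAt.matrix_det {V : Type*} [NormedAddCommGroup V] [NormedSpace ℝ V] {k : ℕ}
    {A : V → Matrix (Fin k) (Fin k) ℝ} {z : V} {n : WithTop ℕ∞}
    (hA : ∀ i j, ContDiffAt ℝ n (fun z => A z i j) z) : ContDiffAt ℝ n (fun z => (A z).det) z :=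
  contDiff_matrix_det.contDiffAt.comp (g := fun B : Fin k → Fin k → ℝ => (Matrix.of B).det) z
    (contDiffAt_pi.2 fun i => contDiffAt_pi.2 fun j => hA i j)

/-- Cramer's rule: each entry is a quotient of determinants, with nonvanishing denominator. -/
theorem ContDiffAt.matrix_inv {V : Type*} [NormedAddCommGroup V] [NormedSpace ℝ V] {k : ℕ}
    {A : V → Matrix (Fin k) (Fin k) ℝ} {z : V} {n : WithTop ℕ∞}
    (hA : ∀ i j, ContDiffAt ℝ n (fun z => A z i j) z) (h0 : (A z).det ≠ 0) (i j : Fin k) :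
    ContDiffAt ℝ n (fun z => (A z)⁻¹ i j) z := by
  simp only [Matrix.inv_def, Matrix.smul_apply, smul_eq_mul, Ring.inverse_eq_inv',
    Matrix.adjugate_apply]
  refine ((ContDiffAt.matrix_det hA).inv h0).mul (ContDiffAt.matrix_det fun a b => ?_)
  by_cases h : a = j
  · subst h
    simp only [Matrix.updateRow_self]
    exact contDiffAt_const
  · simp only [Matrix.updateRow_ne h]
    exact hA a b

theorem contDiffAt_sqrt_det_metricMatrix (he : e ∈ IsManifold.maximalAtlas (𝓡 m) ∞ M)
    (hz : z ∈ e.target) : ContDiffAt ℝ ∞ (fun z => √(metricMatrix g e z).det) z :=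
  (ContDiffAt.matrix_det (contDiffAt_metricMatrix g he hz)).sqrt (metricMatrix_det_pos g he hz).ne'

theorem contDiffAt_metricMatrix_inv (he : e ∈ IsManifold.maximalAtlas (𝓡 m) ∞ M)
    (hz : z ∈ e.target) (i j : Fin m) :
    ContDiffAt ℝ ∞ (fun z => (metricMatrix g e z)⁻¹ i j) z :=
  ContDiffAt.matrix_inv (contDiffAt_metricMatrix g he hz) (metricMatrix_det_pos g he hz).ne' i j

/-- The metric in a chart, along a map. -/
theorem inner_mfderiv_eq_metricMatrix {V : Type*} [NormedAddCommGroup V] [NormedSpace ℝ V]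
    (he : e ∈ IsManifold.maximalAtlas (𝓡 m) ∞ M) {b : V → M} {q : V}
    (hb : MDifferentiableAt 𝓘(ℝ, V) (𝓡 m) b q) (hq : b q ∈ e.source) (v w : V) :
    g.inner (b q) (mfderiv 𝓘(ℝ, V) (𝓡 m) b q v) (mfderiv 𝓘(ℝ, V) (𝓡 m) b q w) =
      (fderiv ℝ (fun z => e (b z)) q v).ofLp ⬝ᵥ
        (metricMatrix g e (e (b q))).mulVec (fderiv ℝ (fun z => e (b z)) q w).ofLp := by
  rw [metricMatrix_dotProduct]
  have hd := mdifferentiable_of_mem_maximalAtlas he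
  have h1 : ∀ v : V, mfderiv (𝓡 m) (𝓡 m) e.symm (e (b q)) (fderiv ℝ (fun z => e (b z)) q v) =
      mfderiv 𝓘(ℝ, V) (𝓡 m) b q v := by
    intro v
    have h2 : fderiv ℝ (fun z => e (b z)) q =
        (mfderiv (𝓡 m) (𝓡 m) e (b q)).comp (mfderiv 𝓘(ℝ, V) (𝓡 m) b q) := by
      rw [← mfderiv_eq_fderiv]
      exact mfderiv_comp q (hd.mdifferentiableAt hq) hb
    have h3 := congrArg (fun L => L (mfderiv 𝓘(ℝ, V) (𝓡 m) b q v)) (hd.symm_comp_deriv hq)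
    rw [h2]
    exact h3
  have hp : e.symm (e (b q)) = b q := e.left_inv hq
  rw [WithLp.toLp_ofLp, WithLp.toLp_ofLp, h1, h1]
  rw [hp]

end Metric

/-! ### The tension field of a map to the circle -/

section CircleChart

variable {c : ℝ} (hc : 0 < c) {f : OpenPartialHomeomorph Circle (EuclideanSpace ℝ (Fin 1))}
  {s : ℝ}

theorem contDiffAt_chart_circleExp (hf : f ∈ IsManifold.maximalAtlas (𝓡 1) ∞ Circle)
    (hs : Circle.exp s ∈ f.source) : ContDiffAt ℝ ∞ (fun t => f (Circle.exp t)) s :=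
  contMDiffAt_iff_contDiffAt.1
    ((contMDiffAt_of_mem_maximalAtlas hf hs).comp s contMDiff_circleExp.contMDiffAt)

theorem contDiffAt_chart_circleExp_coord (hf : f ∈ IsManifold.maximalAtlas (𝓡 1) ∞ Circle)
    (hs : Circle.exp s ∈ f.source) : ContDiffAt ℝ ∞ (fun t => f (Circle.exp t) 0) s :=
  (EuclideanSpace.proj (𝕜 := ℝ) (0 : Fin 1)).contDiff.contDiffAt.comp s
    (contDiffAt_chart_circleExp hf hs)

theorem deriv_chart_circleExp (hf : f ∈ IsManifold.maximalAtlas (𝓡 1) ∞ Circle)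
    (hs : Circle.exp s ∈ f.source) :
    deriv (fun t => f (Circle.exp t) 0) s = fderiv ℝ (fun t => f (Circle.exp t)) s 1 0 := by
  rw [← fderiv_apply_one_eq_deriv, EuclideanSpace.fderiv_coord
    ((contDiffAt_chart_circleExp hf hs).differentiableAt (by simp))]

/-- With F(t) the coordinate of e^{it} and H dy² the metric in the chart, pulling back along F must
give c dt², so H(F) F'² = c. -/
theorem circleMetric_chart (hf : f ∈ IsManifold.maximalAtlas (𝓡 1) ∞ Circle)
    (hs : Circle.exp s ∈ f.source) :
    metricMatrix (circleMetric c hc) f (f (Circle.exp s)) 0 0 *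
      deriv (fun t => f (Circle.exp t) 0) s ^ 2 = c := by
  have h1 := inner_mfderiv_eq_metricMatrix (circleMetric c hc) hf (b := Circle.exp) (q := s)
    ((contMDiff_circleExp (m := ∞)).mdifferentiable (by simp) s) hs 1 1
  have h2 := circleMetric_apply c hc s 1 1
  rw [deriv_chart_circleExp hf hs]
  have h3 := h1.symm.trans h2
  simp only [dotProduct, Matrix.mulVec, Finset.univ_unique, Finset.sum_singleton] at h3
  rw [mul_one, mul_one] at h3
  refine Eq.trans ?_ h3
  change _ = fderiv ℝ (fun t => f (Circle.exp t)) s 1 0 * (_ *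
    fderiv ℝ (fun t => f (Circle.exp t)) s 1 0)
  rw [pow_two]
  change _ * (_ * _) = _ * (metricMatrix (circleMetric c hc) f (f (Circle.exp s)) 0 0 * _)
  ring

include hc in
theorem deriv_chart_circleExp_ne_zero (hf : f ∈ IsManifold.maximalAtlas (𝓡 1) ∞ Circle)
    (hs : Circle.exp s ∈ f.source) : deriv (fun t => f (Circle.exp t) 0) s ≠ 0 := fun h => by
  have := circleMetric_chart hc hf hs
  rw [h] at this
  simp at this
  exact hc.ne this

/-- This is the geodesic equation for t ↦ e^{it}. In dimension one Γ = H'/(2H), and differentiating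
H(F) F'² = c gives H'F'³ + 2HF'F'' = 0. -/
theorem christoffel_circleMetric (hf : f ∈ IsManifold.maximalAtlas (𝓡 1) ∞ Circle)
    (hs : Circle.exp s ∈ f.source) :
    christoffel (circleMetric c hc) f 0 0 0 (f (Circle.exp s)) *
      deriv (fun t => f (Circle.exp t) 0) s ^ 2 =
      - deriv (deriv (fun t => f (Circle.exp t) 0)) s := by
  set F : ℝ → ℝ := fun t => f (Circle.exp t) 0 with hF
  set H := fun y => metricMatrix (circleMetric c hc) f y 0 0 with hH
  set y₀ := f (Circle.exp s)
  have hHd : DifferentiableAt ℝ H y₀ :=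
    (contDiffAt_metricMatrix (circleMetric c hc) hf (f.map_source hs) 0 0).differentiableAt
      (by simp)
  have hFs : ContDiffAt ℝ ∞ F s := contDiffAt_chart_circleExp_coord hf hs
  have hF2 : DifferentiableAt ℝ (deriv F) s :=
    (ContDiffAt.derivWithin hFs (m := ∞) (by simp)).differentiableAt (by simp)
  have hcomp : HasDerivAt (fun t => H (f (Circle.exp t))) (partialDeriv 0 H y₀ * deriv F s) s := by
    have h1 := hHd.hasFDerivAt.comp_hasDerivAt s
      ((contDiffAt_chart_circleExp hf hs).differentiableAt (by simp)).hasFDerivAt.hasDerivAt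
    refine h1.congr_deriv ?_
    rw [EuclideanSpace.clm_apply_eq_sum (fderiv ℝ H y₀), deriv_chart_circleExp hf hs]
    simp [partialDeriv, mul_comm]
  have hprod := hcomp.mul (hF2.hasDerivAt.pow 2)
  have hev : ∀ᶠ t in nhds s, H (f (Circle.exp t)) * deriv F t ^ 2 = c := by
    filter_upwards [(Circle.exp.continuous.continuousAt).preimage_mem_nhds
      (f.open_source.mem_nhds hs)] with t ht
    exact circleMetric_chart hc hf ht
  have hzero := hprod.unique ((hasDerivAt_const s c).congr_of_eventuallyEq hev)
  have hF0 : deriv F s ≠ 0 := deriv_chart_circleExp_ne_zero hc hf hs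
  have hH0 : H y₀ ≠ 0 := fun h => by
    have := circleMetric_chart hc hf hs
    change H y₀ * _ = _ at this
    rw [h, zero_mul] at this
    exact hc.ne this
  have hinv : (metricMatrix (circleMetric c hc) f y₀)⁻¹ 0 0 = (H y₀)⁻¹ := by
    rw [Matrix.inv_def, Matrix.adjugate_fin_one]
    simp [H]
  have hchr : christoffel (circleMetric c hc) f 0 0 0 y₀ = 1 / 2 * ((H y₀)⁻¹ *
      partialDeriv 0 H y₀) := by
    unfold christoffel
    rw [Fin.sum_univ_one, hinv, add_sub_cancel_right]
  rw [hchr]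
  have hz : partialDeriv 0 H y₀ * deriv F s ^ 2 = - (2 * H y₀ * deriv (deriv F) s) := by
    -- The differentiated identity carries a surplus factor F', which is nonzero.
    have h2 : deriv F s * (partialDeriv 0 H y₀ * deriv F s ^ 2 +
        2 * H y₀ * deriv (deriv F) s) = 0 := by
      rw [← hzero]
      change _ = partialDeriv 0 H y₀ * deriv F s * deriv F s ^ 2 + H y₀ * _
      norm_num
      ring
    have := (mul_eq_zero.1 h2).resolve_left hF0
    linarith
  field_simp
  linarith

end CircleChart

/-! ### The tension field as a divergence -/

section Tension

variable {m : ℕ} {M : Type*} [TopologicalSpace M] [ChartedSpace (EuclideanSpace ℝ (Fin m)) M]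
  [IsManifold (𝓡 m) ∞ M] (g : SmoothMetric m M) {c : ℝ} (hc : 0 < c)
  {e : OpenPartialHomeomorph M (EuclideanSpace ℝ (Fin m))}
  {f : OpenPartialHomeomorph Circle (EuclideanSpace ℝ (Fin 1))} {π : M → Circle}
  {z₀ : EuclideanSpace ℝ (Fin m)} {θ : EuclideanSpace ℝ (Fin m) → ℝ}
  {X : EuclideanSpace ℝ (Fin m) → EuclideanSpace ℝ (Fin m)}

/-- Inverting G X = c a gives X = c G⁻¹ a. The symmetry of G⁻¹ allows the contraction over the first
index, as in the formula for the Laplacian. -/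
theorem inv_metricMatrix_mul_grad (he : e ∈ IsManifold.maximalAtlas (𝓡 m) ∞ M)
    {z : EuclideanSpace ℝ (Fin m)} (hz : z ∈ e.target) {a : Fin m → ℝ} (hc : 0 < c)
    (hX : (metricMatrix g e z).mulVec (X z).ofLp = c • a) (j : Fin m) :
    ∑ i, (metricMatrix g e z)⁻¹ i j * a i = c⁻¹ * X z j := by
  have hpd := metricMatrix_posDef g he hz
  have hu : IsUnit (metricMatrix g e z).det := (metricMatrix_det_pos g he hz).ne'.isUnit
  have h1 : (X z).ofLp = (metricMatrix g e z)⁻¹.mulVec (c • a) := by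
    rw [← hX, Matrix.mulVec_mulVec, Matrix.nonsing_inv_mul _ hu, Matrix.one_mulVec]
  have hsym : ∀ i j, (metricMatrix g e z)⁻¹ i j = (metricMatrix g e z)⁻¹ j i := fun i j => by
    have := hpd.inv.isHermitian.apply i j
    simpa using this.symm
  have h2 : X z j = c * ∑ i, (metricMatrix g e z)⁻¹ j i * a i := by
    have := congrFun h1 j
    rw [this, Matrix.mulVec_smul]
    simp [Matrix.mulVec, dotProduct]
  rw [h2, inv_mul_cancel_left₀ hc.ne']
  exact Finset.sum_congr rfl fun i _ => by rw [hsym]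

/-- For a map `π = e^{iθ}` the tension field is the divergence of `grad θ = X / c`, up to a nonzero
factor that depends on the chart of the circle. -/
theorem tensionField_circle (he : e ∈ IsManifold.maximalAtlas (𝓡 m) ∞ M)
    (hf : f ∈ IsManifold.maximalAtlas (𝓡 1) ∞ Circle) (hz : z₀ ∈ e.target)
    (hπ : π (e.symm z₀) ∈ f.source) (hθ : ContDiffAt ℝ ∞ θ z₀)
    (hπθ : ∀ᶠ z in nhds z₀, π (e.symm z) = Circle.exp (θ z))
    (hXd : DifferentiableAt ℝ X z₀)
    (hX : ∀ᶠ z in nhds z₀, (metricMatrix g e z).mulVec (X z).ofLp =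
      c • fun i => partialDeriv i θ z) :
    tensionField g (circleMetric c hc) π e f 0 z₀ =
      deriv (fun t => f (Circle.exp t) 0) (θ z₀) / (c * √(metricMatrix g e z₀).det) *
        ∑ j, partialDeriv j (fun z => √(metricMatrix g e z).det * X z j) z₀ := by
  set F : ℝ → ℝ := fun t => f (Circle.exp t) 0 with hF
  set ρ := fun z => √(metricMatrix g e z).det with hρ
  have hs : Circle.exp (θ z₀) ∈ f.source := hπθ.self_of_nhds ▸ hπ
  have hFs : ContDiffAt ℝ ∞ F (θ z₀) := contDiffAt_chart_circleExp_coord hf hs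
  have hFd' : ContDiffAt ℝ ∞ (deriv F) (θ z₀) := ContDiffAt.derivWithin hFs (m := ∞) (by simp)
  have hFd : DifferentiableAt ℝ (deriv F) (θ z₀) := hFd'.differentiableAt (by simp)
  have hθd : DifferentiableAt ℝ θ z₀ := hθ.differentiableAt (by simp)
  have hρd : DifferentiableAt ℝ ρ z₀ :=
    (contDiffAt_sqrt_det_metricMatrix g he hz).differentiableAt (by simp)
  have hρ0 : ρ z₀ ≠ 0 := (Real.sqrt_pos.2 (metricMatrix_det_pos g he hz)).ne'
  have hu : (fun z => f (π (e.symm z)) 0) =ᶠ[nhds z₀] fun z => F (θ z) := by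
    filter_upwards [hπθ] with z hz
    rw [hz]
  have hpu : ∀ i, ∀ᶠ z in nhds z₀, partialDeriv i (fun z => f (π (e.symm z)) 0) z =
      deriv F (θ z) * partialDeriv i θ z := by
    intro i
    have hθ1 : ∀ᶠ z in nhds z₀, DifferentiableAt ℝ θ z :=
      ((hθ.of_le (m := 1) (by simp)).eventually (by simp)).mono
        fun z hz => hz.differentiableAt (by simp)
    have hs1 : ∀ᶠ z in nhds z₀, Circle.exp (θ z) ∈ f.source :=
      (Circle.exp.continuous.continuousAt.comp hθ.continuousAt).preimage_mem_nhds
        (f.open_source.mem_nhds hs)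
    filter_upwards [hu.eventuallyEq_nhds, hθ1, hs1] with z h1 h2 h3
    unfold partialDeriv
    rw [h1.fderiv_eq]
    have h4 : DifferentiableAt ℝ F (θ z) :=
      (contDiffAt_chart_circleExp_coord hf h3).differentiableAt (by simp)
    have h5 : fderiv ℝ (fun z => F (θ z)) z = deriv F (θ z) • fderiv ℝ θ z :=
      (h4.hasDerivAt.comp_hasFDerivAt z h2.hasFDerivAt).fderiv
    rw [h5]
    rfl
  have hpθ : ∀ i, DifferentiableAt ℝ (fun z => partialDeriv i θ z) z₀ := fun i =>
    ((hθ.fderiv_right (m := ∞) (by simp)).clm_apply contDiffAt_const).differentiableAt (by simp)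
  have hFθ : DifferentiableAt ℝ (fun z => deriv F (θ z)) z₀ :=
    hFd.comp (f := θ) z₀ hθd
  have hterm : ∀ i j, (fun z => (metricMatrix g e z)⁻¹ i j * √(metricMatrix g e z).det *
      partialDeriv i (fun z => f (π (e.symm z)) 0) z) =ᶠ[nhds z₀]
      fun z => (metricMatrix g e z)⁻¹ i j * ρ z * (deriv F (θ z) * partialDeriv i θ z) := by
    intro i j
    filter_upwards [hpu i] with z hz
    rw [hz]
  have htermd : ∀ i j, DifferentiableAt ℝ (fun z => (metricMatrix g e z)⁻¹ i j * ρ z *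
      (deriv F (θ z) * partialDeriv i θ z)) z₀ := fun i j =>
    ((((contDiffAt_metricMatrix_inv g he hz i j).differentiableAt (by simp)).mul hρd).mul
      (hFθ.mul (hpθ i)))
  -- The sum over i must be taken before differentiating: it turns the inverse metric into the
  -- components of X.
  have hsum : ∀ j, (fun z => ∑ i, (metricMatrix g e z)⁻¹ i j * ρ z *
      (deriv F (θ z) * partialDeriv i θ z)) =ᶠ[nhds z₀]
      fun z => (c⁻¹ * deriv F (θ z)) * (ρ z * X z j) := by
    intro j
    filter_upwards [hX, e.open_target.mem_nhds hz] with z h1 h2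
    have h3 := inv_metricMatrix_mul_grad g he h2 hc h1 j
    calc _ = ρ z * deriv F (θ z) *
          ∑ i, (metricMatrix g e z)⁻¹ i j * partialDeriv i θ z := by
          rw [Finset.mul_sum]
          exact Finset.sum_congr rfl fun i _ => by ring
      _ = _ := by rw [h3]; ring
  have hXj : ∀ j, DifferentiableAt ℝ (fun z => ρ z * X z j) z₀ := fun j =>
    hρd.mul (EuclideanSpace.differentiableAt_coord hXd j)
  -- The product rule splits div(F'(θ) X/c) into F'(θ) div X/c and a term F''(θ) dθ(X)/c.
  have hlap : laplaceBeltrami g e (fun z => f (π (e.symm z)) 0) z₀ =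
      1 / ρ z₀ * (c⁻¹ * deriv F (θ z₀) * (∑ j, partialDeriv j (fun z => ρ z * X z j) z₀) +
        c⁻¹ * deriv (deriv F) (θ z₀) * ρ z₀ * ∑ j, X z₀ j * partialDeriv j θ z₀) := by
    unfold laplaceBeltrami
    rw [Finset.sum_comm]
    simp only [← Finset.mul_sum]
    congr 1
    have : ∀ j, ∑ i, partialDeriv j (fun z => (metricMatrix g e z)⁻¹ i j *
        √(metricMatrix g e z).det * partialDeriv i (fun z => f (π (e.symm z)) 0) z) z₀ =
        c⁻¹ * deriv F (θ z₀) * partialDeriv j (fun z => ρ z * X z j) z₀ +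
        c⁻¹ * deriv (deriv F) (θ z₀) * ρ z₀ * (X z₀ j * partialDeriv j θ z₀) := by
      intro j
      have h1 : ∀ i, partialDeriv j (fun z => (metricMatrix g e z)⁻¹ i j *
          √(metricMatrix g e z).det * partialDeriv i (fun z => f (π (e.symm z)) 0) z) z₀ =
          fderiv ℝ (fun z => (metricMatrix g e z)⁻¹ i j * ρ z *
            (deriv F (θ z) * partialDeriv i θ z)) z₀ (EuclideanSpace.single j 1) := fun i =>
        congrArg (fun L : EuclideanSpace ℝ (Fin m) →L[ℝ] ℝ => L (EuclideanSpace.single j 1)) (hterm i j).fderiv_eq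
      simp only [h1]
      have h2 := fderiv_fun_sum (u := Finset.univ) (fun i (_ : i ∈ Finset.univ) => htermd i j)
      rw [← sum_apply, ← h2, (hsum j).fderiv_eq,
        fderiv_fun_mul (hFθ.const_mul _) (hXj j), fderiv_const_mul hFθ]
      have h3 : fderiv ℝ (fun z => deriv F (θ z)) z₀ =
          deriv (deriv F) (θ z₀) • fderiv ℝ θ z₀ :=
        (hFd.hasDerivAt.comp_hasFDerivAt z₀ hθd.hasFDerivAt).fderiv
      rw [h3]
      simp only [add_apply, smul_apply, smul_eq_mul, partialDeriv]
      ring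
    simp only [this, Finset.sum_add_distrib, ← Finset.mul_sum]
  have hgrad : ∑ i, ∑ j, (metricMatrix g e z₀)⁻¹ i j * (partialDeriv i θ z₀ *
      partialDeriv j θ z₀) = c⁻¹ * ∑ j, X z₀ j * partialDeriv j θ z₀ := by
    rw [Finset.sum_comm, Finset.mul_sum]
    refine Finset.sum_congr rfl fun j _ => ?_
    rw [← mul_assoc, ← inv_metricMatrix_mul_grad g he hz hc hX.self_of_nhds j, Finset.sum_mul]
    exact Finset.sum_congr rfl fun i _ => by ring
  have hchr := christoffel_circleMetric hc hf hs
  unfold tensionField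
  rw [hlap]
  -- By the geodesic equation the Christoffel term is −F''(θ) dθ(X)/c, which cancels the second term
  -- of the Laplacian.
  have hsecond : ∑ i, ∑ j, ∑ a, ∑ b, (metricMatrix g e z₀)⁻¹ i j *
      christoffel (circleMetric c hc) f 0 a b (f (π (e.symm z₀))) *
      partialDeriv i (fun z => f (π (e.symm z)) a) z₀ *
      partialDeriv j (fun z => f (π (e.symm z)) b) z₀ =
      -deriv (deriv F) (θ z₀) * (c⁻¹ * ∑ j, X z₀ j * partialDeriv j θ z₀) := by
    rw [← hgrad, Finset.mul_sum]
    refine Finset.sum_congr rfl fun i _ => ?_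
    rw [Finset.mul_sum]
    refine Finset.sum_congr rfl fun j _ => ?_
    rw [Fin.sum_univ_one, Fin.sum_univ_one, (hpu i).self_of_nhds, (hpu j).self_of_nhds,
      hπθ.self_of_nhds, ← hchr]
    ring
  rw [hsecond]
  have hc' := hc.ne'
  change _ = deriv F (θ z₀) / (c * ρ z₀) * _
  field_simp
  ring

end Tension

/-! ### Local branches of the angle -/

section Angle

/-- The branch of the angle of a point of the circle with values in `(t₀ - π, t₀ + π]`. -/
noncomputable def angleNear (t₀ : ℝ) (q : Circle) : ℝ :=
  t₀ + Complex.arg ((q * (Circle.exp t₀)⁻¹ : Circle) : ℂ)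

/-- The domain on which `angleNear` is smooth. -/
def angleDomain (t₀ : ℝ) : Set Circle :=
  {q | ((q * (Circle.exp t₀)⁻¹ : Circle) : ℂ) ∈ Complex.slitPlane}

theorem isOpen_angleDomain (t₀ : ℝ) : IsOpen (angleDomain t₀) :=
  Complex.isOpen_slitPlane.preimage (by fun_prop)

/-- This holds on the cut as well, so π = e^{iθ} is a global identity and only the smoothness of θ
needs a restricted domain. -/
theorem exp_angleNear (t₀ : ℝ) (q : Circle) : Circle.exp (angleNear t₀ q) = q := by
  rw [angleNear, Circle.exp_add, Circle.exp_arg]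
  simp

theorem angleNear_exp {t₀ t : ℝ} (h : |t - t₀| < Real.pi) :
    angleNear t₀ (Circle.exp t) = t := by
  rw [angleNear, ← Circle.exp_neg, ← Circle.exp_add, ← sub_eq_add_neg]
  rw [abs_lt] at h
  rw [Circle.arg_exp h.1 h.2.le]
  ring

theorem exp_mem_angleDomain {t₀ t : ℝ} (h : |t - t₀| < Real.pi) :
    Circle.exp t ∈ angleDomain t₀ := by
  rw [abs_lt] at h
  change ((Circle.exp t * (Circle.exp t₀)⁻¹ : Circle) : ℂ) ∈ Complex.slitPlane
  rw [← Circle.exp_neg, ← Circle.exp_add, ← sub_eq_add_neg, Complex.mem_slitPlane_iff_arg,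
    Circle.arg_exp h.1 h.2.le]
  exact ⟨h.2.ne, Circle.coe_ne_zero _⟩

theorem self_exp_mem_angleDomain (t₀ : ℝ) : Circle.exp t₀ ∈ angleDomain t₀ :=
  exp_mem_angleDomain (by simp [Real.pi_pos])

theorem contDiffAt_arg {z : ℂ} (hz : z ∈ Complex.slitPlane) : ContDiffAt ℝ ∞ Complex.arg z :=
  (Complex.imCLM.contDiff.contDiffAt.comp z
    ((Complex.contDiffAt_log (n := ∞) hz).restrict_scalars ℝ)).congr_of_eventuallyEq
    (Filter.Eventually.of_forall fun z => (Complex.log_im z).symm)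

theorem contMDiffAt_angleNear {t₀ : ℝ} {q : Circle} (hq : q ∈ angleDomain t₀) :
    ContMDiffAt (𝓡 1) 𝓘(ℝ, ℝ) ∞ (angleNear t₀) q := by
  have h1 : ContMDiffAt (𝓡 1) 𝓘(ℝ, ℂ) ∞ (fun q : Circle => (q : ℂ)) q := contMDiff_circle_coe q
  have h2 : ContDiffAt ℝ ∞ (fun z : ℂ => t₀ + Complex.arg (z * ((Circle.exp t₀)⁻¹ : Circle)))
      (q : ℂ) := by
    refine contDiffAt_const.add (ContDiffAt.comp (q : ℂ) (contDiffAt_arg ?_) (by fun_prop))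
    simpa [angleDomain] using hq
  refine (h2.comp_contMDiffAt h1).congr_of_eventuallyEq (Filter.Eventually.of_forall fun q => ?_)
  simp only [angleNear, Circle.coe_mul]
  rfl

end Angle

/-! ### Tubes -/

section Tube

variable {m n : ℕ} {M : Type*} [TopologicalSpace M] [ChartedSpace (EuclideanSpace ℝ (Fin m)) M]
  [IsManifold (𝓡 m) ∞ M]
  {M₀ : Type*} [TopologicalSpace M₀] [ChartedSpace (EuclideanSpace ℝ (Fin n)) M₀]

variable (n) in
/-- A local diffeomorphism `Φ : M₀ × ℝ → M` over the angle, under which the metric of `M` is of the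
form `g(t) + c dt²`. -/
structure IsHorizontalTube (g : SmoothMetric m M) (c : ℝ) (π : M → Circle) (Φ : M₀ × ℝ → M) :
    Prop where
  isLocalDiffeomorph : IsLocalDiffeomorph ((𝓡 n).prod 𝓘(ℝ, ℝ)) (𝓡 m) ∞ Φ
  proj : ∀ x t, π (Φ (x, t)) = Circle.exp t
  inner_eq : ∀ (x : M₀) (t : ℝ) (v w : TangentSpace (𝓡 n) x) (a b : ℝ),
    g.inner (Φ (x, t)) (mfderiv ((𝓡 n).prod 𝓘(ℝ, ℝ)) (𝓡 m) Φ (x, t) (v, a))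
        (mfderiv ((𝓡 n).prod 𝓘(ℝ, ℝ)) (𝓡 m) Φ (x, t) (w, b)) =
      g.inner (Φ (x, t)) (mfderiv ((𝓡 n).prod 𝓘(ℝ, ℝ)) (𝓡 m) Φ (x, t) (v, (0 : ℝ)))
        (mfderiv ((𝓡 n).prod 𝓘(ℝ, ℝ)) (𝓡 m) Φ (x, t) (w, (0 : ℝ))) + c * (a * b)

/-- The Gram matrix of the metric induced on `M₀` by the map `Φ (·, t)`, at the tangent vectors
`v i`. -/
noncomputable def sliceGram (g : SmoothMetric m M) (Φ : M₀ × ℝ → M) (x : M₀) {k : ℕ}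
    (v : Fin k → TangentSpace (𝓡 n) x) (t : ℝ) : Matrix (Fin k) (Fin k) ℝ :=
  Matrix.of fun i j => g.inner (Φ (x, t))
    (mfderiv ((𝓡 n).prod 𝓘(ℝ, ℝ)) (𝓡 m) Φ (x, t) (v i, (0 : ℝ)))
    (mfderiv ((𝓡 n).prod 𝓘(ℝ, ℝ)) (𝓡 m) Φ (x, t) (v j, (0 : ℝ)))

variable (n) in
/-- The standard basis of the tangent space. -/
noncomputable def stdFrame (x : M₀) (i : Fin n) : TangentSpace (𝓡 n) x :=
  (EuclideanSpace.single i (1 : ℝ) : EuclideanSpace ℝ (Fin n))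

/-- The standard basis of `ℝⁿ × ℝ`. -/
noncomputable def prodFrame (i : Fin n ⊕ Fin 1) : EuclideanSpace ℝ (Fin n) × ℝ :=
  Sum.elim (fun i => (EuclideanSpace.single i (1 : ℝ), (0 : ℝ))) (fun _ => (0, 1)) i

theorem prodFrame_linearIndependent {a : Fin n ⊕ Fin 1 → ℝ} (h : ∑ i, a i • prodFrame i = 0) :
    a = 0 := by
  rw [Fintype.sum_sum_type] at h
  have h1 := congrArg Prod.fst h
  have h2 := congrArg Prod.snd h
  simp only [prodFrame, Sum.elim_inl, Sum.elim_inr, Prod.fst_add, Prod.fst_sum, Prod.smul_fst,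
      smul_zero, Finset.sum_const_zero, add_zero, Prod.fst_zero] at h1
  simp [prodFrame, Prod.snd_sum] at h2
  have h3 : (WithLp.toLp 2 fun i => a (Sum.inl i) : EuclideanSpace ℝ (Fin n)) = 0 := by
    rw [EuclideanSpace.eq_sum_single (WithLp.toLp 2 fun i => a (Sum.inl i))]
    exact h1
  funext i
  rcases i with i | i
  · exact congrArg (fun v : EuclideanSpace ℝ (Fin n) => v i) h3
  · rw [Subsingleton.elim i 0]; exact h2

variable {g : SmoothMetric m M} {c : ℝ} {π : M → Circle} {Φ : M₀ × ℝ → M}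

theorem IsHorizontalTube.mfderiv_bijective (h : IsHorizontalTube n g c π Φ) (p : M₀ × ℝ) :
    Function.Bijective (mfderiv ((𝓡 n).prod 𝓘(ℝ, ℝ)) (𝓡 m) Φ p) :=
  (h.isLocalDiffeomorph.mfderivToContinuousLinearEquiv (by simp) p).bijective

theorem IsHorizontalTube.finrank_eq (h : IsHorizontalTube n g c π Φ) (p : M₀ × ℝ) : n + 1 = m := by
  let L : EuclideanSpace ℝ (Fin n) × ℝ →L[ℝ] EuclideanSpace ℝ (Fin m) :=
    mfderiv ((𝓡 n).prod 𝓘(ℝ, ℝ)) (𝓡 m) Φ p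
  have hL : Function.Bijective (L : EuclideanSpace ℝ (Fin n) × ℝ →ₗ[ℝ] EuclideanSpace ℝ (Fin m)) :=
    h.mfderiv_bijective p
  simpa using (LinearEquiv.ofBijective _ hL).finrank_eq

/-- The Gram matrix of the frame `∂₁, …, ∂ₙ, ∂ₜ`. -/
theorem IsHorizontalTube.gram_prodFrame (h : IsHorizontalTube n g c π Φ) (x : M₀) (t : ℝ) :
    (Matrix.of fun i j => g.inner (Φ (x, t))
      (mfderiv ((𝓡 n).prod 𝓘(ℝ, ℝ)) (𝓡 m) Φ (x, t) (prodFrame i))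
      (mfderiv ((𝓡 n).prod 𝓘(ℝ, ℝ)) (𝓡 m) Φ (x, t) (prodFrame j))) =
    Matrix.fromBlocks (sliceGram g Φ x (stdFrame n x) t) 0 0 (Matrix.of fun _ _ => c) := by
  have hz : mfderiv ((𝓡 n).prod 𝓘(ℝ, ℝ)) (𝓡 m) Φ (x, t)
      ((0 : EuclideanSpace ℝ (Fin n)), (0 : ℝ)) = 0 := map_zero _
  ext i j
  rcases i with i | i <;> rcases j with j | j
  · rfl
  · refine (h.inner_eq x t (stdFrame n x i) (0 : EuclideanSpace ℝ (Fin n)) 0 1).trans ?_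
    rw [hz]; simp
  · refine (h.inner_eq x t (0 : EuclideanSpace ℝ (Fin n)) (stdFrame n x j) 1 0).trans ?_
    rw [hz]; simp
  · refine (h.inner_eq x t (0 : EuclideanSpace ℝ (Fin n))
      (0 : EuclideanSpace ℝ (Fin n)) 1 1).trans ?_
    rw [hz]; simp

theorem IsHorizontalTube.det_gram_prodFrame (h : IsHorizontalTube n g c π Φ) (x : M₀) (t : ℝ) :
    (Matrix.of fun i j => g.inner (Φ (x, t))
      (mfderiv ((𝓡 n).prod 𝓘(ℝ, ℝ)) (𝓡 m) Φ (x, t) (prodFrame i))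
      (mfderiv ((𝓡 n).prod 𝓘(ℝ, ℝ)) (𝓡 m) Φ (x, t) (prodFrame j))).det =
    (sliceGram g Φ x (stdFrame n x) t).det * c := by
  rw [h.gram_prodFrame, Matrix.det_fromBlocks_zero₂₁]
  simp

/-- The frame ∂₁, …, ∂ₙ, ∂ₜ has independent images in M, so its Gram determinant is positive; it is
c times that of the slice. -/
theorem IsHorizontalTube.det_sliceGram_pos (h : IsHorizontalTube n g c π Φ) (hc : 0 < c) (x : M₀)
    (t : ℝ) : 0 < (sliceGram g Φ x (stdFrame n x) t).det := by
  have h1 : (Matrix.of fun i j => g.inner (Φ (x, t))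
      (mfderiv ((𝓡 n).prod 𝓘(ℝ, ℝ)) (𝓡 m) Φ (x, t) (prodFrame i))
      (mfderiv ((𝓡 n).prod 𝓘(ℝ, ℝ)) (𝓡 m) Φ (x, t) (prodFrame j))).PosDef := by
    refine g.gram_posDef fun a ha => prodFrame_linearIndependent ?_
    let L : EuclideanSpace ℝ (Fin n) × ℝ →L[ℝ] EuclideanSpace ℝ (Fin m) :=
      mfderiv ((𝓡 n).prod 𝓘(ℝ, ℝ)) (𝓡 m) Φ (x, t)
    have hL : Function.Injective L := (h.mfderiv_bijective (x, t)).1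
    refine hL ?_
    rw [map_sum, map_zero]
    simp only [map_smul]
    exact ha
  have h2 := h1.det_pos
  rw [h.det_gram_prodFrame] at h2
  exact pos_of_mul_pos_left h2 hc.le

/-! #### The tube in coordinates -/

/-- `Φ` in the coordinates of `M₀` at `x`. -/
noncomputable def coordTube (Φ : M₀ × ℝ → M) (x : M₀) (p : EuclideanSpace ℝ (Fin n) × ℝ) : M :=
  Φ ((chartAt (EuclideanSpace ℝ (Fin n)) x).symm p.1, p.2)

variable [IsManifold (𝓡 n) ∞ M₀]

/-- The tangent space at x is identified with the model space through the preferred chart at x, so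
this chart has trivial derivative there. Hence `stdFrame` at x is the coordinate frame of that
chart. -/
theorem mfderiv_chartAt_symm_self (x : M₀) :
    mfderiv (𝓡 n) (𝓡 n) (chartAt (EuclideanSpace ℝ (Fin n)) x).symm
      (chartAt (EuclideanSpace ℝ (Fin n)) x x) =
      ContinuousLinearMap.id ℝ (EuclideanSpace ℝ (Fin n)) := by
  have := mfderivWithin_range_extChartAt_symm (I := 𝓡 n) (x := x)
  simp only [modelWithCornersSelf_coe, range_id, mfderivWithin_univ] at this
  exact this

omit [IsManifold (𝓡 m) ∞ M] in
theorem hasMFDerivAt_coordTube {x : M₀} {w : EuclideanSpace ℝ (Fin n)} {t : ℝ}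
    (hΦ : ContMDiff ((𝓡 n).prod 𝓘(ℝ, ℝ)) (𝓡 m) ∞ Φ)
    (hw : w ∈ (chartAt (EuclideanSpace ℝ (Fin n)) x).target) :
    HasMFDerivAt 𝓘(ℝ, EuclideanSpace ℝ (Fin n) × ℝ) (𝓡 m) (coordTube Φ x) (w, t)
      ((mfderiv ((𝓡 n).prod 𝓘(ℝ, ℝ)) (𝓡 m) Φ
        ((chartAt (EuclideanSpace ℝ (Fin n)) x).symm w, t)).comp
        (((mfderiv (𝓡 n) (𝓡 n) (chartAt (EuclideanSpace ℝ (Fin n)) x).symm w).comp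
          (ContinuousLinearMap.fst ℝ (EuclideanSpace ℝ (Fin n)) ℝ)).prod
          (ContinuousLinearMap.snd ℝ (EuclideanSpace ℝ (Fin n)) ℝ))) := by
  have hd := (mdifferentiable_of_mem_maximalAtlas
    (IsManifold.chart_mem_maximalAtlas (I := 𝓡 n) (n := ∞) x)).mdifferentiableAt_symm hw
  have h1 : HasMFDerivAt 𝓘(ℝ, EuclideanSpace ℝ (Fin n) × ℝ) (𝓡 n)
      (fun p : EuclideanSpace ℝ (Fin n) × ℝ => (chartAt (EuclideanSpace ℝ (Fin n)) x).symm p.1)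
      (w, t) _ := HasMFDerivAt.comp (w, t) hd.hasMFDerivAt
        (ContinuousLinearMap.fst ℝ (EuclideanSpace ℝ (Fin n)) ℝ).hasMFDerivAt
  have h2 := h1.prodMk (ContinuousLinearMap.snd ℝ (EuclideanSpace ℝ (Fin n)) ℝ).hasMFDerivAt
  exact HasMFDerivAt.comp (w, t) ((hΦ.mdifferentiable (by simp)) _).hasMFDerivAt h2

omit [IsManifold (𝓡 m) ∞ M] in
theorem contMDiffAt_coordTube {x : M₀} {w : EuclideanSpace ℝ (Fin n)} {t : ℝ}
    (hΦ : ContMDiff ((𝓡 n).prod 𝓘(ℝ, ℝ)) (𝓡 m) ∞ Φ)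
    (hw : w ∈ (chartAt (EuclideanSpace ℝ (Fin n)) x).target) :
    ContMDiffAt 𝓘(ℝ, EuclideanSpace ℝ (Fin n) × ℝ) (𝓡 m) ∞ (coordTube Φ x) (w, t) := by
  refine hΦ.contMDiffAt.comp (w, t) (ContMDiffAt.prodMk ?_ contDiff_snd.contMDiff.contMDiffAt)
  exact (contMDiffAt_symm_of_mem_maximalAtlas
    (IsManifold.chart_mem_maximalAtlas (I := 𝓡 n) (n := ∞) x) hw).comp (w, t)
      contDiff_fst.contMDiff.contMDiffAt

omit [IsManifold (𝓡 m) ∞ M] in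
-- The derivatives are compared at the centre of the chart only. That is enough, because volume
-- densities are followed along a single line {x} × ℝ.
theorem mfderiv_coordTube_self {x : M₀} {t : ℝ}
    (hΦ : ContMDiff ((𝓡 n).prod 𝓘(ℝ, ℝ)) (𝓡 m) ∞ Φ) (v : EuclideanSpace ℝ (Fin n) × ℝ) :
    mfderiv 𝓘(ℝ, EuclideanSpace ℝ (Fin n) × ℝ) (𝓡 m) (coordTube Φ x)
      (chartAt (EuclideanSpace ℝ (Fin n)) x x, t) v =
      mfderiv ((𝓡 n).prod 𝓘(ℝ, ℝ)) (𝓡 m) Φ (x, t) v := by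
  have hw := mem_chart_target (EuclideanSpace ℝ (Fin n)) x
  have hs := (chartAt (EuclideanSpace ℝ (Fin n)) x).left_inv (mem_chart_source _ x)
  rw [(hasMFDerivAt_coordTube (t := t) hΦ hw).mfderiv, mfderiv_chartAt_symm_self]
  have : ((ContinuousLinearMap.id ℝ (EuclideanSpace ℝ (Fin n))).comp
      (ContinuousLinearMap.fst ℝ (EuclideanSpace ℝ (Fin n)) ℝ)).prod
      (ContinuousLinearMap.snd ℝ (EuclideanSpace ℝ (Fin n)) ℝ) =
      ContinuousLinearMap.id ℝ (EuclideanSpace ℝ (Fin n) × ℝ) := by ext <;> rfl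
  refine (congrArg (fun L : EuclideanSpace ℝ (Fin n) × ℝ →L[ℝ] EuclideanSpace ℝ (Fin n) × ℝ =>
    mfderiv ((𝓡 n).prod 𝓘(ℝ, ℝ)) (𝓡 m) Φ ((chartAt (EuclideanSpace ℝ (Fin n)) x).symm
      (chartAt (EuclideanSpace ℝ (Fin n)) x x), t) (L v)) this).trans ?_
  rw [hs]
  rfl

/-- The chart rule for the metric on the tube. -/
theorem IsHorizontalTube.inner_coordTube (h : IsHorizontalTube n g c π Φ) {x : M₀}
    {w : EuclideanSpace ℝ (Fin n)} {t : ℝ}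
    (hw : w ∈ (chartAt (EuclideanSpace ℝ (Fin n)) x).target) (v : EuclideanSpace ℝ (Fin n) × ℝ) :
    g.inner (coordTube Φ x (w, t))
      (mfderiv 𝓘(ℝ, EuclideanSpace ℝ (Fin n) × ℝ) (𝓡 m) (coordTube Φ x) (w, t) v)
      (mfderiv 𝓘(ℝ, EuclideanSpace ℝ (Fin n) × ℝ) (𝓡 m) (coordTube Φ x) (w, t)
        ((0 : EuclideanSpace ℝ (Fin n)), (1 : ℝ))) = c * v.2 := by
  rw [(hasMFDerivAt_coordTube (t := t) h.isLocalDiffeomorph.contMDiff hw).mfderiv]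
  have h1 := h.inner_eq ((chartAt (EuclideanSpace ℝ (Fin n)) x).symm w) t
    (mfderiv (𝓡 n) (𝓡 n) (chartAt (EuclideanSpace ℝ (Fin n)) x).symm w v.1)
    (mfderiv (𝓡 n) (𝓡 n) (chartAt (EuclideanSpace ℝ (Fin n)) x).symm w
      (0 : EuclideanSpace ℝ (Fin n))) v.2 1
  have h0 : mfderiv (𝓡 n) (𝓡 n) (chartAt (EuclideanSpace ℝ (Fin n)) x).symm w
      (0 : EuclideanSpace ℝ (Fin n)) = 0 := map_zero _
  have hz : mfderiv ((𝓡 n).prod 𝓘(ℝ, ℝ)) (𝓡 m) Φ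
      ((chartAt (EuclideanSpace ℝ (Fin n)) x).symm w, t)
      ((0 : EuclideanSpace ℝ (Fin n)), (0 : ℝ)) = 0 := map_zero _
  refine h1.trans ?_
  rw [h0, mul_one]
  refine (congrArg (fun r => r + c * v.2) ?_).trans (zero_add _)
  refine (congrArg _ hz).trans (map_zero _)

theorem IsHorizontalTube.mfderiv_coordTube_surjective (h : IsHorizontalTube n g c π Φ) {x : M₀}
    {w : EuclideanSpace ℝ (Fin n)} {t : ℝ}
    (hw : w ∈ (chartAt (EuclideanSpace ℝ (Fin n)) x).target) :
    Function.Surjective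
      (mfderiv 𝓘(ℝ, EuclideanSpace ℝ (Fin n) × ℝ) (𝓡 m) (coordTube Φ x) (w, t)) := by
  rw [(hasMFDerivAt_coordTube (t := t) h.isLocalDiffeomorph.contMDiff hw).mfderiv]
  intro y
  obtain ⟨⟨v, s⟩, hv⟩ := (h.mfderiv_bijective ((chartAt (EuclideanSpace ℝ (Fin n)) x).symm w, t)).2 y
  obtain ⟨u, hu⟩ := (mdifferentiable_of_mem_maximalAtlas
    (IsManifold.chart_mem_maximalAtlas (I := 𝓡 n) (n := ∞) x)).symm.mfderiv_surjective
      (x := w) (by simpa using hw) v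
  refine ⟨(u, s), ?_⟩
  rw [← hv, ← hu]
  rfl

end Tube

/-! ### The tension field on a tube -/

section TubeTension

/-- The matrix on the left is AᵀGA, where A has the vectors `a j` as columns. -/
theorem Matrix.det_of_dotProduct_mulVec {m : ℕ} (G : Matrix (Fin m) (Fin m) ℝ)
    (a : Fin m → Fin m → ℝ) :
    (Matrix.of fun i j => a i ⬝ᵥ G.mulVec (a j)).det =
      G.det * (Matrix.of fun i j => a j i).det ^ 2 := by
  have : (Matrix.of fun i j => a i ⬝ᵥ G.mulVec (a j)) =
      (Matrix.of fun i j => a j i).transpose * G * (Matrix.of fun i j => a j i) := by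
    ext i j
    rw [Matrix.mul_assoc, Matrix.mul_apply]
    rfl
  rw [this, Matrix.det_mul, Matrix.det_mul, Matrix.det_transpose]
  ring

variable {m n : ℕ} {M : Type*} [TopologicalSpace M] [ChartedSpace (EuclideanSpace ℝ (Fin m)) M]
  [IsManifold (𝓡 m) ∞ M]
  {M₀ : Type*} [TopologicalSpace M₀] [ChartedSpace (EuclideanSpace ℝ (Fin n)) M₀]
  [IsManifold (𝓡 n) ∞ M₀]
  {g : SmoothMetric m M} {c : ℝ} {π : M → Circle} {Φ : M₀ × ℝ → M}

theorem contDiff_det_sliceGram (hΦ : ContMDiff ((𝓡 n).prod 𝓘(ℝ, ℝ)) (𝓡 m) ∞ Φ) (x : M₀) :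
    ContDiff ℝ ∞ (fun t => (sliceGram g Φ x (stdFrame n x) t).det) := by
  rw [contDiff_iff_contDiffAt]
  intro t
  refine ContDiffAt.matrix_det fun i j => ?_
  have h1 := g.contDiffAt_inner_mfderiv (contMDiffAt_coordTube (t := t) hΦ
    (mem_chart_target (EuclideanSpace ℝ (Fin n)) x)) (prodFrame (Sum.inl i)) (prodFrame (Sum.inl j))
  have h2 : ContDiffAt ℝ ∞ (fun t : ℝ => (chartAt (EuclideanSpace ℝ (Fin n)) x x, t)) t := by
    fun_prop
  refine (h1.comp t h2).congr_of_eventuallyEq (Filter.Eventually.of_forall fun s => ?_)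
  change g.inner (Φ (x, s)) _ _ = g.inner _ _ _
  rw [mfderiv_coordTube_self hΦ, mfderiv_coordTube_self hΦ]
  have : coordTube Φ x (chartAt (EuclideanSpace ℝ (Fin n)) x x, s) = Φ (x, s) := by
    simp [coordTube, (chartAt (EuclideanSpace ℝ (Fin n)) x).left_inv (mem_chart_source _ x)]
  rw [this]
  rfl

/-- On a tube, the tension field of the projection vanishes if and only if the volume density of the
slices is stationary. -/
theorem IsHorizontalTube.tensionField_eq_zero_iff (h : IsHorizontalTube n g c π Φ) (hc : 0 < c)
    (hπ : ContMDiff (𝓡 m) (𝓡 1) ∞ π) {x : M₀} {t₀ : ℝ}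
    {e : OpenPartialHomeomorph M (EuclideanSpace ℝ (Fin m))}
    (he : e ∈ IsManifold.maximalAtlas (𝓡 m) ∞ M)
    {f : OpenPartialHomeomorph Circle (EuclideanSpace ℝ (Fin 1))}
    (hf : f ∈ IsManifold.maximalAtlas (𝓡 1) ∞ Circle)
    (hx : Φ (x, t₀) ∈ e.source) (hq : π (Φ (x, t₀)) ∈ f.source) :
    tensionField g (circleMetric c hc) π e f 0 (e (Φ (x, t₀))) = 0 ↔
      deriv (fun t => (sliceGram g Φ x (stdFrame n x) t).det) t₀ = 0 := by
  have hΦ := h.isLocalDiffeomorph.contMDiff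
  set κ := chartAt (EuclideanSpace ℝ (Fin n)) x
  set w₀ := κ x
  have hw₀ : w₀ ∈ κ.target := mem_chart_target _ x
  have hb : ∀ t, coordTube Φ x (w₀, t) = Φ (x, t) := fun t => by
    change Φ (κ.symm (κ x), t) = _
    rw [κ.left_inv (mem_chart_source _ x)]
  have hbs : ∀ {w t}, w ∈ κ.target → ContMDiffAt 𝓘(ℝ, EuclideanSpace ℝ (Fin n) × ℝ) (𝓡 m) ∞
      (coordTube Φ x) (w, t) := fun hw => contMDiffAt_coordTube hΦ hw
  set ψ : EuclideanSpace ℝ (Fin n) × ℝ → EuclideanSpace ℝ (Fin m) :=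
    fun p => e (coordTube Φ x p) with hψdef
  have hψs : ∀ {w t}, w ∈ κ.target → coordTube Φ x (w, t) ∈ e.source →
      ContDiffAt ℝ ∞ ψ (w, t) := fun hw hs =>
    contMDiffAt_iff_contDiffAt.1 ((contMDiffAt_of_mem_maximalAtlas he hs).comp _ (hbs hw))
  set z₀ := e (Φ (x, t₀)) with hz₀def
  have hψ0 : ψ (w₀, t₀) = z₀ := by rw [hψdef, hz₀def, ← hb]
  have hz₀ : z₀ ∈ e.target := e.map_source hx
  have hez₀ : e.symm z₀ = Φ (x, t₀) := e.left_inv hx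
  set θ : EuclideanSpace ℝ (Fin m) → ℝ := fun z => angleNear t₀ (π (e.symm z)) with hθdef
  have hθs : ∀ {z}, z ∈ e.target → π (e.symm z) ∈ angleDomain t₀ → ContDiffAt ℝ ∞ θ z :=
    fun {z} hz hd => contMDiffAt_iff_contDiffAt.1
      (ContMDiffAt.comp (f := fun z => π (e.symm z)) z (contMDiffAt_angleNear hd)
        ((hπ (e.symm z)).comp z (contMDiffAt_symm_of_mem_maximalAtlas he hz)))
  have hθ0 : ContDiffAt ℝ ∞ θ z₀ := hθs hz₀ (by
    rw [hez₀, h.proj]; exact self_exp_mem_angleDomain t₀)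
  -- X is c grad θ, the coordinate expression of Φ_*∂_t, as `hflow` shows.
  let X : EuclideanSpace ℝ (Fin m) → EuclideanSpace ℝ (Fin m) := fun z =>
    WithLp.toLp 2 ((metricMatrix g e z)⁻¹.mulVec (c • fun i => partialDeriv i θ z))
  have hX : ∀ {z}, z ∈ e.target → (metricMatrix g e z).mulVec (X z).ofLp =
      c • fun i => partialDeriv i θ z := fun {z} hz => by
    change (metricMatrix g e z).mulVec ((metricMatrix g e z)⁻¹.mulVec _) = _
    rw [Matrix.mulVec_mulVec, Matrix.mul_nonsing_inv _ (metricMatrix_det_pos g he hz).ne'.isUnit,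
      Matrix.one_mulVec]
  have hXd : DifferentiableAt ℝ X z₀ := by
    rw [differentiableAt_euclidean]
    intro j
    change DifferentiableAt ℝ (fun z => ∑ i, (metricMatrix g e z)⁻¹ j i *
      (c * partialDeriv i θ z)) z₀
    refine DifferentiableAt.fun_sum fun i _ => ?_
    refine ((contDiffAt_metricMatrix_inv g he hz₀ j i).differentiableAt (by simp)).mul
      (DifferentiableAt.const_mul ?_ c)
    exact ((hθ0.fderiv_right (m := ∞) (by simp)).clm_apply contDiffAt_const).differentiableAt
      (by simp)
  have htension := tensionField_circle g hc he hf hz₀ (by rw [hez₀]; exact hq) hθ0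
    (Filter.Eventually.of_forall fun z => (exp_angleNear t₀ _).symm) hXd
    (by filter_upwards [e.open_target.mem_nhds hz₀] with z hz using hX hz)
  have hsource : ∀ᶠ p in nhds (w₀, t₀), coordTube Φ x p ∈ e.source :=
    (hbs hw₀).continuousAt.preimage_mem_nhds (e.open_source.mem_nhds (by rw [hb]; exact hx))
  have hflow : ∀ᶠ p in nhds (w₀, t₀), fderiv ℝ ψ p (0, 1) = X (ψ p) := by
    have h1 : ∀ᶠ p : EuclideanSpace ℝ (Fin n) × ℝ in nhds (w₀, t₀), p.1 ∈ κ.target :=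
      continuous_fst.continuousAt.preimage_mem_nhds (κ.open_target.mem_nhds hw₀)
    have h2 : ∀ᶠ p : EuclideanSpace ℝ (Fin n) × ℝ in nhds (w₀, t₀), |p.2 - t₀| < Real.pi :=
      (by fun_prop : Continuous fun p : EuclideanSpace ℝ (Fin n) × ℝ => |p.2 - t₀|).continuousAt
        |>.preimage_mem_nhds (Iio_mem_nhds (by simp [Real.pi_pos]))
    -- The branch of the angle recovers t only while |t − t₀| < π.
    have h3 : (fun p => θ (ψ p)) =ᶠ[nhds (w₀, t₀)] Prod.snd := by
      filter_upwards [hsource, h2] with p hp1 hp2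
      change angleNear t₀ (π (e.symm (e (coordTube Φ x p)))) = p.2
      rw [e.left_inv hp1, coordTube, h.proj, angleNear_exp hp2]
    filter_upwards [hsource, h1, h2, h3.eventuallyEq_nhds] with p hp1 hp2 hp3 hp4
    obtain ⟨w, t⟩ := p
    replace hp2 : w ∈ κ.target := hp2
    replace hp3 : |t - t₀| < Real.pi := hp3
    have hzt : ψ (w, t) ∈ e.target := e.map_source hp1
    have hψd : DifferentiableAt ℝ ψ (w, t) := (hψs hp2 hp1).differentiableAt (by simp)
    have hθd : DifferentiableAt ℝ θ (ψ (w, t)) := by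
      refine (hθs hzt ?_).differentiableAt (by simp)
      change π (e.symm (e (coordTube Φ x (w, t)))) ∈ _
      rw [e.left_inv hp1, coordTube, h.proj]
      exact exp_mem_angleDomain hp3
    have hbd := (hbs (t := t) hp2).mdifferentiableAt (by simp)
    have hG : (metricMatrix g e (ψ (w, t))).mulVec (fderiv ℝ ψ (w, t) (0, 1)).ofLp =
        c • fun i => partialDeriv i θ (ψ (w, t)) := by
      -- Nondegeneracy: Dψ is onto, so it suffices to test against a = Dψ v, where the left side is
      -- g(Φ_*v, Φ_*∂_t) = c v.2 and the right side is c dθ(Dψ v) = c v.2.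
      refine dotProduct_eq _ _ fun a => ?_
      obtain ⟨v, hv⟩ := h.mfderiv_coordTube_surjective (t := t) hp2
        (mfderiv (𝓡 m) (𝓡 m) e.symm (e (coordTube Φ x (w, t)))
          (WithLp.toLp 2 a : EuclideanSpace ℝ (Fin m)))
      have hva : fderiv ℝ ψ (w, t) v = WithLp.toLp 2 a := by
        have hd := mdifferentiable_of_mem_maximalAtlas he
        have e1 : fderiv ℝ ψ (w, t) =
            (mfderiv (𝓡 m) (𝓡 m) e (coordTube Φ x (w, t))).comp
              (mfderiv 𝓘(ℝ, EuclideanSpace ℝ (Fin n) × ℝ) (𝓡 m) (coordTube Φ x) (w, t)) := by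
          rw [← mfderiv_eq_fderiv]
          exact mfderiv_comp (w, t) (hd.mdifferentiableAt hp1) hbd
        have e2 := hd.comp_symm_deriv hzt
        have e3 : e.symm (ψ (w, t)) = coordTube Φ x (w, t) := e.left_inv hp1
        rw [e3] at e2
        rw [e1]
        refine (congrArg (mfderiv (𝓡 m) (𝓡 m) e (coordTube Φ x (w, t))) hv).trans ?_
        exact congrArg (fun L : EuclideanSpace ℝ (Fin m) →L[ℝ] EuclideanSpace ℝ (Fin m) =>
          L (WithLp.toLp 2 a)) e2
      have e1 := (inner_mfderiv_eq_metricMatrix (V := EuclideanSpace ℝ (Fin n) × ℝ) g he hbd hp1 v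
        ((0 : EuclideanSpace ℝ (Fin n)), (1 : ℝ))).symm.trans (h.inner_coordTube (t := t) hp2 v)
      change (fderiv ℝ ψ (w, t) v).ofLp ⬝ᵥ
        (metricMatrix g e (ψ (w, t))).mulVec (fderiv ℝ ψ (w, t) (0, 1)).ofLp = c * v.2 at e1
      have e2 : v.2 = fderiv ℝ θ (ψ (w, t)) (fderiv ℝ ψ (w, t) v) := by
        have e3 := hp4.fderiv_eq (𝕜 := ℝ)
        have e4 : fderiv ℝ (fun p => θ (ψ p)) (w, t) =
            (fderiv ℝ θ (ψ (w, t))).comp (fderiv ℝ ψ (w, t)) := fderiv_comp (w, t) hθd hψd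
        have e5 : fderiv ℝ (Prod.snd : EuclideanSpace ℝ (Fin n) × ℝ → ℝ) (w, t) =
            ContinuousLinearMap.snd ℝ _ _ := fderiv_snd
        rw [e4, e5] at e3
        exact (congrArg (fun L : EuclideanSpace ℝ (Fin n) × ℝ →L[ℝ] ℝ => L v) e3).symm
      rw [e2, hva, EuclideanSpace.clm_apply_eq_sum (fderiv ℝ θ (ψ (w, t)))] at e1
      rw [dotProduct_comm, dotProduct_comm _ a]
      refine e1.trans ?_
      simp only [dotProduct, Pi.smul_apply, smul_eq_mul, Finset.mul_sum, partialDeriv]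
      exact Finset.sum_congr rfl fun i _ => by ring
    have hinj := Matrix.mulVec_injective_of_isUnit
      ((Matrix.isUnit_iff_isUnit_det _).2 (metricMatrix_det_pos g he hzt).ne'.isUnit)
    have := hinj (hG.trans (hX hzt).symm)
    exact WithLp.ofLp_injective 2 this
  set ρ := fun z => √(metricMatrix g e z).det with hρ
  have hρd : DifferentiableAt ℝ ρ z₀ :=
    (contDiffAt_sqrt_det_metricMatrix g he hz₀).differentiableAt (by simp)
  -- The frame of M₀ × ℝ is reindexed by `Fin m` so that Dψ has a square matrix.
  let σ : Fin n ⊕ Fin 1 ≃ Fin m := finSumFinEquiv.trans (finCongr (h.finrank_eq (x, t₀)))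
  let a : Fin m → EuclideanSpace ℝ (Fin n) × ℝ := fun j => prodFrame (σ.symm j)
  have hliou := hasDerivAt_mul_det_fderiv (w₀ := w₀) (t₀ := t₀) (ψ := ψ) (X := X) (ρ := ρ)
    ((hψs hw₀ (by rw [hb]; exact hx)).of_le (by norm_cast))
    (by rw [hψ0]; exact hXd) (by rw [hψ0]; exact hρd) hflow a
  set D := fun t => ρ (ψ (w₀, t)) *
    (Matrix.of fun i j => fderiv ℝ ψ (w₀, t) (a j) i).det with hD
  -- The Gram determinant of the full frame is c times that of the slice, and also det G · (det Dψ)²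
  -- = D².
  have hDsq : ∀ᶠ t in nhds t₀, (sliceGram g Φ x (stdFrame n x) t).det = D t ^ 2 * c⁻¹ := by
    have h1 : ∀ᶠ t in nhds t₀, coordTube Φ x (w₀, t) ∈ e.source :=
      (by fun_prop : Continuous fun t : ℝ => (w₀, t)).continuousAt.eventually hsource
    filter_upwards [h1] with t ht
    have h2 := h.det_gram_prodFrame x t
    have hbd := (hbs (t := t) hw₀).mdifferentiableAt (by simp)
    have h3 : (Matrix.of fun i j => g.inner (Φ (x, t))
        (mfderiv ((𝓡 n).prod 𝓘(ℝ, ℝ)) (𝓡 m) Φ (x, t) (prodFrame i))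
        (mfderiv ((𝓡 n).prod 𝓘(ℝ, ℝ)) (𝓡 m) Φ (x, t) (prodFrame j))) =
        (Matrix.of fun i j => (fderiv ℝ ψ (w₀, t) (a i)).ofLp ⬝ᵥ
          (metricMatrix g e (ψ (w₀, t))).mulVec (fderiv ℝ ψ (w₀, t) (a j)).ofLp).submatrix σ σ := by
      ext i j
      simp only [Matrix.submatrix_apply, Matrix.of_apply, a, Equiv.symm_apply_apply]
      have h4 := inner_mfderiv_eq_metricMatrix g he hbd ht (prodFrame i) (prodFrame j)
      rw [mfderiv_coordTube_self hΦ, mfderiv_coordTube_self hΦ] at h4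
      rw [hb] at h4
      refine h4.trans ?_
      rw [← hb]
    rw [h3, Matrix.det_submatrix_equiv_self, Matrix.det_of_dotProduct_mulVec
      (metricMatrix g e (ψ (w₀, t))) (fun i => (fderiv ℝ ψ (w₀, t) (a i)).ofLp)] at h2
    rw [eq_mul_inv_iff_mul_eq₀ hc.ne', ← h2, hD]
    simp only
    rw [mul_pow, hρ]
    simp only
    rw [Real.sq_sqrt (metricMatrix_det_pos g he (e.map_source ht)).le]
  have hpos := h.det_sliceGram_pos hc x t₀
  have hD0 : D t₀ ≠ 0 := fun h0 => by
    have := hDsq.self_of_nhds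
    rw [h0] at this
    simp at this
    exact hpos.ne' this
  have hρ0 : ρ z₀ ≠ 0 := (Real.sqrt_pos.2 (metricMatrix_det_pos g he hz₀)).ne'
  have hB0 : (Matrix.of fun i j => fderiv ℝ ψ (w₀, t₀) (a j) i).det ≠ 0 := fun h0 =>
    hD0 (by rw [hD]; simp only; rw [h0, mul_zero])
  have hderiv : deriv (fun t => (sliceGram g Φ x (stdFrame n x) t).det) t₀ =
      2 * D t₀ * ((∑ j, partialDeriv j (fun z => ρ z * X z j) (ψ (w₀, t₀))) *
        (Matrix.of fun i j => fderiv ℝ ψ (w₀, t₀) (a j) i).det) * c⁻¹ := by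
    have h1 := (hliou.pow 2).mul_const c⁻¹
    rw [Filter.EventuallyEq.deriv_eq hDsq]
    refine h1.deriv.trans ?_
    norm_num
  rw [hderiv, htension, hψ0]
  have hF : deriv (fun t => f (Circle.exp t) 0) (θ z₀) ≠ 0 :=
    deriv_chart_circleExp_ne_zero hc hf (by rw [hθdef]; simp only; rw [exp_angleNear, hez₀]; exact hq)
  have hk : deriv (fun t => f (Circle.exp t) 0) (θ z₀) / (c * √(metricMatrix g e z₀).det) ≠ 0 :=
    div_ne_zero hF (mul_ne_zero hc.ne' hρ0)
  have hci : c⁻¹ ≠ 0 := inv_ne_zero hc.ne'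
  -- Both quantities are now nonzero multiples of div(ρX) at z₀.
  constructor
  · intro h0
    rw [(mul_eq_zero.1 h0).resolve_left hk]
    ring
  · intro h0
    have h1 := (mul_eq_zero.1 h0).resolve_right hci
    have h2 := (mul_eq_zero.1 h1).resolve_left (mul_ne_zero two_ne_zero hD0)
    have h3 := (mul_eq_zero.1 h2).resolve_right hB0
    rw [h3, mul_zero]

end TubeTension

/-! ### The inverse function theorem, with a smooth inverse -/

/-- Smoothness of a local inverse at a point needs an invertible derivative at the preimage. This is
an open condition, so shrinking the source to the set where it holds makes the inverse smooth on its
whole domain. -/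
theorem ContDiffOn.exists_openPartialHomeomorph {E F : Type*} [NormedAddCommGroup E]
    [NormedSpace ℝ E] [CompleteSpace E] [NormedAddCommGroup F] [NormedSpace ℝ F]
    {f : E → F} {U : Set E} (hU : IsOpen U)
    (hf : ContDiffOn ℝ ∞ f U) {a : E} (ha : a ∈ U) (f' : E ≃L[ℝ] F)
    (hf' : HasFDerivAt f (f' : E →L[ℝ] F) a) :
    ∃ H : OpenPartialHomeomorph E F, a ∈ H.source ∧ H.source ⊆ U ∧ (∀ x, H x = f x) ∧
      ContDiffOn ℝ ∞ H.symm H.target := by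
  have hfa : ContDiffAt ℝ ∞ f a := hf.contDiffAt (hU.mem_nhds ha)
  let H₀ := hfa.toOpenPartialHomeomorph f hf' (by simp)
  let V : Set E := U ∩ fderiv ℝ f ⁻¹' range ((↑) : (E ≃L[ℝ] F) → E →L[ℝ] F)
  have hV : IsOpen V :=
    (hf.continuousOn_fderiv_of_isOpen hU (by simp)).isOpen_inter_preimage hU
      ContinuousLinearEquiv.isOpen
  have haV : a ∈ V := ⟨ha, f', hf'.fderiv.symm⟩
  refine ⟨H₀.restrOpen V hV, ⟨hfa.mem_toOpenPartialHomeomorph_source hf' (by simp), haV⟩,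
    fun x hx => hx.2.1, fun x => rfl, ?_⟩
  intro y hy
  have hs := (H₀.restrOpen V hV).map_target hy
  obtain ⟨L, hL⟩ := hs.2.2
  have hfd : ContDiffAt ℝ ∞ f ((H₀.restrOpen V hV).symm y) := hf.contDiffAt (hU.mem_nhds hs.2.1)
  exact (OpenPartialHomeomorph.contDiffAt_symm _ hy (f₀' := L)
    (by rw [hL]; exact (hfd.differentiableAt (by simp)).hasFDerivAt) hfd).contDiffWithinAt

/-! ### Composition operators on spaces of continuous functions -/

section Nemytskii

variable {K : Type*} [TopologicalSpace K] [CompactSpace K]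

/-- Pointwise application of a continuous family of linear maps. -/
noncomputable def ContinuousMap.clmApply {E F : Type*} [NormedAddCommGroup E] [NormedSpace ℝ E]
    [NormedAddCommGroup F] [NormedSpace ℝ F] :
    C(K, E →L[ℝ] F) →L[ℝ] C(K, E) →L[ℝ] C(K, F) :=
  LinearMap.mkContinuous₂
    (LinearMap.mk₂ ℝ (fun (A : C(K, E →L[ℝ] F)) (h : C(K, E)) => (⟨fun t => A t (h t), by fun_prop⟩ : C(K, F)))
      (fun _ _ _ => by ext; simp) (fun _ _ _ => by ext; simp) (fun _ _ _ => by ext; simp)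
      (fun _ _ _ => by ext; simp)) 1
    (fun A h => by
      rw [ContinuousMap.norm_le _ (by positivity)]
      intro t
      rw [one_mul]
      exact (A t).le_of_opNorm_le_of_le (A.norm_coe_le_norm t) (h.norm_coe_le_norm t))

@[simp]
theorem ContinuousMap.clmApply_apply {E F : Type*} [NormedAddCommGroup E] [NormedSpace ℝ E]
    [NormedAddCommGroup F] [NormedSpace ℝ F] (A : C(K, E →L[ℝ] F)) (h : C(K, E)) (t : K) :
    ContinuousMap.clmApply A h t = A t (h t) := rfl

/-- The mean value inequality is applied at each t on the segment from γ(t) to γ(t) + v(t). The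
bound is uniform in t because γ ↦ f' ∘ γ is continuous in the supremum norm. -/
theorem ContinuousMap.hasFDerivAt_comp_left {E F : Type*} [NormedAddCommGroup E]
    [NormedSpace ℝ E] [NormedAddCommGroup F] [NormedSpace ℝ F] {f : C(E, F)}
    {f' : C(E, E →L[ℝ] F)} (hf : ∀ x, HasFDerivAt f (f' x) x) (γ : C(K, E)) :
    HasFDerivAt (fun γ : C(K, E) => f.comp γ) (ContinuousMap.clmApply (f'.comp γ)) γ := by
  rw [hasFDerivAt_iff_isLittleO_nhds_zero, Asymptotics.isLittleO_iff]
  intro ε hε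
  have hc : ContinuousAt (fun γ : C(K, E) => f'.comp γ) γ :=
    (ContinuousMap.continuous_postcomp f').continuousAt
  obtain ⟨δ, hδ, h⟩ : ∃ δ > 0, ∀ ⦃η : C(K, E)⦄, dist η γ < δ →
      dist (f'.comp η) (f'.comp γ) < ε := Metric.continuousAt_iff.1 hc ε hε
  filter_upwards [Metric.ball_mem_nhds (0 : C(K, E)) hδ] with v hv
  rw [ContinuousMap.norm_le _ (by positivity)]
  intro t
  have hseg : ∀ z ∈ segment ℝ (γ t) (γ t + v t), ‖f' z - f' (γ t)‖ ≤ ε := by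
    intro z hz
    rw [segment_eq_image'] at hz
    obtain ⟨s, hs, rfl⟩ := hz
    have h1 : dist (γ + s • v) γ < δ := by
      rw [dist_eq_norm, add_sub_cancel_left, norm_smul, Real.norm_of_nonneg hs.1]
      have : ‖v‖ < δ := by simpa using hv
      nlinarith [norm_nonneg v, hs.2]
    have h2 := (ContinuousMap.dist_apply_le_dist (f := f'.comp (γ + s • v)) (g := f'.comp γ) t).trans
      (h h1).le
    rw [dist_eq_norm] at h2
    simpa using h2
  have h3 := (convex_segment (𝕜 := ℝ) (γ t) (γ t + v t)).norm_image_sub_le_of_norm_hasFDerivWithin_le'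
    (fun z _ => (hf z).hasFDerivWithinAt) hseg (left_mem_segment ..) (right_mem_segment ..)
  rw [add_sub_cancel_left] at h3
  refine le_trans ?_ (h3.trans (mul_le_mul_of_nonneg_left (v.norm_coe_le_norm t) hε.le))
  simp

/-- Induction on the order: the derivative is composition with f' followed by a continuous linear
map. The induction replaces F by `E →L[ℝ] F`, which is why E and F share a universe. -/
theorem ContinuousMap.contDiff_comp_left {E F : Type u} [NormedAddCommGroup E]
    [NormedSpace ℝ E] [NormedAddCommGroup F] [NormedSpace ℝ F] (f : C(E, F))
    (hf : ContDiff ℝ ∞ f) : ContDiff ℝ ∞ (fun γ : C(K, E) => f.comp γ) := by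
  rw [contDiff_infty]
  intro k
  replace hf : ContDiff ℝ k f := hf.of_le (by exact_mod_cast le_top)
  induction k generalizing F with
  | zero => exact contDiff_zero.2 (ContinuousMap.continuous_postcomp f)
  | succ k ih =>
    push_cast at hf ⊢
    have h1 := contDiff_succ_iff_fderiv.1 hf
    let f' : C(E, E →L[ℝ] F) := ⟨fderiv ℝ f, h1.2.2.continuous⟩
    have h2 := fun γ : C(K, E) =>
      ContinuousMap.hasFDerivAt_comp_left (f := f) (f' := f') (fun x => (h1.1 x).hasFDerivAt) γ
    have h3 := ih f' h1.2.2
    refine contDiff_succ_iff_fderiv.2 ⟨fun γ => (h2 γ).differentiableAt, by simp, ?_⟩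
    rw [show fderiv ℝ (fun γ : C(K, E) => f.comp γ) =
      fun γ => ContinuousMap.clmApply (f'.comp γ) from funext fun γ => (h2 γ).fderiv]
    exact ContinuousMap.clmApply.contDiff.comp h3

end Nemytskii

/-! ### Local flows -/

section LocalFlow

variable {E : Type u} [NormedAddCommGroup E] [NormedSpace ℝ E] [CompleteSpace E]

/-- `h ↦ (t ↦ ∫₀ᵗ h)` on continuous functions on `[-1, 1]`. -/
noncomputable def primitiveCLM : C(Icc (-1 : ℝ) 1, E) →L[ℝ] C(Icc (-1 : ℝ) 1, E) :=
  LinearMap.mkContinuous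
    { toFun := fun h => ⟨fun t => ∫ s in (0 : ℝ)..t, h (projIcc (-1) 1 (by norm_num) s), by
        have : Continuous fun t : ℝ => ∫ s in (0 : ℝ)..t, h (projIcc (-1) 1 (by norm_num) s) :=
          intervalIntegral.continuous_primitive
            (fun a b => (h.continuous.comp continuous_projIcc).intervalIntegrable a b) 0
        exact this.comp continuous_subtype_val⟩
      map_add' := fun h k => by
        ext t
        exact intervalIntegral.integral_add
          ((h.continuous.comp continuous_projIcc).intervalIntegrable _ _)
          ((k.continuous.comp continuous_projIcc).intervalIntegrable _ _)
      map_smul' := fun a h => by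
        ext t
        exact intervalIntegral.integral_smul a _ } 1
    (fun h => by
      rw [ContinuousMap.norm_le _ (by positivity)]
      intro t
      refine (intervalIntegral.norm_integral_le_of_norm_le_const
        (fun s _ => h.norm_coe_le_norm _)).trans ?_
      have : |(t : ℝ) - 0| ≤ 1 := by rw [sub_zero]; exact abs_le.2 t.2
      nlinarith [norm_nonneg h])

/-- Rescaling time turns the solution up to time t into a curve γ on [-1, 1] with γ = x + t ∫₀ f(γ).
At t = 0 the solution is the constant x, and the inverse function theorem in E × C([-1, 1], E) with
t as a parameter gives γ = Γ(t, x), smooth in t and x. The flow is Γ(t, x)(1). -/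
theorem ContDiff.exists_local_flow (f : E → E) (hf : ContDiff ℝ ∞ f) (x₀ : E) :
    ∃ φ : ℝ × E → E, ∃ ε > 0, ∃ V : Set E, IsOpen V ∧ x₀ ∈ V ∧
      (∀ t ∈ Ioo (-ε) ε, ∀ x ∈ V, ContDiffAt ℝ ∞ φ (t, x) ∧
        HasDerivAt (fun s => φ (s, x)) (f (φ (t, x))) t) ∧ ∀ x ∈ V, φ (0, x) = x := by
  let C := C(Icc (-1 : ℝ) 1, E)
  let fC : C(E, E) := ⟨f, hf.continuous⟩
  let k : E →L[ℝ] C :=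
    { toFun := ContinuousMap.const _
      map_add' := fun _ _ => rfl
      map_smul' := fun _ _ => rfl
      cont := ContinuousMap.continuous_const' }
  let N : C → C := fun γ => primitiveCLM (fC.comp γ)
  have hN : ContDiff ℝ ∞ N :=
    primitiveCLM.contDiff.comp (ContinuousMap.contDiff_comp_left fC hf)
  let Θ : ℝ × E × C → ℝ × E × C := fun p => (p.1, p.2.1, p.2.2 - k p.2.1 - p.1 • N p.2.2)
  have hΘ : ContDiff ℝ ∞ Θ := by
    refine contDiff_fst.prodMk ((contDiff_fst.comp contDiff_snd).prodMk ?_)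
    have h2 : ContDiff ℝ ∞ (fun p : ℝ × E × C => p.2.2) := contDiff_snd.comp contDiff_snd
    have h1 : ContDiff ℝ ∞ (fun p : ℝ × E × C => k p.2.1) :=
      k.contDiff.comp (contDiff_fst.comp contDiff_snd)
    exact (h2.sub h1).sub (contDiff_fst.smul (hN.comp h2))
  let p₀ : ℝ × E × C := (0, x₀, k x₀)
  let v : C := N (k x₀)
  let fstL : ℝ × E × C →L[ℝ] ℝ := ContinuousLinearMap.fst ℝ _ _
  let sndL : ℝ × E × C →L[ℝ] E :=
    (ContinuousLinearMap.fst ℝ _ _).comp (ContinuousLinearMap.snd ℝ _ _)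
  let thdL : ℝ × E × C →L[ℝ] C :=
    (ContinuousLinearMap.snd ℝ _ _).comp (ContinuousLinearMap.snd ℝ _ _)
  -- At t = 0 the nonlinear term contributes only through its derivative in t, so the derivative of
  -- Θ is triangular with identity blocks.
  let D : ℝ × E × C →L[ℝ] ℝ × E × C :=
    fstL.prod (sndL.prod (thdL - k.comp sndL - fstL.smulRight v))
  let D' : ℝ × E × C →L[ℝ] ℝ × E × C :=
    fstL.prod (sndL.prod (thdL + k.comp sndL + fstL.smulRight v))
  let L : (ℝ × E × C) ≃L[ℝ] ℝ × E × C := ContinuousLinearEquiv.equivOfInverse D D'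
    (fun p => by
      refine Prod.ext rfl (Prod.ext rfl ?_)
      change p.2.2 - k p.2.1 - p.1 • v + k p.2.1 + p.1 • v = p.2.2
      abel)
    (fun p => by
      refine Prod.ext rfl (Prod.ext rfl ?_)
      change p.2.2 + k p.2.1 + p.1 • v - k p.2.1 - p.1 • v = p.2.2
      abel)
  have hD : HasFDerivAt Θ (L : ℝ × E × C →L[ℝ] ℝ × E × C) p₀ := by
    change HasFDerivAt Θ D p₀
    refine fstL.hasFDerivAt.prodMk (sndL.hasFDerivAt.prodMk ?_)
    refine (thdL.hasFDerivAt.sub (k.comp sndL).hasFDerivAt).sub ?_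
    have h1 : HasFDerivAt (fun p : ℝ × E × C => N p.2.2) ((fderiv ℝ N (k x₀)).comp thdL) p₀ :=
      HasFDerivAt.comp (g := N) (f := fun p : ℝ × E × C => p.2.2) p₀ ((hN.differentiable (by simp) (k x₀)).hasFDerivAt) thdL.hasFDerivAt
    have h2 := (fstL.hasFDerivAt (x := p₀)).smul h1
    have h3 : fstL p₀ = 0 := rfl
    rw [h3, zero_smul, zero_add] at h2
    exact h2
  obtain ⟨H, hp₀, -, hH, hsymm⟩ := ContDiffOn.exists_openPartialHomeomorph isOpen_univ
    hΘ.contDiffOn (mem_univ p₀) L hD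
  obtain ⟨r, hr, hball⟩ := Metric.isOpen_iff.1 H.open_source p₀ hp₀
  let ι : ℝ × E → ℝ × E × C := fun q => (q.1, q.2, 0)
  have hι : ContDiff ℝ ∞ ι := by fun_prop
  have hι₀ : ι (0, x₀) = H p₀ := by
    rw [hH]
    simp [ι, Θ, p₀]
  -- The solution is required to lie in a ball on which Θ is injective, because rescaled solutions
  -- stay in such a ball.
  let W : Set (ℝ × E) := ι ⁻¹' (H.target ∩ H.symm ⁻¹' Metric.ball p₀ r)
  have hW : IsOpen W :=
    (H.symm.isOpen_inter_preimage Metric.isOpen_ball).preimage hι.continuous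
  have hW₀ : ((0 : ℝ), x₀) ∈ W := by
    refine ⟨?_, ?_⟩
    · rw [hι₀]; exact H.map_source hp₀
    · rw [hι₀, mem_preimage, H.left_inv hp₀]; exact Metric.mem_ball_self hr
  obtain ⟨A, V, hA, hV, hA0, hV0, hAV⟩ := isOpen_prod_iff.1 hW 0 x₀ hW₀
  obtain ⟨ε, hε, hεA⟩ := Metric.isOpen_iff.1 hA 0 hA0
  let Γ : ℝ × E → C := fun q => (H.symm (ι q)).2.2
  have hΓ : ∀ {t : ℝ} {x : E}, (t, x) ∈ W → H.symm (ι (t, x)) = (t, x, Γ (t, x)) ∧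
      Γ (t, x) = k x + t • N (Γ (t, x)) := by
    intro t x h
    have h1 : Θ (H.symm (ι (t, x))) = (t, x, 0) := by rw [← hH, H.right_inv h.1]
    have h2 : (H.symm (ι (t, x))).1 = t := congrArg Prod.fst h1
    have h3 : (H.symm (ι (t, x))).2.1 = x := congrArg (fun p => p.2.1) h1
    refine ⟨Prod.ext h2 (Prod.ext h3 rfl), ?_⟩
    have h4 : Γ (t, x) - k (H.symm (ι (t, x))).2.1 - (H.symm (ι (t, x))).1 • N (Γ (t, x)) = 0 :=
      congrArg (fun p => p.2.2) h1
    rw [h2, h3, sub_sub, sub_eq_zero] at h4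
    exact h4
  let one : Icc (-1 : ℝ) 1 := ⟨1, by norm_num, le_rfl⟩
  -- The curve u ↦ Γ(t, x)(su) solves the equation with parameter st and lies in the ball, so by
  -- injectivity of Θ it is Γ(st, x); evaluation at u = 1 gives the claim.
  have hscale : ∀ {t s : ℝ} {x : E} (hs : s ∈ Icc (-1 : ℝ) 1), (t, x) ∈ W → (s * t, x) ∈ W →
      Γ (s * t, x) one = Γ (t, x) ⟨s, hs⟩ := by
    intro t s x hs h h'
    have hs' : ∀ u : Icc (-1 : ℝ) 1, s * u ∈ Icc (-1 : ℝ) 1 := fun u => by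
      refine abs_le.1 ?_
      rw [abs_mul]
      exact mul_le_one₀ (abs_le.2 hs) (abs_nonneg _) (abs_le.2 u.2)
    let β : C := (Γ (t, x)).comp ⟨fun u => ⟨s * u, hs' u⟩, by fun_prop⟩
    have hβ : β = k x + (s * t) • N β := by
      ext u
      change Γ (t, x) ⟨s * u, hs' u⟩ = x + (s * t) • N β u
      rw [(hΓ h).2]
      change x + t • N (Γ (t, x)) ⟨s * u, hs' u⟩ = _
      congr 1
      rw [mul_comm s t, mul_smul]
      congr 1
      change ∫ a in (0 : ℝ)..(s * u), f (Γ (t, x) (projIcc (-1) 1 _ a)) =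
        s • ∫ a in (0 : ℝ)..u, f (β (projIcc (-1) 1 _ a))
      rw [← intervalIntegral.integral_smul]
      have h5 := intervalIntegral.smul_integral_comp_mul_left
        (fun a => f (Γ (t, x) (projIcc (-1) 1 (by norm_num) a))) s (a := 0) (b := (u : ℝ))
      rw [mul_zero] at h5
      rw [← h5, ← intervalIntegral.integral_smul]
      refine intervalIntegral.integral_congr fun a ha => ?_
      have ha' : a ∈ Icc (-1 : ℝ) 1 :=
        (uIcc_subset_Icc (by constructor <;> norm_num) u.2) ha
      have h6 : s * a ∈ Icc (-1 : ℝ) 1 := hs' ⟨a, ha'⟩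
      rw [projIcc_of_mem _ ha', projIcc_of_mem _ h6]
      rfl
    have hmem : (s * t, x, β) ∈ Metric.ball p₀ r := by
      have h7 := h.2
      rw [mem_preimage, (hΓ h).1] at h7
      simp only [Metric.mem_ball, Prod.dist_eq, max_lt_iff, p₀] at h7 ⊢
      refine ⟨lt_of_le_of_lt ?_ h7.1, h7.2.1, ?_⟩
      · rw [dist_zero_right, dist_zero_right, norm_mul]
        exact mul_le_of_le_one_left (norm_nonneg _) (abs_le.2 hs)
      · rw [ContinuousMap.dist_lt_iff hr]
        intro u
        exact (ContinuousMap.dist_apply_le_dist (f := Γ (t, x)) (g := k x₀)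
          ⟨s * u, hs' u⟩).trans_lt h7.2.2
    have hinj : H.symm (ι (s * t, x)) = (s * t, x, β) := by
      rw [← H.left_inv (hball hmem), hH]
      congr 1
      refine Prod.ext rfl (Prod.ext rfl ?_)
      change 0 = β - k x - (s * t) • N β
      rw [sub_sub, ← hβ, sub_self]
    have h8 : Γ (s * t, x) = β := congrArg (fun p => p.2.2) hinj
    rw [h8]
    change Γ (t, x) ⟨s * 1, _⟩ = _
    congr 2
    exact mul_one s
  -- Half of ε keeps the endpoint T = ε/2 admissible. All values on [-T, T] are then read off the
  -- one curve Γ(T, x), where the fundamental theorem of calculus applies.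
  refine ⟨fun q => Γ q one, ε / 2, half_pos hε, V, hV, hV0, fun t ht x hx => ⟨?_, ?_⟩, ?_⟩
  · have hmem : (t, x) ∈ W := hAV ⟨hεA (by
      rw [Metric.mem_ball, dist_zero_right, Real.norm_eq_abs, abs_lt]
      constructor <;> linarith [ht.1, ht.2]), hx⟩
    have h1 : ContDiffAt ℝ ∞ (fun q => H.symm (ι q)) (t, x) :=
      (hsymm.contDiffAt (H.open_target.mem_nhds hmem.1)).comp _ hι.contDiffAt
    let ev : C →L[ℝ] E := ContinuousMap.evalCLM ℝ one
    exact (ev.contDiff.comp (contDiff_snd.comp contDiff_snd)).contDiffAt.comp _ h1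
  · set T := ε / 2 with hT
    have hTpos : 0 < T := half_pos hε
    have hWt : ∀ {s}, s ∈ Icc (-T) T → (s, x) ∈ W := fun hs => hAV ⟨hεA (by
      rw [Metric.mem_ball, dist_zero_right, Real.norm_eq_abs, abs_lt]
      constructor <;> linarith [hs.1, hs.2]), hx⟩
    have hTW : (T, x) ∈ W := hWt ⟨by linarith, le_rfl⟩
    have hdiv : ∀ {s}, s ∈ Icc (-T) T → s / T ∈ Icc (-1 : ℝ) 1 := fun hs => by
      constructor
      · rw [le_div_iff₀ hTpos]; linarith [hs.1]
      · rw [div_le_one hTpos]; exact hs.2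
    have hφ : ∀ {s} (hs : s ∈ Icc (-T) T), Γ (s, x) one = Γ (T, x) ⟨s / T, hdiv hs⟩ := by
      intro s hs
      have h1 := hscale (t := T) (x := x) (hdiv hs) hTW
      rw [div_mul_cancel₀ _ hTpos.ne'] at h1
      exact h1 (hWt hs)
    let P : ℝ → E := fun a => f (Γ (T, x) (projIcc (-1) 1 (by norm_num) a))
    have hP : Continuous P :=
      hf.continuous.comp ((Γ (T, x)).continuous.comp continuous_projIcc)
    have h2 : ∀ s ∈ Icc (-T) T, Γ (s, x) one = x + T • ∫ a in (0 : ℝ)..(s / T), P a := by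
      intro s hs
      rw [hφ hs, (hΓ hTW).2]
      rfl
    have h3 : HasDerivAt (fun s : ℝ => x + T • ∫ a in (0 : ℝ)..(s / T), P a)
        (T • ((1 / T) • P (t / T))) t := by
      refine HasDerivAt.const_add x (HasDerivAt.const_smul T ?_)
      exact HasDerivAt.scomp t (h := fun s : ℝ => s / T)
        (intervalIntegral.integral_hasDerivAt_right (hP.intervalIntegrable _ _)
        hP.stronglyMeasurable.stronglyMeasurableAtFilter hP.continuousAt)
        ((hasDerivAt_id t).div_const T)
    rw [smul_smul, mul_one_div_cancel hTpos.ne', one_smul] at h3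
    have h4 : P (t / T) = f (Γ (t, x) one) := by
      have ht' : t ∈ Icc (-T) T := Ioo_subset_Icc_self ht
      change f (Γ (T, x) (projIcc (-1) 1 _ (t / T))) = _
      rw [projIcc_of_mem _ (hdiv ht'), hφ ht']
    rw [h4] at h3
    refine h3.congr_of_eventuallyEq ?_
    filter_upwards [Icc_mem_nhds ht.1 ht.2] with s hs using h2 s hs
  · intro x hx
    have h0 : ((0 : ℝ), x) ∈ W := hAV ⟨hA0, hx⟩
    change Γ (0, x) one = x
    rw [(hΓ h0).2, zero_smul, add_zero]
    rfl

end LocalFlow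

/-! ### The flow of a vector field on a compact manifold -/

section Flow

variable {m : ℕ} {M : Type*} [TopologicalSpace M] [ChartedSpace (EuclideanSpace ℝ (Fin m)) M]
  [IsManifold (𝓡 m) ∞ M] {X : ∀ p : M, TangentSpace (𝓡 m) p}

/-- The coordinate expression of X is multiplied by a bump function, since
`ContDiff.exists_local_flow` needs a field on the whole space. Near z₀ the field is unchanged. -/
theorem exists_contDiff_vectorField_chart
    (hX : ContMDiff (𝓡 m) (𝓡 m).tangent ∞ (fun p => (⟨p, X p⟩ : TangentBundle (𝓡 m) M)))
    {e : OpenPartialHomeomorph M (EuclideanSpace ℝ (Fin m))}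
    (he : e ∈ IsManifold.maximalAtlas (𝓡 m) ∞ M) {z₀ : EuclideanSpace ℝ (Fin m)}
    (hz₀ : z₀ ∈ e.target) :
    ∃ f : EuclideanSpace ℝ (Fin m) → EuclideanSpace ℝ (Fin m), ContDiff ℝ ∞ f ∧
      ∃ B : Set (EuclideanSpace ℝ (Fin m)), IsOpen B ∧ z₀ ∈ B ∧ B ⊆ e.target ∧
        ∀ z ∈ B, mfderiv (𝓡 m) (𝓡 m) e.symm z (f z) = X (e.symm z) := by
  let F : EuclideanSpace ℝ (Fin m) → EuclideanSpace ℝ (Fin m) :=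
    fun z => mfderiv (𝓡 m) (𝓡 m) e (e.symm z) (X (e.symm z))
  have hF : ∀ z ∈ e.target, ContDiffAt ℝ ∞ F z := by
    intro z hz
    have h1 : ContMDiffAt (𝓡 m) (𝓡 m).tangent ∞
        (fun z => (⟨e.symm z, X (e.symm z)⟩ : TangentBundle (𝓡 m) M)) z :=
      (hX (e.symm z)).comp z (contMDiffAt_symm_of_mem_maximalAtlas he hz)
    have h2 := ContMDiffAt.mfderiv_lift (f := e) (b := e.symm) (v := fun z => X (e.symm z))
      (contMDiffAt_of_mem_maximalAtlas he (e.map_target hz)) h1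
    have h3 := (Bundle.contMDiffAt_totalSpace.1 h2).2
    refine contMDiffAt_iff_contDiffAt.1 (h3.congr_of_eventuallyEq ?_)
    exact Filter.Eventually.of_forall fun q => by simp [F]; rfl
  obtain ⟨r, hr, hball⟩ := Metric.isOpen_iff.1 e.open_target z₀ hz₀
  let χ : ContDiffBump z₀ := ⟨r / 4, r / 2, by positivity, by linarith⟩
  refine ⟨fun z => χ z • F z, ?_, Metric.ball z₀ (r / 4), Metric.isOpen_ball,
    Metric.mem_ball_self (by positivity),
    (Metric.ball_subset_ball (by linarith)).trans hball, ?_⟩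
  · refine contDiff_iff_contDiffAt.2 fun z => ?_
    by_cases hz : z ∈ tsupport (fun z => χ z • F z)
    swap
    · exact contDiffAt_const.congr_of_eventuallyEq (notMem_tsupport_iff_eventuallyEq.1 hz)
    have h1 : z ∈ tsupport χ := tsupport_smul_subset_left _ _ hz
    rw [χ.tsupport_eq] at h1
    exact χ.contDiff.contDiffAt.smul
      (hF z (hball (Metric.closedBall_subset_ball (by change r / 2 < r; linarith) h1)))
  · intro z hz
    have hzt : z ∈ e.target := (Metric.ball_subset_ball (by linarith)).trans hball hz
    have h1 : χ z = 1 := χ.one_of_mem_closedBall (Metric.ball_subset_closedBall hz)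
    have h2 : χ z • F z = F z := by rw [h1, one_smul]
    refine (congrArg (mfderiv (𝓡 m) (𝓡 m) e.symm z) h2).trans ?_
    have h3 := (mdifferentiable_of_mem_maximalAtlas he).symm_comp_deriv (e.map_target hzt)
    rw [e.right_inv hzt] at h3
    exact congrArg (fun L : TangentSpace (𝓡 m) (e.symm z) →L[ℝ] TangentSpace (𝓡 m) (e.symm z) =>
      L (X (e.symm z))) h3

/-- The flow in a chart is transported to M, with times and starting points restricted so that it
stays in the set where the cut-off field represents X. -/
theorem exists_local_flow
    (hX : ContMDiff (𝓡 m) (𝓡 m).tangent ∞ (fun p => (⟨p, X p⟩ : TangentBundle (𝓡 m) M)))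
    (p₀ : M) :
    ∃ φ : ℝ × M → M, ∃ ε > 0, ∃ V : Set M, IsOpen V ∧ p₀ ∈ V ∧
      (∀ t ∈ Ioo (-ε) ε, ∀ p ∈ V, ContMDiffAt (𝓘(ℝ, ℝ).prod (𝓡 m)) (𝓡 m) ∞ φ (t, p) ∧
        HasMFDerivAt 𝓘(ℝ, ℝ) (𝓡 m) (fun s => φ (s, p)) t
          ((1 : ℝ →L[ℝ] ℝ).smulRight (X (φ (t, p))))) ∧ ∀ p ∈ V, φ (0, p) = p := by
  set e := chartAt (EuclideanSpace ℝ (Fin m)) p₀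
  have he : e ∈ IsManifold.maximalAtlas (𝓡 m) ∞ M := IsManifold.chart_mem_maximalAtlas p₀
  have hp₀ : p₀ ∈ e.source := mem_chart_source _ p₀
  obtain ⟨f, hf, B, hB, hB₀, hBt, hfX⟩ := exists_contDiff_vectorField_chart hX he
    (e.map_source hp₀)
  obtain ⟨φ, ε, hε, V, hV, hV₀, hφ, hφ0⟩ := hf.exists_local_flow f (e p₀)
  have hW : IsOpen ((Ioo (-ε) ε ×ˢ V) ∩ φ ⁻¹' B) := by
    refine ContinuousOn.isOpen_inter_preimage ?_ (isOpen_Ioo.prod hV) hB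
    rintro ⟨t, x⟩ h
    exact (hφ t h.1 x h.2).1.continuousAt.continuousWithinAt
  obtain ⟨A, V', hA, hV', hA0, hV'0, hAV⟩ := isOpen_prod_iff.1 hW 0 (e p₀)
    ⟨⟨⟨by linarith, hε⟩, hV₀⟩, by rw [mem_preimage, hφ0 _ hV₀]; exact hB₀⟩
  obtain ⟨δ, hδ, hδA⟩ := Metric.isOpen_iff.1 hA 0 hA0
  rw [Real.ball_eq_Ioo, zero_sub, zero_add] at hδA
  refine ⟨fun q => e.symm (φ (q.1, e q.2)), δ, hδ, e.source ∩ e ⁻¹' V',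
    e.isOpen_inter_preimage hV', ⟨hp₀, hV'0⟩, ?_, ?_⟩
  · intro t ht p hp
    have h1 : (t, e p) ∈ (Ioo (-ε) ε ×ˢ V) ∩ φ ⁻¹' B := hAV ⟨hδA ht, hp.2⟩
    have h2 := hφ t h1.1.1 _ h1.1.2
    have hy : φ (t, e p) ∈ e.target := hBt h1.2
    constructor
    · have h3 : ContMDiffAt (𝓘(ℝ, ℝ).prod (𝓡 m)) 𝓘(ℝ, ℝ × EuclideanSpace ℝ (Fin m)) ∞
          (fun q : ℝ × M => (q.1, e q.2)) (t, p) := by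
        refine ContMDiffAt.prodMk_space contMDiffAt_fst ?_
        exact ContMDiffAt.comp (t, p) (contMDiffAt_of_mem_maximalAtlas he hp.1) contMDiffAt_snd
      have h4 : ContMDiffAt (𝓘(ℝ, ℝ).prod (𝓡 m)) (𝓡 m) ∞ (fun q : ℝ × M => φ (q.1, e q.2)) (t, p) :=
        ContMDiffAt.comp (g := φ) (t, p) h2.1.contMDiffAt h3
      exact ContMDiffAt.comp (g := e.symm) (t, p) (contMDiffAt_symm_of_mem_maximalAtlas he hy) h4
    · have h3 : HasMFDerivAt (𝓡 m) (𝓡 m) e.symm (φ (t, e p))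
          (mfderiv (𝓡 m) (𝓡 m) e.symm (φ (t, e p))) :=
        ((mdifferentiable_of_mem_maximalAtlas he).mdifferentiableAt_symm hy).hasMFDerivAt
      have h4 : HasMFDerivAt 𝓘(ℝ, ℝ) (𝓡 m) (fun s => φ (s, e p)) t
          ((1 : ℝ →L[ℝ] ℝ).smulRight (f (φ (t, e p)))) := h2.2.hasFDerivAt.hasMFDerivAt
      have h5 := h3.comp (f := fun s => φ (s, e p)) t h4
      refine h5.congr_mfderiv ?_
      refine ContinuousLinearMap.ext_ring ?_
      have h6 := hfX _ h1.2
      change mfderiv (𝓡 m) (𝓡 m) e.symm (φ (t, e p)) ((1 : ℝ) • f (φ (t, e p))) =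
        (1 : ℝ) • X (e.symm (φ (t, e p)))
      rw [one_smul]
      exact h6.trans (one_smul ℝ _).symm
  · intro p hp
    have h1 : ((0 : ℝ), e p) ∈ (Ioo (-ε) ε ×ˢ V) ∩ φ ⁻¹' B :=
      hAV ⟨hA0, hp.2⟩
    change e.symm (φ (0, e p)) = p
    rw [hφ0 _ h1.1.2, e.left_inv hp.1]

/-- A smooth vector field on a compact manifold has a smooth global flow. -/
theorem exists_flow [T2Space M] [CompactSpace M]
    (hX : ContMDiff (𝓡 m) (𝓡 m).tangent ∞ (fun p => (⟨p, X p⟩ : TangentBundle (𝓡 m) M))) :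
    ∃ φ : ℝ → M → M,
      ContMDiff (𝓘(ℝ, ℝ).prod (𝓡 m)) (𝓡 m) ∞ (fun q : ℝ × M => φ q.1 q.2) ∧
      (∀ p, φ 0 p = p) ∧ (∀ s t p, φ (s + t) p = φ s (φ t p)) ∧
      ∀ p t, HasMFDerivAt 𝓘(ℝ, ℝ) (𝓡 m) (fun s => φ s p) t
        ((1 : ℝ →L[ℝ] ℝ).smulRight (X (φ t p))) := by
  have hX1 : ContMDiff (𝓡 m) (𝓡 m).tangent 1 (fun p => (⟨p, X p⟩ : TangentBundle (𝓡 m) M)) :=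
    hX.of_le (by simp)
  choose ψ ε hε V hV hpV hψ hψ0 using exists_local_flow hX
  obtain ⟨T, hT⟩ := CompactSpace.elim_nhds_subcover V (fun p => (hV p).mem_nhds (hpV p))
  -- Finitely many local flows cover M, so they have a common lifetime δ, which makes integral
  -- curves extend to all times.
  obtain ⟨δ, hδ, hδT⟩ : ∃ δ > 0, ∀ p ∈ T, δ ≤ ε p := by
    rcases T.eq_empty_or_nonempty with h | h
    · exact ⟨1, one_pos, by simp [h]⟩
    · obtain ⟨q, hq, hq'⟩ := T.exists_min_image ε h
      exact ⟨ε q, hε q, hq'⟩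
  have hcov : ∀ p : M, ∃ q ∈ T, p ∈ V q := fun p => by
    have : p ∈ ⋃ x ∈ T, V x := by rw [hT]; trivial
    simpa using this
  have hsub : ∀ {q}, q ∈ T → Ioo (-δ) δ ⊆ Ioo (-ε q) (ε q) := fun hq =>
    Ioo_subset_Ioo (neg_le_neg (hδT _ hq)) (hδT _ hq)
  have hloc : ∀ q ∈ T, ∀ p ∈ V q, IsMIntegralCurveOn (fun t => ψ q (t, p)) X (Ioo (-δ) δ) :=
    fun q hq p hp t ht => (hψ q t (hsub hq ht) p hp).2.hasMFDerivWithinAt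
  have hex : ∀ p : M, ∃ γ : ℝ → M, γ 0 = p ∧ IsMIntegralCurve (I := 𝓡 m) γ X :=
    exists_isMIntegralCurve_of_isMIntegralCurveOn hX1 hδ fun p => by
      obtain ⟨q, hq, hp⟩ := hcov p
      exact ⟨fun t => ψ q (t, p), hψ0 q p hp, hloc q hq p hp⟩
  choose γ hγ0 hγ using hex
  have hadd : ∀ s t p, γ p (s + t) = γ (γ p t) s := by
    intro s t p
    have h1 : IsMIntegralCurve (γ p ∘ (· + t)) X := (hγ p).comp_add t
    exact congrFun (isMIntegralCurve_Ioo_eq_of_contMDiff_boundaryless (t₀ := 0) hX1 h1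
      (hγ (γ p t)) (by simp [hγ0])) s
  -- For short times the global curves agree with the local flows by uniqueness of integral curves,
  -- and so inherit their smoothness.
  have hsmall : ∀ t ∈ Ioo (-δ) δ, ∀ p,
      ContMDiffAt (𝓘(ℝ, ℝ).prod (𝓡 m)) (𝓡 m) ∞ (fun q : ℝ × M => γ q.2 q.1) (t, p) := by
    intro t ht p
    obtain ⟨q, hq, hp⟩ := hcov p
    refine (hψ q t (hsub hq ht) p hp).1.congr_of_eventuallyEq ?_
    filter_upwards [(isOpen_Ioo.prod (hV q)).mem_nhds (⟨ht, hp⟩ : (t, p) ∈ Ioo (-δ) δ ×ˢ V q)]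
      with r hr
    exact isMIntegralCurveOn_Ioo_eqOn_of_contMDiff_boundaryless (t₀ := 0) ⟨by linarith, hδ⟩ hX1
      ((hγ r.2).isMIntegralCurveOn _) (hloc q hq r.2 hr.2) (by rw [hγ0, hψ0 q _ hr.2]) hr.1
  -- Writing φ_t = φ_{t/2} ∘ φ_{t/2} doubles the interval of smoothness.
  have hall : ∀ n : ℕ, ∀ t ∈ Ioo (-(2 ^ n * δ)) (2 ^ n * δ), ∀ p,
      ContMDiffAt (𝓘(ℝ, ℝ).prod (𝓡 m)) (𝓡 m) ∞ (fun q : ℝ × M => γ q.2 q.1) (t, p) := by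
    intro n
    induction n with
    | zero => simpa using hsmall
    | succ n ih =>
      intro t ht p
      have ht' : t / 2 ∈ Ioo (-(2 ^ n * δ)) (2 ^ n * δ) := by
        rw [pow_succ] at ht
        constructor <;> linarith [ht.1, ht.2]
      have e1 : (fun q : ℝ × M => γ q.2 q.1) = fun q => γ (γ q.2 (q.1 / 2)) (q.1 / 2) := by
        funext q
        rw [← hadd, add_halves]
      rw [e1]
      have h1 : ContMDiffAt (𝓘(ℝ, ℝ).prod (𝓡 m)) 𝓘(ℝ, ℝ) ∞ (fun q : ℝ × M => q.1 / 2) (t, p) := by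
        have : ContDiff ℝ ∞ (fun s : ℝ => s / 2) := by fun_prop
        exact this.contMDiff.contMDiffAt.comp (t, p) contMDiffAt_fst
      have h2 : ContMDiffAt (𝓘(ℝ, ℝ).prod (𝓡 m)) (𝓡 m) ∞ (fun q : ℝ × M => γ q.2 (q.1 / 2)) (t, p) :=
        ContMDiffAt.comp (g := fun q : ℝ × M => γ q.2 q.1) (f := fun q : ℝ × M => (q.1 / 2, q.2))
          (t, p) (ih _ ht' p) (h1.prodMk contMDiffAt_snd)
      exact ContMDiffAt.comp (g := fun q : ℝ × M => γ q.2 q.1)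
        (f := fun q : ℝ × M => (q.1 / 2, γ q.2 (q.1 / 2)))
          (t, p) (ih _ ht' _) (h1.prodMk h2)
  refine ⟨fun t p => γ p t, ?_, hγ0, hadd, hγ⟩
  rintro ⟨t, p⟩
  obtain ⟨n, hn⟩ := pow_unbounded_of_one_lt (|t| / δ) (one_lt_two (α := ℝ))
  rw [div_lt_iff₀ hδ] at hn
  exact hall n t (abs_lt.1 hn) p

end Flow

/-! ### Hypersurfaces -/

/-- With ℓ(v) = 1, each z splits as (z − ℓ(z) v) + ℓ(z) v, and ker ℓ has dimension n. This completes
the differential of the angle to linear coordinates. -/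
theorem ContinuousLinearMap.exists_equiv_snd_eq {m n : ℕ} (hmn : n + 1 = m)
    (ℓ : EuclideanSpace ℝ (Fin m) →L[ℝ] ℝ) (hℓ : ℓ ≠ 0) :
    ∃ L : EuclideanSpace ℝ (Fin m) ≃L[ℝ] EuclideanSpace ℝ (Fin n) × ℝ, ∀ z, (L z).2 = ℓ z := by
  obtain ⟨v, hv⟩ : ∃ v, ℓ v = 1 := by
    obtain ⟨u, hu⟩ := DFunLike.ne_iff.1 hℓ
    refine ⟨(ℓ u)⁻¹ • u, ?_⟩
    rw [map_smul, smul_eq_mul, inv_mul_cancel₀ hu]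
  have hker : Module.finrank ℝ (LinearMap.ker (ℓ : EuclideanSpace ℝ (Fin m) →ₗ[ℝ] ℝ)) =
      Module.finrank ℝ (EuclideanSpace ℝ (Fin n)) := by
    have := Module.Dual.finrank_ker_add_one_of_ne_zero
      (f := (ℓ : EuclideanSpace ℝ (Fin m) →ₗ[ℝ] ℝ)) (fun h => hℓ (by ext z; exact congrArg (fun f => f z) h))
    rw [finrank_euclideanSpace_fin] at this ⊢
    omega
  let κ := LinearEquiv.ofFinrankEq _ _ hker
  let Q : EuclideanSpace ℝ (Fin m) →ₗ[ℝ] LinearMap.ker (ℓ : EuclideanSpace ℝ (Fin m) →ₗ[ℝ] ℝ) :=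
    LinearMap.codRestrict _ (LinearMap.id - (ℓ : EuclideanSpace ℝ (Fin m) →ₗ[ℝ] ℝ).smulRight v)
      (fun z => by simp [hv])
  let L : EuclideanSpace ℝ (Fin m) ≃ₗ[ℝ] EuclideanSpace ℝ (Fin n) × ℝ :=
    { toLinearMap := (κ.toLinearMap ∘ₗ Q).prod (ℓ : EuclideanSpace ℝ (Fin m) →ₗ[ℝ] ℝ)
      invFun := fun p => (κ.symm p.1 : EuclideanSpace ℝ (Fin m)) + p.2 • v
      left_inv := fun z => by
        change (κ.symm (κ (Q z)) : EuclideanSpace ℝ (Fin m)) + ℓ z • v = z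
        rw [κ.symm_apply_apply]
        change z - ℓ z • v + ℓ z • v = z
        abel
      right_inv := fun p => by
        have h1 : ℓ (κ.symm p.1 : EuclideanSpace ℝ (Fin m)) = 0 := (κ.symm p.1).2
        have h2 : ℓ ((κ.symm p.1 : EuclideanSpace ℝ (Fin m)) + p.2 • v) = p.2 := by
          rw [map_add, map_smul, h1, hv, zero_add, smul_eq_mul, mul_one]
        refine Prod.ext ?_ h2
        change κ (Q _) = p.1
        rw [← κ.apply_symm_apply p.1]
        congr 1
        refine Subtype.ext ?_
        change (κ.symm p.1 : EuclideanSpace ℝ (Fin m)) + p.2 • v - ℓ _ • v = _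
        rw [h2]
        abel }
  exact ⟨L.toContinuousLinearEquiv, fun z => rfl⟩

section Slice

variable {m n : ℕ} {M : Type*} [TopologicalSpace M] [ChartedSpace (EuclideanSpace ℝ (Fin m)) M]

variable (m n) in
/-- A smooth chart of `M` around the point `x` of `S` that straightens `S` into `ℝⁿ × 0`. -/
structure SliceChart (S : Set M) (x : S) where
  /-- The chart. -/
  chart : OpenPartialHomeomorph M (EuclideanSpace ℝ (Fin n) × ℝ)
  mem_source : (x : M) ∈ chart.source
  contMDiffOn : ContMDiffOn (𝓡 m) 𝓘(ℝ, EuclideanSpace ℝ (Fin n) × ℝ) ∞ chart chart.source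
  contMDiffOn_symm : ContMDiffOn 𝓘(ℝ, EuclideanSpace ℝ (Fin n) × ℝ) (𝓡 m) ∞ chart.symm chart.target
  mem_iff : ∀ p ∈ chart.source, p ∈ S ↔ (chart p).2 = 0

/-! ### The manifold structure on a subset with slice charts -/

namespace SliceChart

variable {S : Set M} {x : S}

theorem symm_mem (σ : SliceChart m n S x) {w : EuclideanSpace ℝ (Fin n)}
    (hw : (w, (0 : ℝ)) ∈ σ.chart.target) : σ.chart.symm (w, 0) ∈ S := by
  rw [σ.mem_iff _ (σ.chart.map_target hw), σ.chart.right_inv hw]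

open Classical in
/-- The chart of `S` induced by a slice chart. -/
noncomputable def toChart (σ : SliceChart m n S x) :
    OpenPartialHomeomorph S (EuclideanSpace ℝ (Fin n)) where
  toFun p := (σ.chart p).1
  -- The inverse must be total with values in S; outside the target x is an arbitrary value.
  invFun w := if hw : (w, (0 : ℝ)) ∈ σ.chart.target then ⟨σ.chart.symm (w, 0), σ.symm_mem hw⟩ else x
  source := Subtype.val ⁻¹' σ.chart.source
  target := {w | (w, (0 : ℝ)) ∈ σ.chart.target}
  map_source' := fun p hp => by
    have h1 : σ.chart p = ((σ.chart p).1, 0) := Prod.ext rfl ((σ.mem_iff _ hp).1 p.2)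
    change ((σ.chart p).1, (0 : ℝ)) ∈ σ.chart.target
    rw [← h1]
    exact σ.chart.map_source hp
  map_target' := fun w hw => by
    have hw' : (w, (0 : ℝ)) ∈ σ.chart.target := hw
    rw [dif_pos hw']
    exact σ.chart.map_target hw
  left_inv' := fun p hp => by
    have h1 : σ.chart p = ((σ.chart p).1, 0) := Prod.ext rfl ((σ.mem_iff _ hp).1 p.2)
    have h2 : ((σ.chart p).1, (0 : ℝ)) ∈ σ.chart.target := by
      rw [← h1]; exact σ.chart.map_source hp
    rw [dif_pos h2]
    refine Subtype.ext ?_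
    change σ.chart.symm ((σ.chart p).1, 0) = p
    rw [← h1, σ.chart.left_inv hp]
  right_inv' := fun w hw => by
    have hw' : (w, (0 : ℝ)) ∈ σ.chart.target := hw
    rw [dif_pos hw']
    change (σ.chart (σ.chart.symm (w, 0))).1 = w
    rw [σ.chart.right_inv hw']
  open_source := σ.chart.open_source.preimage continuous_subtype_val
  open_target := σ.chart.open_target.preimage (by fun_prop)
  continuousOn_toFun := continuous_fst.comp_continuousOn
    (σ.chart.continuousOn.comp continuous_subtype_val.continuousOn fun p hp => hp)
  continuousOn_invFun := by
    rw [Topology.IsInducing.subtypeVal.continuousOn_iff]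
    have h1 : ContinuousOn (fun w : EuclideanSpace ℝ (Fin n) => σ.chart.symm (w, 0))
        {w | (w, (0 : ℝ)) ∈ σ.chart.target} :=
      σ.chart.continuousOn_symm.comp (by fun_prop) fun w hw => hw
    refine h1.congr fun w hw => ?_
    have hw' : (w, (0 : ℝ)) ∈ σ.chart.target := hw
    simp only [Function.comp_apply]
    rw [dif_pos hw']

theorem coe_toChart_symm (σ : SliceChart m n S x) {w : EuclideanSpace ℝ (Fin n)}
    (hw : w ∈ σ.toChart.target) : (σ.toChart.symm w : M) = σ.chart.symm (w, 0) := by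
  have hw' : (w, (0 : ℝ)) ∈ σ.chart.target := hw
  exact congrArg Subtype.val (dif_pos hw' : _ = (⟨σ.chart.symm (w, 0), σ.symm_mem hw'⟩ : S))

theorem chart_coe (σ : SliceChart m n S x) {p : S} (hp : p ∈ σ.toChart.source) :
    σ.chart p = (σ.toChart p, 0) := Prod.ext rfl ((σ.mem_iff _ hp).1 p.2)

/-- The atlas on `S` of the charts induced by a family of slice charts. -/
@[reducible]
noncomputable def chartedSpace (σ : ∀ x : S, SliceChart m n S x) :
    ChartedSpace (EuclideanSpace ℝ (Fin n)) S where
  atlas := range fun x => (σ x).toChart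
  chartAt x := (σ x).toChart
  mem_chart_source x := (σ x).mem_source
  chart_mem_atlas x := ⟨x, rfl⟩

/-- A transition map of S is a smooth transition map of M restricted to ℝⁿ × 0 and projected to ℝⁿ.
-/
theorem isManifold (σ : ∀ x : S, SliceChart m n S x) :
    letI := chartedSpace σ
    IsManifold (𝓡 n) ∞ S := by
  let _ := chartedSpace σ
  refine isManifold_of_contDiffOn _ _ _ ?_
  rintro _ _ ⟨x, rfl⟩ ⟨y, rfl⟩
  have h1 : ContDiffOn ℝ ∞ (fun w : EuclideanSpace ℝ (Fin n) =>
      ((σ y).chart ((σ x).chart.symm (w, 0))).1)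
      ((σ x).toChart.symm ≫ₕ (σ y).toChart).source := by
    intro w hw
    have hw1 : (w, (0 : ℝ)) ∈ (σ x).chart.target := hw.1
    have hw2 : (σ x).chart.symm (w, 0) ∈ (σ y).chart.source := by
      rw [← (σ x).coe_toChart_symm hw1]; exact hw.2
    have h2 := ((σ x).contMDiffOn_symm.contMDiffAt ((σ x).chart.open_target.mem_nhds hw1))
    have h3 := ((σ y).contMDiffOn.contMDiffAt ((σ y).chart.open_source.mem_nhds hw2))
    have h4 := contMDiffAt_iff_contDiffAt.1 (h3.comp _ h2)
    have h5 : ContDiffAt ℝ ∞ (fun w : EuclideanSpace ℝ (Fin n) => (w, (0 : ℝ))) w := by fun_prop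
    exact (contDiffAt_fst.comp w (h4.comp w h5)).contDiffWithinAt
  refine (h1.congr fun w hw => ?_).mono fun w hw => hw.1
  have hw1 : w ∈ (σ x).toChart.target := hw.1
  change ((σ y).chart ((σ x).toChart.symm w)).1 = _
  rw [(σ x).coe_toChart_symm hw1]

theorem toChart_mem_maximalAtlas (σ : ∀ x : S, SliceChart m n S x) (x : S) :
    letI := chartedSpace σ
    (σ x).toChart ∈ IsManifold.maximalAtlas (𝓡 n) ∞ S := by
  let _ := chartedSpace σ
  have := isManifold σ
  exact IsManifold.subset_maximalAtlas ⟨x, rfl⟩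

theorem contMDiff_val (σ : ∀ x : S, SliceChart m n S x) :
    letI := chartedSpace σ
    ContMDiff (𝓡 n) (𝓡 m) ∞ (Subtype.val : S → M) := by
  let _ := chartedSpace σ
  have := isManifold σ
  intro x
  have h0 : x ∈ (σ x).toChart.source := (σ x).mem_source
  have h1 : ContMDiffAt (𝓡 n) (𝓡 n) ∞ (σ x).toChart x :=
    contMDiffAt_of_mem_maximalAtlas (toChart_mem_maximalAtlas σ x) h0
  have h2 : ContMDiffAt (𝓡 n) 𝓘(ℝ, EuclideanSpace ℝ (Fin n) × ℝ) ∞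
      (fun p : S => ((σ x).toChart p, (0 : ℝ))) x := by
    have : ContDiff ℝ ∞ (fun w : EuclideanSpace ℝ (Fin n) => (w, (0 : ℝ))) := by fun_prop
    exact this.contMDiff.contMDiffAt.comp x h1
  have h3 := (σ x).contMDiffOn_symm.contMDiffAt
    ((σ x).chart.open_target.mem_nhds ((σ x).toChart.map_source h0))
  refine (ContMDiffAt.comp (g := (σ x).chart.symm) x h3 h2).congr_of_eventuallyEq ?_
  filter_upwards [(σ x).toChart.open_source.mem_nhds h0] with p hp
  change (p : M) = (σ x).chart.symm ((σ x).toChart p, 0)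
  rw [← (σ x).chart_coe hp, (σ x).chart.left_inv hp]

/-- In a slice chart the projection ℝⁿ × ℝ → ℝⁿ retracts onto S. Such retractions reduce smoothness
of maps into S to smoothness of maps into M. -/
theorem exists_retraction (σ : ∀ x : S, SliceChart m n S x) (x : S) :
    letI := chartedSpace σ
    ∃ r : M → S, ContMDiffAt (𝓡 m) (𝓡 n) ∞ r x ∧ ∀ᶠ p : S in nhds x, r p = p := by
  let _ := chartedSpace σ
  have := isManifold σ
  have h0 : x ∈ (σ x).toChart.source := (σ x).mem_source
  refine ⟨fun p => (σ x).toChart.symm ((σ x).chart p).1, ?_, ?_⟩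
  · have h1 : ContMDiffAt (𝓡 m) (𝓡 n) ∞ (fun p => ((σ x).chart p).1) (x : M) :=
      contDiff_fst.contMDiff.contMDiffAt.comp (x : M)
        ((σ x).contMDiffOn.contMDiffAt ((σ x).chart.open_source.mem_nhds h0))
    exact ContMDiffAt.comp (g := (σ x).toChart.symm) (x : M) (contMDiffAt_symm_of_mem_maximalAtlas
      (toChart_mem_maximalAtlas σ x) ((σ x).toChart.map_source h0)) h1
  · filter_upwards [(σ x).toChart.open_source.mem_nhds h0] with p hp
    exact (σ x).toChart.left_inv hp

end SliceChart

variable [IsManifold (𝓡 m) ∞ M]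

/-- The branch θ of the angle near 0 has nonzero differential, so n linear functions P complete it
to a map (P, θ) with invertible derivative. The inverse function theorem makes this a chart, in
which the fibre is θ = 0. -/
theorem exists_sliceChart (hmn : n + 1 = m) {π : M → Circle} (hπ : ContMDiff (𝓡 m) (𝓡 1) ∞ π)
    (hsurj : ∀ p : M, Function.Surjective (mfderiv (𝓡 m) (𝓡 1) π p)) (x : {p : M | π p = 1}) :
    Nonempty (SliceChart m n {p : M | π p = 1} x) := by
  set e := chartAt (EuclideanSpace ℝ (Fin m)) (x : M)
  have he : e ∈ IsManifold.maximalAtlas (𝓡 m) ∞ M := IsManifold.chart_mem_maximalAtlas _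
  have hx : (x : M) ∈ e.source := mem_chart_source _ _
  have hπx : π x = Circle.exp 0 := by rw [Circle.exp_zero]; exact x.2
  let θ : EuclideanSpace ℝ (Fin m) → ℝ := fun z => angleNear 0 (π (e.symm z))
  let U : Set (EuclideanSpace ℝ (Fin m)) := e.target ∩ e.symm ⁻¹' (π ⁻¹' angleDomain 0)
  have hU : IsOpen U :=
    e.symm.isOpen_inter_preimage ((isOpen_angleDomain 0).preimage hπ.continuous)
  have hxU : e x ∈ U := ⟨e.map_source hx, by
    rw [mem_preimage, e.left_inv hx, mem_preimage, hπx]; exact self_exp_mem_angleDomain 0⟩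
  have hθ : ContDiffOn ℝ ∞ θ U := fun z hz => (contMDiffAt_iff_contDiffAt.1
    (ContMDiffAt.comp (f := fun z => π (e.symm z)) z (contMDiffAt_angleNear hz.2)
        ((hπ (e.symm z)).comp z (contMDiffAt_symm_of_mem_maximalAtlas he hz.1)))).contDiffWithinAt
  have hθd : DifferentiableAt ℝ θ (e x) :=
    (hθ.contDiffAt (hU.mem_nhds hxU)).differentiableAt (by simp)
  -- Since π = e^{iθ} in the chart, dθ = 0 would give dπ = 0, against surjectivity.
  have hℓ : fderiv ℝ θ (e x) ≠ 0 := by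
    intro h0
    have h1 : HasMFDerivAt (𝓡 m) (𝓡 1) (fun z => π (e.symm z)) (e x)
        ((mfderiv 𝓘(ℝ, ℝ) (𝓡 1) Circle.exp (θ (e x))).comp (fderiv ℝ θ (e x))) := by
      have h2 := HasMFDerivAt.comp (e x)
        ((contMDiff_circleExp (m := ∞)).mdifferentiable (by simp) (θ (e x))).hasMFDerivAt
        hθd.hasFDerivAt.hasMFDerivAt
      have h3 : (fun z => π (e.symm z)) = fun z => Circle.exp (θ z) :=
        funext fun z => (exp_angleNear 0 _).symm
      rw [h3]
      exact h2
    have hd := mdifferentiable_of_mem_maximalAtlas he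
    have h2 : HasMFDerivAt (𝓡 m) (𝓡 1) (fun z => π (e.symm z)) (e x)
        ((mfderiv (𝓡 m) (𝓡 1) π (e.symm (e x))).comp (mfderiv (𝓡 m) (𝓡 m) e.symm (e x))) :=
      HasMFDerivAt.comp (e x) (hπ.mdifferentiable (by simp) (e.symm (e x))).hasMFDerivAt
        (hd.mdifferentiableAt_symm (e.map_source hx)).hasMFDerivAt
    have h3 := hasMFDerivAt_unique h1 h2
    obtain ⟨v, hv⟩ := hsurj (e.symm (e x)) (EuclideanSpace.single 0 (1 : ℝ) : EuclideanSpace ℝ (Fin 1))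
    obtain ⟨w, hw⟩ : ∃ w, mfderiv (𝓡 m) (𝓡 m) e.symm (e x) w = v := by
      have h4 := hd.symm_comp_deriv (e.map_target (e.map_source hx))
      rw [e.right_inv (e.map_source hx)] at h4
      exact ⟨_, congrArg (fun L : TangentSpace (𝓡 m) (e.symm (e x)) →L[ℝ]
        TangentSpace (𝓡 m) (e.symm (e x)) => L v) h4⟩
    have h4 := congrArg (fun L : EuclideanSpace ℝ (Fin m) →L[ℝ] EuclideanSpace ℝ (Fin 1) => L w) h3
    have h5 : (0 : EuclideanSpace ℝ (Fin 1)) = EuclideanSpace.single 0 (1 : ℝ) := by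
      refine Eq.trans ?_ (h4.trans ((congrArg (mfderiv (𝓡 m) (𝓡 1) π (e.symm (e x))) hw).trans hv))
      refine Eq.trans ?_ (congrArg (mfderiv 𝓘(ℝ, ℝ) (𝓡 1) Circle.exp (θ (e x)))
        (congrArg (fun L : EuclideanSpace ℝ (Fin m) →L[ℝ] ℝ => L w) h0)).symm
      exact (map_zero (mfderiv 𝓘(ℝ, ℝ) (𝓡 1) Circle.exp (θ (e x)))).symm
    have h6 := congrArg (fun v : EuclideanSpace ℝ (Fin 1) => v 0) h5
    simp at h6
  obtain ⟨L, hL⟩ := ContinuousLinearMap.exists_equiv_snd_eq hmn _ hℓ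
  let P : EuclideanSpace ℝ (Fin m) →L[ℝ] EuclideanSpace ℝ (Fin n) :=
    (ContinuousLinearMap.fst ℝ _ _).comp (L : EuclideanSpace ℝ (Fin m) →L[ℝ] EuclideanSpace ℝ (Fin n) × ℝ)
  have hF : ContDiffOn ℝ ∞ (fun z => (P z, θ z)) U := P.contDiff.contDiffOn.prodMk hθ
  have hF' : HasFDerivAt (fun z => (P z, θ z))
      (L : EuclideanSpace ℝ (Fin m) →L[ℝ] EuclideanSpace ℝ (Fin n) × ℝ) (e x) := by
    have h1 := P.hasFDerivAt.prodMk hθd.hasFDerivAt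
    have h2 : P.prod (fderiv ℝ θ (e x)) =
        (L : EuclideanSpace ℝ (Fin m) →L[ℝ] EuclideanSpace ℝ (Fin n) × ℝ) :=
      ContinuousLinearMap.ext fun z => Prod.ext rfl (hL z).symm
    rw [← h2]
    exact h1
  obtain ⟨H, hxH, hHU, hH, hHs⟩ := hF.exists_openPartialHomeomorph hU hxU L hF'
  refine ⟨⟨e.trans H, ⟨hx, hxH⟩, ?_, ?_, ?_⟩⟩
  · intro p hp
    have h1 : ContDiffAt ℝ ∞ H (e p) :=
      (hF.contDiffAt (hU.mem_nhds (hHU hp.2))).congr_of_eventuallyEq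
        (Filter.Eventually.of_forall hH)
    exact (h1.contMDiffAt.comp p (contMDiffAt_of_mem_maximalAtlas he hp.1)).contMDiffWithinAt
  · intro w hw
    have h1 : ContDiffAt ℝ ∞ H.symm w := hHs.contDiffAt (H.open_target.mem_nhds hw.1)
    have h2 : H.symm w ∈ e.target := hw.2
    exact (ContMDiffAt.comp (g := e.symm) w (contMDiffAt_symm_of_mem_maximalAtlas he h2)
      h1.contMDiffAt).contMDiffWithinAt
  · intro p hp
    have h1 : ((e.trans H) p).2 = angleNear 0 (π p) := by
      change (H (e p)).2 = _
      rw [hH]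
      change angleNear 0 (π (e.symm (e p))) = _
      rw [e.left_inv hp.1]
    rw [h1]
    constructor
    · intro h
      have h' : π p = Circle.exp 0 := by rw [Circle.exp_zero]; exact h
      rw [h', angleNear_exp (by simp [Real.pi_pos])]
    · intro h
      have := exp_angleNear 0 (π p)
      rw [h, Circle.exp_zero] at this
      exact this.symm

end Slice

/-! ### Induced metrics -/

section Pullback

variable {m n : ℕ} {M : Type*} [TopologicalSpace M] [ChartedSpace (EuclideanSpace ℝ (Fin m)) M]
  [IsManifold (𝓡 m) ∞ M]
  {N : Type*} [TopologicalSpace N] [ChartedSpace (EuclideanSpace ℝ (Fin n)) N]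
  [IsManifold (𝓡 n) ∞ N]

/-- The bilinear form `(v, w) ↦ B (A v, A w)`. -/
noncomputable def ContinuousLinearMap.pullbackForm {E F : Type*} [NormedAddCommGroup E]
    [NormedSpace ℝ E] [NormedAddCommGroup F] [NormedSpace ℝ F] (B : F →L[ℝ] F →L[ℝ] ℝ)
    (A : E →L[ℝ] F) : E →L[ℝ] E →L[ℝ] ℝ := B.bilinearComp A A

/-- The bilinear form induced on `T_x N` by a map `j : N → M`. -/
noncomputable def SmoothMetric.pullbackInner (g : SmoothMetric m M) (j : N → M) (x : N) :
    TangentSpace (𝓡 n) x →L[ℝ] TangentSpace (𝓡 n) x →L[ℝ] ℝ :=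
  ContinuousLinearMap.pullbackForm (E := EuclideanSpace ℝ (Fin n)) (F := EuclideanSpace ℝ (Fin m))
    (g.inner (j x)) (mfderiv (𝓡 n) (𝓡 m) j x)

theorem EuclideanSpace.bilinear_eq_sum (A : EuclideanSpace ℝ (Fin n) →L[ℝ]
    EuclideanSpace ℝ (Fin n) →L[ℝ] ℝ) :
    A = ∑ i, ∑ k, A (EuclideanSpace.single i 1) (EuclideanSpace.single k 1) •
      ((EuclideanSpace.proj i : EuclideanSpace ℝ (Fin n) →L[ℝ] ℝ).smulRight
        (EuclideanSpace.proj k : EuclideanSpace ℝ (Fin n) →L[ℝ] ℝ)) := by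
  ext v w
  rw [EuclideanSpace.clm_apply_eq_sum A]
  simp only [sum_apply, smul_apply]
  refine Finset.sum_congr rfl fun i _ => ?_
  rw [EuclideanSpace.clm_apply_eq_sum (A (EuclideanSpace.single i 1)), Finset.smul_sum]
  refine Finset.sum_congr rfl fun k _ => ?_
  simp
  ring

/-- A field of bilinear forms is smooth once its values on a local frame are. The frame comes from a
trivialization, and its values are inner products of smooth vector fields along j. -/
theorem SmoothMetric.contMDiff_pullbackInner (g : SmoothMetric m M) {j : N → M}
    (hj : ContMDiff (𝓡 n) (𝓡 m) ∞ j) :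
    ContMDiff (𝓡 n) ((𝓡 n).prod 𝓘(ℝ, EuclideanSpace ℝ (Fin n) →L[ℝ]
      EuclideanSpace ℝ (Fin n) →L[ℝ] ℝ)) ∞
      (fun x => Bundle.TotalSpace.mk' (EuclideanSpace ℝ (Fin n) →L[ℝ]
        EuclideanSpace ℝ (Fin n) →L[ℝ] ℝ)
        (E := fun x : N => TangentSpace (𝓡 n) x →L[ℝ] TangentSpace (𝓡 n) x →L[ℝ] ℝ)
        x (g.pullbackInner j x)) := by
  intro z
  refine (Bundle.contMDiffAt_section z).2 ?_
  set τ := trivializationAt (EuclideanSpace ℝ (Fin n)) (fun x : N => TangentSpace (𝓡 n) x) z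
  have hz : z ∈ τ.baseSet := mem_baseSet_trivializationAt _ _ z
  let s : EuclideanSpace ℝ (Fin n) → ∀ x : N, TangentSpace (𝓡 n) x := fun v x => τ.symm x v
  have hs : ∀ v, ContMDiffAt (𝓡 n) (𝓡 n).tangent ∞
      (fun x => (⟨x, s v x⟩ : TangentBundle (𝓡 n) N)) z := by
    intro v
    have h : ContMDiffOn (𝓡 n) (𝓡 n).tangent ∞
      (fun x => (⟨x, s v x⟩ : TangentBundle (𝓡 n) N)) τ.baseSet := by
      rw [τ.contMDiffOn_section_baseSet_iff]
      apply (contMDiffOn_const (c := v)).congr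
      intro y hy
      simp [s, τ.apply_mk_symm hy]
    exact h.contMDiffAt (τ.open_baseSet.mem_nhds hz)
  have hv : ∀ v w, ContMDiffAt (𝓡 n) 𝓘(ℝ, ℝ) ∞
      (fun x => g.pullbackInner j x (s v x) (s w x)) z := fun v w =>
    g.contMDiffAt_inner (ContMDiffAt.mfderiv_lift (f := j) (b := id) (hj z) (hs v))
      (ContMDiffAt.mfderiv_lift (f := j) (b := id) (hj z) (hs w))
  have hsum : ContMDiffAt (𝓡 n) 𝓘(ℝ, EuclideanSpace ℝ (Fin n) →L[ℝ]
      EuclideanSpace ℝ (Fin n) →L[ℝ] ℝ) ∞ (fun x => ∑ i, ∑ k,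
      g.pullbackInner j x (s (EuclideanSpace.single i 1) x) (s (EuclideanSpace.single k 1) x) •
      ((EuclideanSpace.proj i : EuclideanSpace ℝ (Fin n) →L[ℝ] ℝ).smulRight
        (EuclideanSpace.proj k : EuclideanSpace ℝ (Fin n) →L[ℝ] ℝ))) z := by
    refine ContMDiffAt.sum fun i _ => ContMDiffAt.sum fun k _ => ?_
    exact (hv _ _).smul contMDiffAt_const
  refine hsum.congr_of_eventuallyEq ?_
  filter_upwards [τ.open_baseSet.mem_nhds hz] with x hx
  refine (EuclideanSpace.bilinear_eq_sum _).trans ?_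
  refine Finset.sum_congr rfl fun i _ => Finset.sum_congr rfl fun k _ => ?_
  congr 1
  refine (inCoordinates_apply_eq₂ hx hx (Set.mem_univ _)).trans ?_
  have hl : ∀ r : ℝ, (trivializationAt ℝ (Bundle.Trivial N ℝ) z).linearMapAt ℝ x r = r := by
    simp
  exact hl _

/-- The metric induced by an immersion. -/
noncomputable def SmoothMetric.pullback (g : SmoothMetric m M) (j : N → M)
    (hj : ContMDiff (𝓡 n) (𝓡 m) ∞ j)
    (hinj : ∀ x, Function.Injective (mfderiv (𝓡 n) (𝓡 m) j x)) : SmoothMetric n N where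
  inner := g.pullbackInner j
  symm x v w := g.symm (j x) _ _
  pos x v hv := g.pos (j x) _ fun h => hv (hinj x (h.trans (map_zero _).symm))
  isVonNBounded x := by
    let A : EuclideanSpace ℝ (Fin n) →L[ℝ] EuclideanSpace ℝ (Fin m) := mfderiv (𝓡 n) (𝓡 m) j x
    have hA : LinearMap.ker (A : EuclideanSpace ℝ (Fin n) →ₗ[ℝ] EuclideanSpace ℝ (Fin m)) = ⊥ :=
      LinearMap.ker_eq_bot.2 (hinj x)
    -- An injective linear map in finite dimension is bounded below, so the unit ball of the induced
    -- form is bounded because that of g is.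
    obtain ⟨K, -, hK⟩ := LinearMap.exists_antilipschitzWith
      (A : EuclideanSpace ℝ (Fin n) →ₗ[ℝ] EuclideanSpace ℝ (Fin m)) hA
    have hb : Bornology.IsVonNBounded ℝ
      {v : EuclideanSpace ℝ (Fin m) | g.inner (j x) v v < 1} := g.isVonNBounded (j x)
    change Bornology.IsVonNBounded ℝ {v : EuclideanSpace ℝ (Fin n) | g.inner (j x) (A v) (A v) < 1}
    rw [NormedSpace.isVonNBounded_iff, isBounded_iff_forall_norm_le] at hb ⊢
    obtain ⟨R, hR⟩ := hb
    refine ⟨K * R, fun v hv => ?_⟩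
    have h1 : ‖v‖ ≤ K * ‖A v‖ := hK.le_mul_norm (f := A) (map_zero A) v
    exact h1.trans (mul_le_mul_of_nonneg_left (hR (A v) hv) K.2)
  contMDiff := g.contMDiff_pullbackInner hj

end Pullback

/-! ### The angle form and its dual vector field -/

section AngleForm

variable {m : ℕ} {M : Type*} [TopologicalSpace M] [ChartedSpace (EuclideanSpace ℝ (Fin m)) M]

/-- The differential of a branch of the angle of `π : M → S¹`. -/
noncomputable def angleDeriv (π : M → Circle) (t : ℝ) (p : M) : TangentSpace (𝓡 m) p →L[ℝ] ℝ :=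
  mfderiv (𝓡 m) 𝓘(ℝ, ℝ) (fun q => angleNear t (π q)) p

/-- The pullback of the form `dt` on the circle by `π : M → S¹`. -/
noncomputable def angleForm (π : M → Circle) (p : M) : TangentSpace (𝓡 m) p →L[ℝ] ℝ :=
  angleDeriv π (Complex.arg (π p)) p

variable {π : M → Circle}

theorem contMDiffAt_angleNear_comp (hπ : ContMDiff (𝓡 m) (𝓡 1) ∞ π) {t : ℝ} {p : M}
    (h : π p ∈ angleDomain t) : ContMDiffAt (𝓡 m) 𝓘(ℝ, ℝ) ∞ (fun q => angleNear t (π q)) p :=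
  (contMDiffAt_angleNear h).comp p (hπ p)

theorem circleInclusionDeriv_mfderiv_exp (t a : ℝ) : circleInclusionDeriv (Circle.exp t)
    (mfderiv 𝓘(ℝ, ℝ) (𝓡 1) Circle.exp t a) = a • (Circle.exp t * Complex.I : ℂ) := by
  have h1 : HasMFDerivAt 𝓘(ℝ, ℝ) 𝓘(ℝ, ℂ) (fun s : ℝ => (Circle.exp s : ℂ)) t
      ((circleInclusionDeriv (Circle.exp t)).comp (mfderiv 𝓘(ℝ, ℝ) (𝓡 1) Circle.exp t)) :=
    HasMFDerivAt.comp t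
      ((contMDiff_circle_coe.mdifferentiable (by simp) (Circle.exp t)).hasMFDerivAt)
      ((contMDiff_circleExp (m := ∞)).mdifferentiable (by simp) t).hasMFDerivAt
  have h2 : HasDerivAt (fun s : ℝ => (Circle.exp s : ℂ)) (Circle.exp t * Complex.I) t := by
    simp only [Circle.coe_exp]
    have := ((Complex.ofRealCLM.hasDerivAt (x := t)).mul_const Complex.I).cexp
    simpa using this
  let L : ℝ →L[ℝ] ℂ :=
    (circleInclusionDeriv (Circle.exp t)).comp (mfderiv 𝓘(ℝ, ℝ) (𝓡 1) Circle.exp t)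
  have h1' : HasFDerivAt (fun s : ℝ => (Circle.exp s : ℂ)) L t :=
    hasMFDerivAt_iff_hasFDerivAt.1 h1
  have h4 := h1'.unique h2.hasFDerivAt
  exact congrArg (fun L : ℝ →L[ℝ] ℂ => L a) h4

/-- This is the chain rule for π = e^{iθ}, namely dπ = iπ dθ in ℂ. -/
theorem circleInclusionDeriv_mfderiv (hπ : ContMDiff (𝓡 m) (𝓡 1) ∞ π) {t : ℝ} {p : M}
    (h : π p ∈ angleDomain t) (w : TangentSpace (𝓡 m) p) :
    circleInclusionDeriv (π p) (mfderiv (𝓡 m) (𝓡 1) π p w) =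
      angleDeriv π t p w • (π p * Complex.I : ℂ) := by
  have h1 : HasMFDerivAt (𝓡 m) (𝓡 1) π p
      ((mfderiv 𝓘(ℝ, ℝ) (𝓡 1) Circle.exp (angleNear t (π p))).comp
        (mfderiv (𝓡 m) 𝓘(ℝ, ℝ) (fun q => angleNear t (π q)) p)) := by
    have h2 := HasMFDerivAt.comp p
      ((contMDiff_circleExp (m := ∞)).mdifferentiable (by simp) (angleNear t (π p))).hasMFDerivAt
      ((contMDiffAt_angleNear_comp hπ h).mdifferentiableAt (by simp)).hasMFDerivAt
    have h3 : Circle.exp ∘ (fun q => angleNear t (π q)) = π :=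
      funext fun q => exp_angleNear t (π q)
    rw [h3] at h2
    exact h2
  have h4 := circleInclusionDeriv_mfderiv_exp (angleNear t (π p))
    (angleDeriv π t p w)
  rw [exp_angleNear] at h4
  rw [h1.mfderiv]
  exact h4

theorem mem_angleDomain_arg (q : Circle) : q ∈ angleDomain (Complex.arg q) := by
  have := self_exp_mem_angleDomain (Complex.arg q)
  rwa [Circle.exp_arg] at this

/-- Every branch has the same differential, because dπ = iπ dθ determines dθ. Hence the form is
globally defined although the angle is not. -/
theorem angleForm_eq (hπ : ContMDiff (𝓡 m) (𝓡 1) ∞ π) {t : ℝ} {p : M} (h : π p ∈ angleDomain t) :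
    angleForm (m := m) π p = angleDeriv π t p := by
  refine ContinuousLinearMap.ext fun w => ?_
  have h1 := (circleInclusionDeriv_mfderiv hπ (mem_angleDomain_arg (π p)) w).symm.trans
    (circleInclusionDeriv_mfderiv hπ h w)
  have h2 : (π p * Complex.I : ℂ) ≠ 0 := mul_ne_zero (Circle.coe_ne_zero _) Complex.I_ne_zero
  exact smul_left_injective ℝ h2 h1

theorem circleInclusionDeriv_mfderiv_eq (hπ : ContMDiff (𝓡 m) (𝓡 1) ∞ π) (p : M)
    (w : TangentSpace (𝓡 m) p) :
    circleInclusionDeriv (π p) (mfderiv (𝓡 m) (𝓡 1) π p w) =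
      angleForm π p w • (π p * Complex.I : ℂ) :=
  circleInclusionDeriv_mfderiv hπ (mem_angleDomain_arg (π p)) w

theorem mfderiv_eq_zero_iff_angleForm (hπ : ContMDiff (𝓡 m) (𝓡 1) ∞ π) (p : M)
    (w : TangentSpace (𝓡 m) p) : mfderiv (𝓡 m) (𝓡 1) π p w = 0 ↔ angleForm π p w = 0 := by
  have h2 : (π p * Complex.I : ℂ) ≠ 0 := mul_ne_zero (Circle.coe_ne_zero _) Complex.I_ne_zero
  have h1 := circleInclusionDeriv_mfderiv_eq hπ p w
  constructor
  · intro h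
    rw [h, map_zero] at h1
    exact (smul_eq_zero.1 h1.symm).resolve_right h2
  · intro h
    rw [h, zero_smul] at h1
    exact injective_circleInclusionDeriv _ (h1.trans (map_zero _).symm)

theorem circleMetric_mfderiv (hπ : ContMDiff (𝓡 m) (𝓡 1) ∞ π) {c : ℝ} (hc : 0 < c) (p : M)
    (v w : TangentSpace (𝓡 m) p) :
    (circleMetric c hc).inner (π p) (mfderiv (𝓡 m) (𝓡 1) π p v) (mfderiv (𝓡 m) (𝓡 1) π p w) =
      c * (angleForm π p v * angleForm π p w) := by
  change c * inner ℝ (circleInclusionDeriv (π p) _) (circleInclusionDeriv (π p) _) = _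
  rw [circleInclusionDeriv_mfderiv_eq hπ, circleInclusionDeriv_mfderiv_eq hπ,
    real_inner_smul_left, real_inner_smul_right, real_inner_self_eq_norm_sq, norm_mul,
    Circle.norm_coe, Complex.norm_I]
  ring

/-- The differential of `π` along a map on which `π` is the exponential of a function. -/
theorem angleForm_mfderiv {EP : Type*} [NormedAddCommGroup EP] [NormedSpace ℝ EP] {HP : Type*}
    [TopologicalSpace HP] {IP : ModelWithCorners ℝ EP HP} {P : Type*} [TopologicalSpace P]
    [ChartedSpace HP P] (hπ : ContMDiff (𝓡 m) (𝓡 1) ∞ π) {Φ : P → M} {f : P → ℝ}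
    {q : P} (hΦ : MDifferentiableAt IP (𝓡 m) Φ q) (hf : MDifferentiableAt IP 𝓘(ℝ, ℝ) f q)
    (h : ∀ p, π (Φ p) = Circle.exp (f p)) (v : TangentSpace IP q) :
    angleForm π (Φ q) (mfderiv IP (𝓡 m) Φ q v) = mfderiv IP 𝓘(ℝ, ℝ) f q v := by
  have hd : π (Φ q) ∈ angleDomain (f q) := by rw [h]; exact self_exp_mem_angleDomain _
  rw [angleForm_eq hπ hd]
  have h1 := HasMFDerivAt.comp q
    ((contMDiffAt_angleNear_comp hπ hd).mdifferentiableAt (by simp)).hasMFDerivAt hΦ.hasMFDerivAt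
  have h2 : (fun p => angleNear (f q) (π p)) ∘ Φ =ᶠ[nhds q] f := by
    have : ∀ᶠ p in nhds q, |f p - f q| < Real.pi := by
      have hc : ContinuousAt (fun p => |f p - f q|) q :=
        (hf.continuousAt.sub continuousAt_const).abs
      exact hc.preimage_mem_nhds (Iio_mem_nhds (by simp [Real.pi_pos]))
    filter_upwards [this] with p hp
    change angleNear (f q) (π (Φ p)) = f p
    rw [h, angleNear_exp hp]
  have h3 := hasMFDerivAt_unique (h1.congr_of_eventuallyEq h2.symm) hf.hasMFDerivAt
  exact congrArg (fun L : TangentSpace IP q →L[ℝ] ℝ => L v) h3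

variable [IsManifold (𝓡 m) ∞ M] (g : SmoothMetric m M)

theorem SmoothMetric.eq_of_inner_eq {p : M} {v w : TangentSpace (𝓡 m) p}
    (h : ∀ u, g.inner p v u = g.inner p w u) : v = w := by
  by_contra hne
  have h1 := g.pos p (v - w) (sub_ne_zero.2 hne)
  rw [g.symm p, map_sub, g.symm p _ v, g.symm p _ w, h, sub_self] at h1
  exact lt_irrefl _ h1

/-- In a chart the duality is the linear system G V = c dθ, whose solution is smooth because G⁻¹ is.
-/
theorem exists_dual_chart (c : ℝ) (hπ : ContMDiff (𝓡 m) (𝓡 1) ∞ π) (p₀ : M) :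
    ∃ Y : ∀ p : M, TangentSpace (𝓡 m) p,
      ContMDiffAt (𝓡 m) (𝓡 m).tangent ∞ (fun p => (⟨p, Y p⟩ : TangentBundle (𝓡 m) M)) p₀ ∧
      ∀ᶠ p in nhds p₀, ∀ w, g.inner p (Y p) w = c * angleForm π p w := by
  set e := chartAt (EuclideanSpace ℝ (Fin m)) p₀
  have he : e ∈ IsManifold.maximalAtlas (𝓡 m) ∞ M := IsManifold.chart_mem_maximalAtlas _
  have hd := mdifferentiable_of_mem_maximalAtlas he
  have hp₀ : p₀ ∈ e.source := mem_chart_source _ _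
  set t := Complex.arg (π p₀)
  let θ : EuclideanSpace ℝ (Fin m) → ℝ := fun z => angleNear t (π (e.symm z))
  have hθ : ∀ {z}, z ∈ e.target → π (e.symm z) ∈ angleDomain t → ContDiffAt ℝ ∞ θ z :=
    fun {z} hz hd => contMDiffAt_iff_contDiffAt.1
      (ContMDiffAt.comp (g := fun q => angleNear t (π q)) z (contMDiffAt_angleNear_comp hπ hd)
        (contMDiffAt_symm_of_mem_maximalAtlas he hz))
  let V : EuclideanSpace ℝ (Fin m) → EuclideanSpace ℝ (Fin m) := fun z =>
    WithLp.toLp 2 ((metricMatrix g e z)⁻¹.mulVec (c • fun i => partialDeriv i θ z))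
  have hV : ∀ {z}, z ∈ e.target → (metricMatrix g e z).mulVec (V z).ofLp =
      c • fun i => partialDeriv i θ z := fun {z} hz => by
    change (metricMatrix g e z).mulVec ((metricMatrix g e z)⁻¹.mulVec _) = _
    rw [Matrix.mulVec_mulVec, Matrix.mul_nonsing_inv _ (metricMatrix_det_pos g he hz).ne'.isUnit,
      Matrix.one_mulVec]
  have hz₀ : e p₀ ∈ e.target := e.map_source hp₀
  have hVs : ContDiffAt ℝ ∞ V (e p₀) := by
    rw [contDiffAt_euclidean]
    intro j
    change ContDiffAt ℝ ∞ (fun z => ∑ i, (metricMatrix g e z)⁻¹ j i *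
      (c * partialDeriv i θ z)) (e p₀)
    refine ContDiffAt.sum fun i _ => ?_
    refine (contDiffAt_metricMatrix_inv g he hz₀ j i).mul (contDiffAt_const.mul ?_)
    exact ((hθ hz₀ (by rw [e.left_inv hp₀]; exact mem_angleDomain_arg _)).fderiv_right (m := ∞)
      (by simp)).clm_apply contDiffAt_const
  have hYs := ContMDiffAt.mfderiv_lift (f := e.symm) (b := e) (v := fun p => V (e p)) (p := p₀)
    (contMDiffAt_symm_of_mem_maximalAtlas he hz₀)
    (contMDiffAt_lift_vectorSpace (contMDiffAt_of_mem_maximalAtlas he hp₀)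
      (hVs.contMDiffAt.comp p₀ (contMDiffAt_of_mem_maximalAtlas he hp₀)))
  let Y : M → EuclideanSpace ℝ (Fin m) := fun p => mfderiv (𝓡 m) (𝓡 m) e.symm (e p) (V (e p))
  refine ⟨Y, ?_, ?_⟩
  · refine hYs.congr_of_eventuallyEq ?_
    filter_upwards [e.open_source.mem_nhds hp₀] with p hp
    have key : ∀ q : M, q = p → ∀ v : EuclideanSpace ℝ (Fin m),
        (⟨p, v⟩ : TangentBundle (𝓡 m) M) = ⟨q, v⟩ := by
      rintro _ rfl v; rfl
    exact key _ (e.left_inv hp) (Y p)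
  · have hdom : ∀ᶠ p in nhds p₀, π p ∈ angleDomain t :=
      hπ.continuous.continuousAt.preimage_mem_nhds
        ((isOpen_angleDomain t).mem_nhds (mem_angleDomain_arg _))
    filter_upwards [e.open_source.mem_nhds hp₀, hdom] with p hp hpd
    have hz : e p ∈ e.target := e.map_source hp
    have hθd : DifferentiableAt ℝ θ (e p) :=
      (hθ hz (by rw [e.left_inv hp]; exact hpd)).differentiableAt (by simp)
    have key : ∀ w : TangentSpace (𝓡 m) (e.symm (e p)),
        g.inner (e.symm (e p)) (mfderiv (𝓡 m) (𝓡 m) e.symm (e p) (V (e p))) w =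
          c * angleForm π (e.symm (e p)) w := by
      intro w
      obtain ⟨u, rfl⟩ : ∃ u, mfderiv (𝓡 m) (𝓡 m) e.symm (e p) u = w := by
        have h4 := hd.symm_comp_deriv (e.map_target hz)
        rw [e.right_inv hz] at h4
        exact ⟨_, congrArg (fun L : TangentSpace (𝓡 m) (e.symm (e p)) →L[ℝ]
          TangentSpace (𝓡 m) (e.symm (e p)) => L w) h4⟩
      let u' : EuclideanSpace ℝ (Fin m) := u
      have h1 := angleForm_mfderiv hπ (hd.mdifferentiableAt_symm hz) hθd.mdifferentiableAt
        (fun z => (exp_angleNear t (π (e.symm z))).symm) u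
      rw [h1, g.symm]
      refine (metricMatrix_dotProduct g (e p) u'.ofLp (V (e p)).ofLp).symm.trans ?_
      rw [hV hz, mfderiv_eq_fderiv]
      refine Eq.trans ?_ (congrArg (c * ·)
        (EuclideanSpace.clm_apply_eq_sum (fderiv ℝ θ (e p)) (v := u')).symm)
      simp only [dotProduct, Pi.smul_apply, smul_eq_mul, Finset.mul_sum, partialDeriv]
      exact Finset.sum_congr rfl fun i _ => by ring
    -- The identity is known at e⁻¹(e(p)); generalizing the base point moves it to p.
    have key' : ∀ q : M, q = p → ∀ A : EuclideanSpace ℝ (Fin m),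
        (∀ w : TangentSpace (𝓡 m) q, g.inner q A w = c * angleForm π q w) →
        ∀ w : TangentSpace (𝓡 m) p, g.inner p A w = c * angleForm π p w := by
      rintro _ rfl A h
      exact h
    exact key' _ (e.left_inv hp) (Y p) key

/-- The vector field that is dual to `c` times the angle form. -/
theorem exists_dual_vectorField (c : ℝ) (hπ : ContMDiff (𝓡 m) (𝓡 1) ∞ π) :
    ∃ X : ∀ p : M, TangentSpace (𝓡 m) p,
      ContMDiff (𝓡 m) (𝓡 m).tangent ∞ (fun p => (⟨p, X p⟩ : TangentBundle (𝓡 m) M)) ∧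
      ∀ p w, g.inner p (X p) w = c * angleForm π p w := by
  choose Y hYs hY using exists_dual_chart g c hπ
  -- Each local solution is used only at its own centre. By nondegeneracy of g this choice agrees
  -- near p with the solution built around p, so it is smooth.
  refine ⟨fun p => Y p p, fun p => ?_, fun p w => (hY p).self_of_nhds w⟩
  refine (hYs p).congr_of_eventuallyEq ?_
  filter_upwards [hY p] with q hq
  have : Y q q = Y p q :=
    g.eq_of_inner_eq fun u => ((hY q).self_of_nhds u).trans (hq u).symm
  rw [this]

/-- X is horizontal, so isometry gives c α(X)² = g(X, X) = c α(X), and α(X) is 0 or 1. If it were 0,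
then X = 0 by positivity, hence α = 0, against surjectivity of dπ. -/
theorem IsRiemannianSubmersion.angleForm_dual {c : ℝ} {hc : 0 < c}
    (h : IsRiemannianSubmersion g (circleMetric c hc) π) {X : ∀ p : M, TangentSpace (𝓡 m) p}
    (hX : ∀ p w, g.inner p (X p) w = c * angleForm π p w) (p : M) : angleForm π p (X p) = 1 := by
  have hhor : ∀ u : TangentSpace (𝓡 m) p, mfderiv (𝓡 m) (𝓡 1) π p u = 0 →
      g.inner p (X p) u = 0 := fun u hu => by
    rw [hX, (mfderiv_eq_zero_iff_angleForm h.smooth p u).1 hu, mul_zero]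
  have h1 := h.isometric p (X p) (X p) hhor hhor
  rw [circleMetric_mfderiv h.smooth hc, hX] at h1
  have h2 := mul_left_cancel₀ hc.ne' h1
  by_contra hne
  have h3 : angleForm π p (X p) = 0 := by
    by_contra h0
    exact hne (mul_left_cancel₀ h0 (h2.trans (mul_one _).symm))
  have h4 : X p = 0 := by
    by_contra h0
    have := g.pos p (X p) h0
    rw [hX, h3, mul_zero] at this
    exact lt_irrefl _ this
  obtain ⟨v, hv⟩ := h.surjective p
    (EuclideanSpace.single 0 (1 : ℝ) : EuclideanSpace ℝ (Fin 1))
  have h5 : angleForm π p v = 0 := by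
    have := hX p v
    rw [h4, map_zero, zero_apply] at this
    exact (mul_eq_zero.1 this.symm).resolve_left hc.ne'
  have h6 : (EuclideanSpace.single 0 (1 : ℝ) : EuclideanSpace ℝ (Fin 1)) = 0 :=
    hv.symm.trans ((mfderiv_eq_zero_iff_angleForm h.smooth p v).2 h5)
  have h7 := congrArg (fun v : EuclideanSpace ℝ (Fin 1) => v 0) h6
  simp at h7

end AngleForm

/-! ### Tubes and Riemannian submersions -/

section TubeSubmersion

variable {m n : ℕ} {M : Type*} [TopologicalSpace M] [ChartedSpace (EuclideanSpace ℝ (Fin m)) M]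
  [IsManifold (𝓡 m) ∞ M]
  {M₀ : Type*} [TopologicalSpace M₀] [ChartedSpace (EuclideanSpace ℝ (Fin n)) M₀]
  {g : SmoothMetric m M} {c : ℝ} {π : M → Circle} {Φ : M₀ × ℝ → M}

omit [IsManifold (𝓡 m) ∞ M] in
theorem surjective_mfderiv_of_angleForm_ne_zero (hπ : ContMDiff (𝓡 m) (𝓡 1) ∞ π) {p : M}
    {v : TangentSpace (𝓡 m) p} (h : angleForm π p v ≠ 0) :
    Function.Surjective (mfderiv (𝓡 m) (𝓡 1) π p) := by
  let L : EuclideanSpace ℝ (Fin m) →L[ℝ] EuclideanSpace ℝ (Fin 1) := mfderiv (𝓡 m) (𝓡 1) π p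
  let v' : EuclideanSpace ℝ (Fin m) := v
  have hw : L v' 0 ≠ 0 := by
    intro h0
    refine h ((mfderiv_eq_zero_iff_angleForm hπ p v).1 ?_)
    change L v' = 0
    ext i
    rw [Subsingleton.elim i 0]
    exact h0
  intro u
  let u' : EuclideanSpace ℝ (Fin 1) := u
  refine ⟨((u' 0 / L v' 0) • v' : EuclideanSpace ℝ (Fin m)), ?_⟩
  change L ((u' 0 / L v' 0) • v') = u'
  ext i
  rw [Subsingleton.elim i 0, map_smul]
  simp [div_mul_cancel₀ _ hw]

theorem IsHorizontalTube.angleForm_eq (h : IsHorizontalTube n g c π Φ)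
    (hπ : ContMDiff (𝓡 m) (𝓡 1) ∞ π) (q : M₀ × ℝ)
    (v : TangentSpace ((𝓡 n).prod 𝓘(ℝ, ℝ)) q) :
    angleForm π (Φ q) (mfderiv ((𝓡 n).prod 𝓘(ℝ, ℝ)) (𝓡 m) Φ q v) = v.2 := by
  rw [angleForm_mfderiv hπ (h.isLocalDiffeomorph.contMDiff.mdifferentiableAt (by simp))
    (f := Prod.snd) mdifferentiableAt_snd (fun p => h.proj p.1 p.2) v, mfderiv_snd]
  rfl

/-- Slice directions lie in ker dπ, so pairing a horizontal vector with its own slice component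
shows that this component vanishes. What remains is a multiple of ∂_t, whose squared length c
matches the circle. -/
theorem IsHorizontalTube.isRiemannianSubmersion (h : IsHorizontalTube n g c π Φ) (hc : 0 < c)
    (hπ : ContMDiff (𝓡 m) (𝓡 1) ∞ π) (hsurj : Function.Surjective Φ) :
    IsRiemannianSubmersion g (circleMetric c hc) π where
  smooth := hπ
  surjective p := by
    obtain ⟨q, rfl⟩ := hsurj p
    have h1 := h.angleForm_eq hπ q ((0 : EuclideanSpace ℝ (Fin n)), (1 : ℝ))
    exact surjective_mfderiv_of_angleForm_ne_zero hπ (by rw [h1]; exact one_ne_zero)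
  isometric p v w hv _ := by
    obtain ⟨⟨x, t⟩, rfl⟩ := hsurj p
    obtain ⟨⟨v, a⟩, rfl⟩ := (h.mfderiv_bijective (x, t)).2 v
    obtain ⟨⟨w, b⟩, rfl⟩ := (h.mfderiv_bijective (x, t)).2 w
    have hα : ∀ (v : TangentSpace (𝓡 n) x) (a : ℝ), angleForm π (Φ (x, t))
        (mfderiv ((𝓡 n).prod 𝓘(ℝ, ℝ)) (𝓡 m) Φ (x, t) (v, a)) = a :=
      fun v a => h.angleForm_eq hπ (x, t) (v, a)
    rw [circleMetric_mfderiv hπ hc]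
    refine (congrArg₂ (fun r s => c * (r * s)) (hα v a) (hα w b)).trans ?_
    have h1 := hv (mfderiv ((𝓡 n).prod 𝓘(ℝ, ℝ)) (𝓡 m) Φ (x, t) (v, (0 : ℝ)))
      ((mfderiv_eq_zero_iff_angleForm hπ _ _).2 (hα v 0))
    have h2 : mfderiv ((𝓡 n).prod 𝓘(ℝ, ℝ)) (𝓡 m) Φ (x, t) (v, (0 : ℝ)) = 0 := by
      by_contra hne
      have h3 := g.pos _ _ hne
      have h4 := (h.inner_eq x t v v a 0).symm.trans h1
      rw [mul_zero, mul_zero, add_zero] at h4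
      exact h3.ne' h4
    refine Eq.trans ?_ (h.inner_eq x t v w a b).symm
    rw [h2, map_zero, zero_apply, zero_add]

/-- One preimage of each point suffices, because the tension field is a quantity on M. A fundamental
domain of the covering can therefore be used. -/
theorem IsHorizontalTube.isHarmonicMap [IsManifold (𝓡 n) ∞ M₀] (h : IsHorizontalTube n g c π Φ)
    (hc : 0 < c) (hπ : ContMDiff (𝓡 m) (𝓡 1) ∞ π)
    (hd : ∀ p, ∃ x t, Φ (x, t) = p ∧
      deriv (fun t => (sliceGram g Φ x (stdFrame n x) t).det) t = 0) :
    IsHarmonicMap g (circleMetric c hc) π where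
  smooth := hπ
  tension_eq_zero e he f hf p hp hq k := by
    obtain ⟨x, t, rfl, ht⟩ := hd p
    rw [Subsingleton.elim k 0]
    exact (h.tensionField_eq_zero_iff hc hπ he hf hp hq).2 ht

end TubeSubmersion

/-! ### The tube of a mapping torus -/

namespace MappingTorus

variable {m n : ℕ} {M : Type u} [TopologicalSpace M] [ChartedSpace (EuclideanSpace ℝ (Fin m)) M]
  [IsManifold (𝓡 m) ∞ M]
  {M₀ : Type u} [TopologicalSpace M₀] [ChartedSpace (EuclideanSpace ℝ (Fin n)) M₀]
  [IsManifold (𝓡 n) ∞ M₀]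
  {g : SmoothMetric m M} {c : ℝ} {π : M → Circle} {η : Diffeomorph (𝓡 n) (𝓡 n) M₀ M₀ ∞}
  {gt : Icc (0 : ℝ) (2 * Real.pi) → SmoothMetric n M₀}
  {Ψ : Diffeomorph ((𝓡 n).prod 𝓘(ℝ, ℝ)) (𝓡 m) (MappingTorus η.toHomeomorph) M ∞}

/-- The metric is prescribed for t in [0, 2π] only. A deck transformation D brings any t into this
interval; it satisfies Φ ∘ D = Φ and preserves both ∂_t and the slice directions, so the form of the
metric propagates to all of ℝ. -/
theorem isHorizontalTube
    (hg : ∀ (x : M₀) (t : Icc (0 : ℝ) (2 * Real.pi)) (v w : TangentSpace (𝓡 n) x) (a b : ℝ),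
        g.inner (Ψ (MappingTorus.cover η.toHomeomorph (x, (t : ℝ))))
          (mfderiv ((𝓡 n).prod 𝓘(ℝ, ℝ)) (𝓡 m)
            (fun p : M₀ × ℝ => Ψ (MappingTorus.cover η.toHomeomorph p)) (x, (t : ℝ)) (v, a))
          (mfderiv ((𝓡 n).prod 𝓘(ℝ, ℝ)) (𝓡 m)
            (fun p : M₀ × ℝ => Ψ (MappingTorus.cover η.toHomeomorph p)) (x, (t : ℝ)) (w, b)) =
        (gt t).inner x v w + c * (a * b))
    (hπ : ∀ (x : M₀) (t : Icc (0 : ℝ) (2 * Real.pi)),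
        π (Ψ (MappingTorus.mk η.toHomeomorph (x, t))) = Circle.exp t) :
    IsHorizontalTube n g c π (fun p : M₀ × ℝ => Ψ (MappingTorus.cover η.toHomeomorph p)) := by
  set Φ : M₀ × ℝ → M := fun p => Ψ (MappingTorus.cover η.toHomeomorph p) with hΦdef
  have hΦ : IsLocalDiffeomorph ((𝓡 n).prod 𝓘(ℝ, ℝ)) (𝓡 m) ∞ Φ := fun p =>
    IsLocalDiffeomorphAt.comp (hf := isLocalDiffeomorph_cover η p) (hg := Ψ.isLocalDiffeomorph _)
  refine ⟨hΦ, fun x t => ?_, fun x t v w a b => ?_⟩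
  · change π (Ψ (mk _ _)) = _
    rw [hπ]
    change Circle.exp (t - winding t * (2 * Real.pi)) = _
    exact Circle.periodic_exp.sub_int_mul_eq _
  · set k : ℤ := -winding t
    let D : M₀ × ℝ → M₀ × ℝ := fun q => ((η.toHomeomorph ^ k) q.1, q.2 + k * (2 * Real.pi))
    have hΦD : Φ = Φ ∘ D := funext fun q =>
      congrArg Ψ ((cover_eq_cover_iff η.toHomeomorph q (D q)).2 ⟨k, rfl⟩)
    have hs : (D (x, t)).2 ∈ Icc (0 : ℝ) (2 * Real.pi) := by
      have := sub_winding_mem t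
      change t + (k : ℝ) * (2 * Real.pi) ∈ _
      have e : t + (k : ℝ) * (2 * Real.pi) = t - winding t * (2 * Real.pi) := by
        simp only [k]; push_cast; ring
      rw [e]; exact this
    have h1 : HasMFDerivAt (𝓡 n) (𝓡 n) (η.toHomeomorph ^ k) x
        (mfderiv (𝓡 n) (𝓡 n) (η.toHomeomorph ^ k) x) :=
      ((contMDiff_zpow η k).mdifferentiable (by simp) x).hasMFDerivAt
    have h2 : HasMFDerivAt 𝓘(ℝ, ℝ) 𝓘(ℝ, ℝ) (fun s : ℝ => s + k * (2 * Real.pi)) t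
        (ContinuousLinearMap.id ℝ ℝ) :=
      ((hasFDerivAt_id t).add_const _).hasMFDerivAt
    have h3 : HasMFDerivAt ((𝓡 n).prod 𝓘(ℝ, ℝ)) ((𝓡 n).prod 𝓘(ℝ, ℝ)) D (x, t)
        (((mfderiv (𝓡 n) (𝓡 n) (η.toHomeomorph ^ k) x).comp (ContinuousLinearMap.fst ℝ _ _)).prod
          ((ContinuousLinearMap.id ℝ ℝ).comp (ContinuousLinearMap.snd ℝ _ _))) :=
      (h1.comp (x, t) (hasMFDerivAt_fst (x, t))).prodMk (h2.comp (x, t) (hasMFDerivAt_snd (x, t)))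
    have h4 : ∀ (v : TangentSpace (𝓡 n) x) (a : ℝ),
        mfderiv ((𝓡 n).prod 𝓘(ℝ, ℝ)) (𝓡 m) Φ (x, t) (v, a) =
          mfderiv ((𝓡 n).prod 𝓘(ℝ, ℝ)) (𝓡 m) Φ (D (x, t))
            (mfderiv (𝓡 n) (𝓡 n) (η.toHomeomorph ^ k) x v, a) := by
      intro v a
      have h5 := (hΦ.contMDiff.mdifferentiable (by simp) (D (x, t))).hasMFDerivAt.comp (x, t) h3
      rw [← hΦD] at h5
      rw [h5.mfderiv]
      rfl
    have h6 : Φ (x, t) = Φ (D (x, t)) := congrFun hΦD (x, t)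
    have h7 := fun v w a b => hg (D (x, t)).1 ⟨(D (x, t)).2, hs⟩
      (mfderiv (𝓡 n) (𝓡 n) (η.toHomeomorph ^ k) x v)
      (mfderiv (𝓡 n) (𝓡 n) (η.toHomeomorph ^ k) x w) a b
    have h8 : ∀ (v w : TangentSpace (𝓡 n) x) (a b : ℝ), g.inner (Φ (x, t))
        (mfderiv ((𝓡 n).prod 𝓘(ℝ, ℝ)) (𝓡 m) Φ (x, t) (v, a))
        (mfderiv ((𝓡 n).prod 𝓘(ℝ, ℝ)) (𝓡 m) Φ (x, t) (w, b)) =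
        (gt ⟨(D (x, t)).2, hs⟩).inner (D (x, t)).1
          (mfderiv (𝓡 n) (𝓡 n) (η.toHomeomorph ^ k) x v)
          (mfderiv (𝓡 n) (𝓡 n) (η.toHomeomorph ^ k) x w) + c * (a * b) := by
      intro v w a b
      rw [h4, h4]
      refine Eq.trans ?_ (h7 v w a b)
      rw [h6]
    rw [h8, h8 v w 0 0]
    ring

theorem isHarmonicMap_and_isRiemannianSubmersion (hc : 0 < c) (hπs : ContMDiff (𝓡 m) (𝓡 1) ∞ π)
    (hg : ∀ (x : M₀) (t : Icc (0 : ℝ) (2 * Real.pi)) (v w : TangentSpace (𝓡 n) x) (a b : ℝ),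
        g.inner (Ψ (MappingTorus.cover η.toHomeomorph (x, (t : ℝ))))
          (mfderiv ((𝓡 n).prod 𝓘(ℝ, ℝ)) (𝓡 m)
            (fun p : M₀ × ℝ => Ψ (MappingTorus.cover η.toHomeomorph p)) (x, (t : ℝ)) (v, a))
          (mfderiv ((𝓡 n).prod 𝓘(ℝ, ℝ)) (𝓡 m)
            (fun p : M₀ × ℝ => Ψ (MappingTorus.cover η.toHomeomorph p)) (x, (t : ℝ)) (w, b)) =
        (gt t).inner x v w + c * (a * b))
    (hvol : ∀ (s t : Icc (0 : ℝ) (2 * Real.pi)) (x : M₀) (v : Fin n → TangentSpace (𝓡 n) x),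
        volumeDensity (gt s) x v = volumeDensity (gt t) x v)
    (hπ : ∀ (x : M₀) (t : Icc (0 : ℝ) (2 * Real.pi)),
        π (Ψ (MappingTorus.mk η.toHomeomorph (x, t))) = Circle.exp t) :
    IsHarmonicMap g (circleMetric c hc) π ∧ IsRiemannianSubmersion g (circleMetric c hc) π := by
  have h := isHorizontalTube hg hπ
  set Φ : M₀ × ℝ → M := fun p => Ψ (MappingTorus.cover η.toHomeomorph p) with hΦdef
  refine ⟨h.isHarmonicMap hc hπs fun p => ?_, h.isRiemannianSubmersion hc hπs
    (Ψ.surjective.comp (cover_surjective _))⟩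
  obtain ⟨z, rfl⟩ := Ψ.surjective p
  obtain ⟨⟨x, t⟩, rfl⟩ : ∃ r, mk η.toHomeomorph r = z := Quot.exists_rep z
  refine ⟨x, t, congrArg Ψ (mk_eq_cover η.toHomeomorph (x, t)).symm, ?_⟩
  have h1 : ∀ s : Icc (0 : ℝ) (2 * Real.pi), (sliceGram g Φ x (stdFrame n x) s).det =
      volumeDensity (gt s) x (stdFrame n x) ^ 2 := by
    intro s
    have h2 : sliceGram g Φ x (stdFrame n x) s =
        Matrix.of fun i j => (gt s).inner x (stdFrame n x i) (stdFrame n x j) := by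
      ext i j
      refine (hg x s _ _ 0 0).trans ?_
      rw [mul_zero, mul_zero, add_zero]
      rfl
    have h3 := (h.det_sliceGram_pos hc x s).le
    rw [h2] at h3 ⊢
    exact (Real.sq_sqrt h3).symm
  have h2 : EqOn (fun s => (sliceGram g Φ x (stdFrame n x) s).det)
      (fun _ => volumeDensity (gt t) x (stdFrame n x) ^ 2) (Icc (0 : ℝ) (2 * Real.pi)) := by
    intro s hs
    change (sliceGram g Φ x (stdFrame n x) s).det = _
    rw [h1 ⟨s, hs⟩, hvol ⟨s, hs⟩ t]
  -- The determinant is known to be constant only on [0, 2π]. As it is smooth on ℝ, its derivative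
  -- at an endpoint equals the one-sided derivative.
  have hu : UniqueDiffWithinAt ℝ (Icc (0 : ℝ) (2 * Real.pi)) t :=
    uniqueDiffOn_Icc Real.two_pi_pos t t.2
  have h3 : DifferentiableAt ℝ (fun s => (sliceGram g Φ x (stdFrame n x) s).det) t :=
    (contDiff_det_sliceGram h.isLocalDiffeomorph.contMDiff x).differentiable (by simp) t
  rw [← h3.derivWithin hu, derivWithin_congr h2 (h2 t.2)]
  simp

end MappingTorus

/-! ### Fibres and flows -/

section FibreFlow

variable {m n : ℕ} {M : Type u} [TopologicalSpace M] [ChartedSpace (EuclideanSpace ℝ (Fin m)) M]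
  {M₀ : Type u} [TopologicalSpace M₀] [ChartedSpace (EuclideanSpace ℝ (Fin n)) M₀]
  {π : M → Circle} {j : M₀ → M} {φ : ℝ → M → M}

variable (m n) in
/-- A smooth embedding onto the fibre of `π` over `1`, which locally has smooth retractions. -/
structure IsFibreEmbedding (π : M → Circle) (j : M₀ → M) : Prop where
  contMDiff : ContMDiff (𝓡 n) (𝓡 m) ∞ j
  isEmbedding : Topology.IsEmbedding j
  mem_range_iff : ∀ p, (∃ x, j x = p) ↔ π p = 1
  exists_retraction : ∀ x, ∃ r : M → M₀, ContMDiffAt (𝓡 m) (𝓡 n) ∞ r (j x) ∧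
    ∀ᶠ z in nhds x, r (j z) = z

/-- The embedding makes F continuous, and then F = r ∘ j ∘ F near q for a local retraction r. -/
theorem IsFibreEmbedding.contMDiffAt_of_comp (h : IsFibreEmbedding m n π j)
    {EP : Type*} [NormedAddCommGroup EP] [NormedSpace ℝ EP] {HP : Type*} [TopologicalSpace HP]
    {IP : ModelWithCorners ℝ EP HP} {P : Type*} [TopologicalSpace P] [ChartedSpace HP P]
    {F : P → M₀} {q : P} (hF : ContMDiffAt IP (𝓡 m) ∞ (fun p => j (F p)) q) :
    ContMDiffAt IP (𝓡 n) ∞ F q := by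
  have hc : ContinuousAt F q := h.isEmbedding.isInducing.continuousAt_iff.2 hF.continuousAt
  obtain ⟨r, hr, hrj⟩ := h.exists_retraction (F q)
  refine (ContMDiffAt.comp q (f := fun p => j (F p)) hr hF).congr_of_eventuallyEq ?_
  filter_upwards [hc.eventually hrj] with p hp using hp.symm

/-- A smooth flow along which the angle grows with unit speed. -/
structure IsAngleFlow (m : ℕ) {M : Type*} [TopologicalSpace M]
    [ChartedSpace (EuclideanSpace ℝ (Fin m)) M] (π : M → Circle) (φ : ℝ → M → M) : Prop where
  contMDiff : ContMDiff (𝓘(ℝ, ℝ).prod (𝓡 m)) (𝓡 m) ∞ (fun q : ℝ × M => φ q.1 q.2)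
  zero : ∀ p, φ 0 p = p
  add : ∀ s t p, φ (s + t) p = φ s (φ t p)
  proj : ∀ t p, π (φ t p) = Circle.exp t * π p

/-- The function e^{-is} π(φ_s p) has zero derivative, because π(φ_s p) has derivative i π(φ_s p)
α(X) with α(X) = 1. -/
theorem proj_flow {X : ∀ p : M, TangentSpace (𝓡 m) p} (hπ : ContMDiff (𝓡 m) (𝓡 1) ∞ π)
    (h0 : ∀ p, φ 0 p = p) (hφ : ∀ p t, HasMFDerivAt 𝓘(ℝ, ℝ) (𝓡 m) (fun s => φ s p) t
        ((1 : ℝ →L[ℝ] ℝ).smulRight (X (φ t p))))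
    (hX : ∀ p, angleForm π p (X p) = 1) (t : ℝ) (p : M) :
    π (φ t p) = Circle.exp t * π p := by
  have h1 : ∀ s, HasDerivAt (fun s => (π (φ s p) : ℂ)) (π (φ s p) * Complex.I) s := by
    intro s
    have h2 : HasMFDerivAt 𝓘(ℝ, ℝ) 𝓘(ℝ, ℂ) (fun s => (π (φ s p) : ℂ)) s
        ((circleInclusionDeriv (π (φ s p))).comp ((mfderiv (𝓡 m) (𝓡 1) π (φ s p)).comp
          ((1 : ℝ →L[ℝ] ℝ).smulRight (X (φ s p))))) :=
      HasMFDerivAt.comp s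
        ((contMDiff_circle_coe.mdifferentiable (by simp) (π (φ s p))).hasMFDerivAt)
        (HasMFDerivAt.comp s (hπ.mdifferentiable (by simp) (φ s p)).hasMFDerivAt (hφ p s))
    let L : ℝ →L[ℝ] ℂ := (circleInclusionDeriv (π (φ s p))).comp
      ((mfderiv (𝓡 m) (𝓡 1) π (φ s p)).comp ((1 : ℝ →L[ℝ] ℝ).smulRight (X (φ s p))))
    have h3 : HasFDerivAt (fun s => (π (φ s p) : ℂ)) L s := hasMFDerivAt_iff_hasFDerivAt.1 h2
    refine h3.hasDerivAt.congr_deriv ?_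
    have h4 := circleInclusionDeriv_mfderiv_eq hπ (φ s p) (X (φ s p))
    rw [hX, one_smul] at h4
    refine Eq.trans ?_ h4
    change circleInclusionDeriv (π (φ s p)) (mfderiv (𝓡 m) (𝓡 1) π (φ s p)
      ((1 : ℝ) • X (φ s p))) = _
    rw [one_smul]
  have h2 : ∀ s, HasDerivAt (fun s : ℝ => Complex.exp (-(s * Complex.I)) * (π (φ s p) : ℂ)) 0 s := by
    intro s
    have h3 : HasDerivAt (fun s : ℝ => Complex.exp (-(s * Complex.I)))
        (Complex.exp (-(s * Complex.I)) * (-Complex.I)) s := by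
      have := ((Complex.ofRealCLM.hasDerivAt (x := s)).mul_const Complex.I).neg.cexp
      simpa using this
    refine (h3.mul (h1 s)).congr_deriv ?_
    ring
  have h3 := is_const_of_deriv_eq_zero (fun s => (h2 s).differentiableAt)
    (fun s => (h2 s).deriv) t 0
  rw [h0] at h3
  simp only [Complex.ofReal_zero, zero_mul, neg_zero, Complex.exp_zero, one_mul] at h3
  refine Circle.ext ?_
  rw [Circle.coe_mul, Circle.coe_exp, ← h3, ← mul_assoc, ← Complex.exp_add, add_neg_cancel,
    Complex.exp_zero, one_mul]

/-! ### The tube swept out by a fibre under the flow -/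

namespace IsAngleFlow

theorem neg_apply (h : IsAngleFlow m π φ) (t : ℝ) (p : M) : φ (-t) (φ t p) = p := by
  rw [← h.add, neg_add_cancel, h.zero]

theorem apply_neg (h : IsAngleFlow m π φ) (t : ℝ) (p : M) : φ t (φ (-t) p) = p := by
  rw [← h.add, add_neg_cancel, h.zero]

theorem contMDiff_apply (h : IsAngleFlow m π φ) (t : ℝ) : ContMDiff (𝓡 m) (𝓡 m) ∞ (φ t) :=
  ContMDiff.comp (f := fun p : M => (t, p)) h.contMDiff (contMDiff_const.prodMk contMDiff_id)

theorem exists_preimage (h : IsAngleFlow m π φ) (hj : IsFibreEmbedding m n π j) {p : M} {t : ℝ}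
    (hp : π p = Circle.exp t) : ∃ x, j x = φ (-t) p := by
  rw [hj.mem_range_iff, h.proj, hp, ← Circle.exp_add, neg_add_cancel, Circle.exp_zero]

theorem contMDiff_tube (h : IsAngleFlow m π φ) (hj : IsFibreEmbedding m n π j) :
    ContMDiff ((𝓡 n).prod 𝓘(ℝ, ℝ)) (𝓡 m) ∞ (fun q : M₀ × ℝ => φ q.2 (j q.1)) :=
  ContMDiff.comp (f := fun q : M₀ × ℝ => (q.2, j q.1)) h.contMDiff
    (contMDiff_snd.prodMk (hj.contMDiff.comp contMDiff_fst))

theorem proj_tube (h : IsAngleFlow m π φ) (hj : IsFibreEmbedding m n π j) (x : M₀) (t : ℝ) :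
    π (φ t (j x)) = Circle.exp t := by
  rw [h.proj, (hj.mem_range_iff (j x)).1 ⟨x, rfl⟩, mul_one]

/-- The inverse is explicit: with θ the branch of the angle around t₀, a point p comes from flowing
p back to the fibre for time θ(p). This works on the whole strip |t − t₀| < π. -/
theorem isLocalDiffeomorph_tube (h : IsAngleFlow m π φ) (hj : IsFibreEmbedding m n π j)
    (hπ : ContMDiff (𝓡 m) (𝓡 1) ∞ π) :
    IsLocalDiffeomorph ((𝓡 n).prod 𝓘(ℝ, ℝ)) (𝓡 m) ∞ (fun q : M₀ × ℝ => φ q.2 (j q.1)) := by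
  rintro ⟨x₀, t₀⟩
  choose ρ hρ using fun p : M => h.exists_preimage hj (exp_angleNear t₀ (π p)).symm
  refine ⟨{ toFun := fun q => φ q.2 (j q.1)
            invFun := fun p => (ρ p, angleNear t₀ (π p))
            source := univ ×ˢ Ioo (t₀ - Real.pi) (t₀ + Real.pi)
            target := π ⁻¹' angleDomain t₀
            map_source' := ?_
            map_target' := ?_
            left_inv' := ?_
            right_inv' := ?_
            open_source := isOpen_univ.prod isOpen_Ioo
            open_target := (isOpen_angleDomain t₀).preimage hπ.continuous
            contMDiffOn_toFun := (h.contMDiff_tube hj).contMDiffOn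
            contMDiffOn_invFun := ?_ }, ?_, fun q _ => rfl⟩
  · rintro ⟨x, t⟩ ⟨-, ht⟩
    change π (φ t (j x)) ∈ angleDomain t₀
    rw [h.proj_tube hj]
    exact exp_mem_angleDomain (abs_lt.2 ⟨by linarith [ht.1], by linarith [ht.2]⟩)
  · intro p hp
    have h1 := Complex.mem_slitPlane_iff_arg.1 hp
    have h2 := Complex.neg_pi_lt_arg ((π p * (Circle.exp t₀)⁻¹ : Circle) : ℂ)
    have h3 := (Complex.arg_le_pi ((π p * (Circle.exp t₀)⁻¹ : Circle) : ℂ)).lt_of_ne h1.1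
    refine ⟨mem_univ _, ?_, ?_⟩
    · change t₀ - Real.pi < angleNear t₀ (π p)
      rw [angleNear]; linarith
    · change angleNear t₀ (π p) < t₀ + Real.pi
      rw [angleNear]; linarith
  · rintro ⟨x, t⟩ ⟨-, ht⟩
    have h1 : angleNear t₀ (π (φ t (j x))) = t := by
      rw [h.proj_tube hj]
      exact angleNear_exp (abs_lt.2 ⟨by linarith [ht.1], by linarith [ht.2]⟩)
    refine Prod.ext (hj.isEmbedding.injective ?_) h1
    change j (ρ (φ t (j x))) = j x
    rw [hρ, h1, h.neg_apply]
  · intro p hp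
    change φ (angleNear t₀ (π p)) (j (ρ p)) = p
    rw [hρ, h.apply_neg]
  · intro p hp
    have h1 := contMDiffAt_angleNear_comp hπ hp
    refine (ContMDiffAt.prodMk (hj.contMDiffAt_of_comp ?_) h1).contMDiffWithinAt
    simp only [hρ]
    have h2 : ContMDiffAt (𝓡 m) 𝓘(ℝ, ℝ) ∞ (fun p => -angleNear t₀ (π p)) p := h1.neg
    exact ContMDiffAt.comp (f := fun p : M => (-angleNear t₀ (π p), p)) p
      (h.contMDiff _) (h2.prodMk contMDiffAt_id)
  · exact ⟨mem_univ _, by simp [Real.pi_pos], by simp [Real.pi_pos]⟩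

/-- The return map of the flow. -/
theorem exists_returnMap (h : IsAngleFlow m π φ) (hj : IsFibreEmbedding m n π j) :
    ∃ η : Diffeomorph (𝓡 n) (𝓡 n) M₀ M₀ ∞, ∀ x, j (η x) = φ (-(2 * Real.pi)) (j x) := by
  -- The sign is forced by the gluing (x, 0) ∼ (η x, 2π), which requires φ_{2π}(η x) = x.
  have h1 : ∀ x, ∃ y, j y = φ (-(2 * Real.pi)) (j x) := fun x =>
    h.exists_preimage hj (by rw [Circle.exp_two_pi]; exact (hj.mem_range_iff _).1 ⟨x, rfl⟩)
  have h2 : ∀ x, ∃ y, j y = φ (2 * Real.pi) (j x) := fun x => by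
    rw [hj.mem_range_iff, h.proj_tube hj, Circle.exp_two_pi]
  choose a ha using h1
  choose b hb using h2
  exact ⟨{ toFun := a
           invFun := b
           left_inv := fun x => hj.isEmbedding.injective (by rw [hb, ha, h.apply_neg])
           right_inv := fun x => hj.isEmbedding.injective (by rw [ha, hb, h.neg_apply])
           contMDiff_toFun := fun x => hj.contMDiffAt_of_comp (by
             simp only [Equiv.coe_fn_mk, ha]
             exact ((h.contMDiff_apply _).comp hj.contMDiff) x)
           contMDiff_invFun := fun x => hj.contMDiffAt_of_comp (by
             simp only [Equiv.coe_fn_symm_mk, hb]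
             exact ((h.contMDiff_apply _).comp hj.contMDiff) x) }, ha⟩

theorem zpow_returnMap (h : IsAngleFlow m π φ) {η : M₀ ≃ₜ M₀}
    (hη : ∀ x, j (η x) = φ (-(2 * Real.pi)) (j x)) (k : ℤ) (x : M₀) :
    j ((η ^ k) x) = φ (-(k * (2 * Real.pi))) (j x) := by
  have hs : ∀ x, j (η.symm x) = φ (2 * Real.pi) (j x) := fun x => by
    have := hη (η.symm x)
    rw [η.apply_symm_apply] at this
    rw [this, h.apply_neg]
  induction k using Int.induction_on with
  | zero => simp [h.zero]
  | succ i ih =>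
    rw [add_comm, zpow_one_add]
    change j (η ((η ^ (i : ℤ)) x)) = _
    rw [hη, ih, ← h.add]
    congr 1
    push_cast
    ring
  | pred i ih =>
    rw [sub_eq_neg_add, zpow_add, zpow_neg_one]
    change j (η.symm ((η ^ (-(i : ℤ))) x)) = _
    rw [hs, ih, ← h.add]
    congr 1
    push_cast
    ring

/-- Equal images have equal angles, so the times differ by 2πk. Flowing back to the fibre, the base
points then differ by φ_{-2πk}, which is η^k. -/
theorem tube_eq_iff (h : IsAngleFlow m π φ) (hj : IsFibreEmbedding m n π j) {η : M₀ ≃ₜ M₀}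
    (hη : ∀ x, j (η x) = φ (-(2 * Real.pi)) (j x)) (q q' : M₀ × ℝ) :
    φ q.2 (j q.1) = φ q'.2 (j q'.1) ↔
      ∃ k : ℤ, q' = ((η ^ k) q.1, q.2 + k * (2 * Real.pi)) := by
  constructor
  · intro hq
    have h1 := congrArg π hq
    rw [h.proj_tube hj, h.proj_tube hj] at h1
    obtain ⟨k, hk⟩ := Circle.exp_eq_exp.1 h1.symm
    refine ⟨k, Prod.ext (hj.isEmbedding.injective ?_) hk⟩
    change j q'.1 = j ((η ^ k) q.1)
    rw [h.zpow_returnMap hη, ← h.neg_apply q'.2 (j q'.1), ← hq, ← h.add, hk]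
    congr 1
    ring
  · rintro ⟨k, rfl⟩
    change _ = φ (q.2 + k * (2 * Real.pi)) (j ((η ^ k) q.1))
    rw [h.zpow_returnMap hη, ← h.add]
    congr 1
    ring

theorem surjective_tube (h : IsAngleFlow m π φ) (hj : IsFibreEmbedding m n π j) :
    Function.Surjective (fun q : M₀ × ℝ => φ q.2 (j q.1)) := by
  intro p
  obtain ⟨x, hx⟩ := h.exists_preimage hj (exp_angleNear 0 (π p)).symm
  refine ⟨(x, angleNear 0 (π p)), ?_⟩
  change φ _ (j x) = p
  rw [hx, h.apply_neg]

end IsAngleFlow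

/-- A local diffeomorphism with the fibres of `cover` induces a diffeomorphism of the mapping
torus. -/
theorem MappingTorus.exists_diffeomorph [IsManifold (𝓡 n) ∞ M₀] {Φ : M₀ × ℝ → M}
    {η : Diffeomorph (𝓡 n) (𝓡 n) M₀ M₀ ∞}
    (hΦ : IsLocalDiffeomorph ((𝓡 n).prod 𝓘(ℝ, ℝ)) (𝓡 m) ∞ Φ) (hsurj : Function.Surjective Φ)
    (h : ∀ q q', Φ q = Φ q' ↔ ∃ k : ℤ, q' = ((η.toHomeomorph ^ k) q.1, q.2 + k * (2 * Real.pi))) :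
    ∃ Ψ : Diffeomorph ((𝓡 n).prod 𝓘(ℝ, ℝ)) (𝓡 m) (MappingTorus η.toHomeomorph) M ∞,
      ∀ q, Ψ (cover η.toHomeomorph q) = Φ q := by
  have hiff : ∀ q q', cover η.toHomeomorph q = cover η.toHomeomorph q' ↔ Φ q = Φ q' :=
    fun q q' => (cover_eq_cover_iff _ q q').trans (h q q').symm
  choose s hs using cover_surjective η.toHomeomorph
  let F : MappingTorus η.toHomeomorph → M := fun z => Φ (s z)
  have hF : ∀ q, F (cover η.toHomeomorph q) = Φ q := fun q => (hiff _ _).1 (hs _)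
  have hbij : Function.Bijective F := by
    refine ⟨fun z z' hz => ?_, fun p => ?_⟩
    · rw [← hs z, ← hs z']
      exact (hiff _ _).2 hz
    · obtain ⟨q, rfl⟩ := hsurj p
      exact ⟨_, hF q⟩
  let e := Equiv.ofBijective F hbij
  refine ⟨⟨e, ?_, ?_⟩, hF⟩
  · intro z
    obtain ⟨q, rfl⟩ := cover_surjective _ z
    -- The section s is not continuous in general; smoothness comes from F = Φ ∘ (local inverse of
    -- the covering), and symmetrically for the inverse of F.
    have hc := isLocalDiffeomorph_cover η q
    have hq : hc.localInverse (cover η.toHomeomorph q) = q :=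
      hc.localInverse_left_inv hc.localInverse_mem_target
    refine (ContMDiffAt.comp (g := Φ) (f := hc.localInverse) _ (hΦ.contMDiff _)
      hc.localInverse_contMDiffAt).congr_of_eventuallyEq ?_
    filter_upwards [hc.localInverse_eventuallyEq_right] with z hz
    have hz' : cover η.toHomeomorph (hc.localInverse z) = z := hz
    change F z = Φ (hc.localInverse z)
    rw [← hF, hz']
  · intro p
    obtain ⟨q, rfl⟩ := hsurj p
    refine (ContMDiffAt.comp (g := cover η.toHomeomorph) (f := (hΦ q).localInverse) _
      (contMDiff_cover η _) (hΦ q).localInverse_contMDiffAt).congr_of_eventuallyEq ?_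
    filter_upwards [(hΦ q).localInverse_eventuallyEq_right] with p hp
    have hp' : Φ ((hΦ q).localInverse p) = p := hp
    change e.symm p = cover η.toHomeomorph ((hΦ q).localInverse p)
    rw [Equiv.symm_apply_eq]
    exact hp'.symm.trans (hF _).symm

end FibreFlow

/-! ### The mapping torus of a harmonic Riemannian submersion -/

section Decomposition

variable {m n : ℕ} {M : Type u} [TopologicalSpace M] [ChartedSpace (EuclideanSpace ℝ (Fin m)) M]
  [IsManifold (𝓡 m) ∞ M]
  {M₀ : Type u} [TopologicalSpace M₀] [ChartedSpace (EuclideanSpace ℝ (Fin n)) M₀]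
  {g : SmoothMetric m M} {c : ℝ} {π : M → Circle} {j : M₀ → M} {φ : ℝ → M → M}
  {X : ∀ p : M, TangentSpace (𝓡 m) p} {Φ : M₀ × ℝ → M}

/-- All tangent spaces are the model space by definition, so vectors at equal base points can be
compared there without transport. -/
theorem SmoothMetric.inner_congr (g : SmoothMetric m M) {p q : M} (h : p = q)
    {A B A' B' : EuclideanSpace ℝ (Fin m)} (hA : A = A') (hB : B = B') :
    g.inner p A B = g.inner q A' B' := by
  subst h hA hB
  rfl

omit [IsManifold (𝓡 m) ∞ M] in
theorem mfderiv_slice (hΦ : ContMDiff ((𝓡 n).prod 𝓘(ℝ, ℝ)) (𝓡 m) ∞ Φ) (x : M₀) (t : ℝ)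
    (v : TangentSpace (𝓡 n) x) :
    mfderiv (𝓡 n) (𝓡 m) (fun x => Φ (x, t)) x v =
      mfderiv ((𝓡 n).prod 𝓘(ℝ, ℝ)) (𝓡 m) Φ (x, t) (v, (0 : ℝ)) := by
  have h1 : HasMFDerivAt (𝓡 n) ((𝓡 n).prod 𝓘(ℝ, ℝ)) (fun x : M₀ => (x, t)) x
      ((ContinuousLinearMap.id ℝ _).prod 0) := (hasMFDerivAt_id x).prodMk (hasMFDerivAt_const t x)
  have h2 := (hΦ.mdifferentiable (by simp) (x, t)).hasMFDerivAt.comp x h1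
  exact congrArg (fun L : EuclideanSpace ℝ (Fin n) →L[ℝ] EuclideanSpace ℝ (Fin m) => L v) h2.mfderiv

/-- Φ_*∂_t = X by the flow equation. The angle is constant on slices, so g(X, Φ_*(v, 0)) = c
α(Φ_*(v, 0)) = 0, and g(X, X) = c α(X) = c. -/
theorem IsAngleFlow.isHorizontalTube (h : IsAngleFlow m π φ) (hj : IsFibreEmbedding m n π j)
    (hπ : ContMDiff (𝓡 m) (𝓡 1) ∞ π) (hX : ∀ p w, g.inner p (X p) w = c * angleForm π p w)
    (hX1 : ∀ p, angleForm π p (X p) = 1)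
    (hφ : ∀ p t, HasMFDerivAt 𝓘(ℝ, ℝ) (𝓡 m) (fun s => φ s p) t
        ((1 : ℝ →L[ℝ] ℝ).smulRight (X (φ t p)))) :
    IsHorizontalTube n g c π (fun q : M₀ × ℝ => φ q.2 (j q.1)) := by
  set Φ : M₀ × ℝ → M := fun q => φ q.2 (j q.1) with hΦdef
  have hΦ : ContMDiff ((𝓡 n).prod 𝓘(ℝ, ℝ)) (𝓡 m) ∞ Φ := h.contMDiff_tube hj
  refine ⟨h.isLocalDiffeomorph_tube hj hπ, h.proj_tube hj, fun x t v w a b => ?_⟩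
  let L : EuclideanSpace ℝ (Fin n) × ℝ →L[ℝ] EuclideanSpace ℝ (Fin m) :=
    mfderiv ((𝓡 n).prod 𝓘(ℝ, ℝ)) (𝓡 m) Φ (x, t)
  let Y : EuclideanSpace ℝ (Fin m) := X (φ t (j x))
  let B : EuclideanSpace ℝ (Fin m) →L[ℝ] EuclideanSpace ℝ (Fin m) →L[ℝ] ℝ := g.inner (φ t (j x))
  have h1 : L (0, 1) = Y := by
    have h2 : HasMFDerivAt 𝓘(ℝ, ℝ) ((𝓡 n).prod 𝓘(ℝ, ℝ)) (fun s : ℝ => (x, s)) t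
        ((0 : ℝ →L[ℝ] TangentSpace (𝓡 n) x).prod (ContinuousLinearMap.id ℝ ℝ)) :=
      (hasMFDerivAt_const x t).prodMk (hasMFDerivAt_id t)
    have h3 := (hΦ.mdifferentiable (by simp) (x, t)).hasMFDerivAt.comp t h2
    have h4 := hasMFDerivAt_unique h3 (hφ (j x) t)
    refine (congrArg (fun L : ℝ →L[ℝ] EuclideanSpace ℝ (Fin m) => L 1) h4).trans ?_
    change (1 : ℝ) • Y = _
    rw [one_smul]
  have h2 : ∀ (v : EuclideanSpace ℝ (Fin n)) (a : ℝ), L (v, a) = L (v, 0) + a • Y := by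
    intro v a
    rw [← h1, ← map_smul, ← map_add]
    simp
  have h3 : ∀ v : EuclideanSpace ℝ (Fin n), B Y (L (v, 0)) = 0 := by
    intro v
    have h4 := angleForm_mfderiv hπ (hΦ.mdifferentiableAt (x := (x, t)) (by simp))
      (f := Prod.snd) mdifferentiableAt_snd (fun p => h.proj_tube hj p.1 p.2)
      ((v, (0 : ℝ)) : EuclideanSpace ℝ (Fin n) × ℝ)
    rw [mfderiv_snd] at h4
    have h5 : angleForm π (φ t (j x)) (L (v, 0)) = 0 := h4
    exact (hX (φ t (j x)) (L (v, 0))).trans (by rw [h5, mul_zero])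
  have hsymm : ∀ u w, B u w = B w u := fun u w => g.symm _ u w
  have hYY : B Y Y = c := (hX _ _).trans (by rw [hX1, mul_one])
  have key : ∀ v w : EuclideanSpace ℝ (Fin n),
      B (L (v, a)) (L (w, b)) = B (L (v, 0)) (L (w, 0)) + c * (a * b) := by
    intro v w
    rw [h2 v a, h2 w b]
    simp only [map_add, map_smul, add_apply, smul_apply, h3, hsymm (L (v, 0)) Y, hYY, smul_eq_mul]
    ring
  exact key v w

theorem IsHorizontalTube.det_sliceGram_eq [IsManifold (𝓡 n) ∞ M₀]
    (h : IsHorizontalTube n g c π Φ) (hc : 0 < c)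
    (hharm : IsHarmonicMap g (circleMetric c hc) π) (x : M₀)
    (v : Fin n → TangentSpace (𝓡 n) x) (s t : ℝ) :
    (sliceGram g Φ x v s).det = (sliceGram g Φ x v t).det := by
  have hΦ := h.isLocalDiffeomorph.contMDiff
  have h1 : (sliceGram g Φ x (stdFrame n x) s).det = (sliceGram g Φ x (stdFrame n x) t).det := by
    refine is_const_of_deriv_eq_zero (f := fun t => (sliceGram g Φ x (stdFrame n x) t).det)
      ((contDiff_det_sliceGram hΦ x).differentiable (by simp)) (fun t₀ => ?_) s t
    have he := IsManifold.chart_mem_maximalAtlas (I := 𝓡 m) (n := ∞) (Φ (x, t₀))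
    have hf := IsManifold.chart_mem_maximalAtlas (I := 𝓡 1) (n := ∞) (π (Φ (x, t₀)))
    exact (h.tensionField_eq_zero_iff hc hharm.smooth he hf (mem_chart_source _ _)
      (mem_chart_source _ _)).1 (hharm.tension_eq_zero _ he _ hf _ (mem_chart_source _ _)
        (mem_chart_source _ _) 0)
  -- Passing from the standard frame to v multiplies the determinant by the square of a determinant
  -- that does not depend on t.
  let a : Fin n → EuclideanSpace ℝ (Fin n) := v
  have h2 : ∀ t, (sliceGram g Φ x v t).det = (sliceGram g Φ x (stdFrame n x) t).det *
      (Matrix.of fun i j => (a j).ofLp i).det ^ 2 := by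
    intro t
    rw [← Matrix.det_of_dotProduct_mulVec _ (fun i => (a i).ofLp)]
    congr 1
    ext i k
    let L : EuclideanSpace ℝ (Fin n) →L[ℝ] EuclideanSpace ℝ (Fin m) :=
      (mfderiv ((𝓡 n).prod 𝓘(ℝ, ℝ)) (𝓡 m) Φ (x, t) :
        EuclideanSpace ℝ (Fin n) × ℝ →L[ℝ] EuclideanSpace ℝ (Fin m)).comp
      (ContinuousLinearMap.inl ℝ _ ℝ)
    have h3 := g.inner_sum_sum (p := Φ (x, t)) (a i).ofLp (a k).ofLp
      (fun l => L (EuclideanSpace.single l 1))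
    refine Eq.trans ?_ h3
    exact g.inner_congr rfl (EuclideanSpace.clm_apply_eq_sum L (a i))
      (EuclideanSpace.clm_apply_eq_sum L (a k))
  rw [h2, h2, h1]

/-- The mapping torus structure defined by a flow. -/
theorem IsAngleFlow.exists_mappingTorus [IsManifold (𝓡 n) ∞ M₀] (h : IsAngleFlow m π φ)
    (hj : IsFibreEmbedding m n π j) (hc : 0 < c)
    (hharm : IsHarmonicMap g (circleMetric c hc) π)
    (htube : IsHorizontalTube n g c π (fun q : M₀ × ℝ => φ q.2 (j q.1))) :
    ∃ (η : Diffeomorph (𝓡 n) (𝓡 n) M₀ M₀ ∞)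
      (gt : Icc (0 : ℝ) (2 * Real.pi) → SmoothMetric n M₀)
      (Ψ : Diffeomorph ((𝓡 n).prod 𝓘(ℝ, ℝ)) (𝓡 m) (MappingTorus η.toHomeomorph) M ∞),
      (∀ (x : M₀) (t : Icc (0 : ℝ) (2 * Real.pi)) (v w : TangentSpace (𝓡 n) x) (a b : ℝ),
        g.inner (Ψ (MappingTorus.cover η.toHomeomorph (x, (t : ℝ))))
          (mfderiv ((𝓡 n).prod 𝓘(ℝ, ℝ)) (𝓡 m)
            (fun p : M₀ × ℝ => Ψ (MappingTorus.cover η.toHomeomorph p)) (x, (t : ℝ)) (v, a))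
          (mfderiv ((𝓡 n).prod 𝓘(ℝ, ℝ)) (𝓡 m)
            (fun p : M₀ × ℝ => Ψ (MappingTorus.cover η.toHomeomorph p)) (x, (t : ℝ)) (w, b)) =
        (gt t).inner x v w + c * (a * b)) ∧
      (∀ (x : M₀) (v w : TangentSpace (𝓡 n) x),
        (gt ⟨2 * Real.pi, right_mem_Icc.2 Real.two_pi_pos.le⟩).inner (η x)
          (mfderiv (𝓡 n) (𝓡 n) η x v) (mfderiv (𝓡 n) (𝓡 n) η x w) =
        (gt ⟨0, left_mem_Icc.2 Real.two_pi_pos.le⟩).inner x v w) ∧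
      (∀ (s t : Icc (0 : ℝ) (2 * Real.pi)) (x : M₀) (v : Fin n → TangentSpace (𝓡 n) x),
        volumeDensity (gt s) x v = volumeDensity (gt t) x v) ∧
      (∀ (x : M₀) (t : Icc (0 : ℝ) (2 * Real.pi)),
        π (Ψ (MappingTorus.mk η.toHomeomorph (x, t))) = Circle.exp t) := by
  set Φ : M₀ × ℝ → M := fun q => φ q.2 (j q.1) with hΦdef
  have hΦ : ContMDiff ((𝓡 n).prod 𝓘(ℝ, ℝ)) (𝓡 m) ∞ Φ := htube.isLocalDiffeomorph.contMDiff
  obtain ⟨η, hη⟩ := h.exists_returnMap hj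
  obtain ⟨Ψ, hΨ⟩ := MappingTorus.exists_diffeomorph htube.isLocalDiffeomorph
    (h.surjective_tube hj) (h.tube_eq_iff hj (η := η.toHomeomorph) hη)
  have hslice : ∀ t : ℝ, ContMDiff (𝓡 n) (𝓡 m) ∞ (fun x => Φ (x, t)) := fun t =>
    hΦ.comp (contMDiff_id.prodMk contMDiff_const)
  have hinj : ∀ (t : ℝ) (x : M₀),
      Function.Injective (mfderiv (𝓡 n) (𝓡 m) (fun x => Φ (x, t)) x) := by
    intro t x v w hvw
    rw [mfderiv_slice hΦ, mfderiv_slice hΦ] at hvw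
    exact congrArg Prod.fst ((htube.mfderiv_bijective (x, t)).1 hvw)
  -- g(t) is the metric induced on the slice at time t.
  let gt : ℝ → SmoothMetric n M₀ := fun t => g.pullback (fun x => Φ (x, t)) (hslice t) (hinj t)
  have hgt : ∀ (t : ℝ) (x : M₀) (v w : TangentSpace (𝓡 n) x), (gt t).inner x v w =
      g.inner (Φ (x, t)) (mfderiv ((𝓡 n).prod 𝓘(ℝ, ℝ)) (𝓡 m) Φ (x, t) (v, (0 : ℝ)))
        (mfderiv ((𝓡 n).prod 𝓘(ℝ, ℝ)) (𝓡 m) Φ (x, t) (w, (0 : ℝ))) := fun t x v w =>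
    g.inner_congr rfl (mfderiv_slice hΦ x t v) (mfderiv_slice hΦ x t w)
  have hΨΦ : (fun p : M₀ × ℝ => Ψ (MappingTorus.cover η.toHomeomorph p)) = Φ := funext hΨ
  refine ⟨η, fun t => gt t, Ψ, ?_, ?_, ?_, ?_⟩
  · intro x t v w a b
    rw [hΨΦ, hgt]
    refine Eq.trans ?_ (htube.inner_eq x t v w a b)
    exact g.inner_congr (hΨ _) rfl rfl
  · intro x v w
    -- The slice at time 2π, composed with η, is the slice at time 0; hence η pulls g(2π) back to
    -- g(0).
    have h1 : (fun y => Φ (y, 2 * Real.pi)) ∘ η = fun y => Φ (y, 0) := by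
      funext y
      change φ (2 * Real.pi) (j (η y)) = φ 0 (j y)
      rw [hη, h.apply_neg, h.zero]
    have h2 : ∀ v : TangentSpace (𝓡 n) x,
        mfderiv (𝓡 n) (𝓡 m) (fun y => Φ (y, 2 * Real.pi)) (η x) (mfderiv (𝓡 n) (𝓡 n) η x v) =
          mfderiv (𝓡 n) (𝓡 m) (fun y => Φ (y, 0)) x v := by
      intro v
      have h3 := mfderiv_comp x ((hslice (2 * Real.pi)).mdifferentiableAt (by simp))
        (η.contMDiff.mdifferentiableAt (x := x) (by simp))
      rw [h1] at h3
      exact (congrArg (fun L : EuclideanSpace ℝ (Fin n) →L[ℝ] EuclideanSpace ℝ (Fin m) => L v)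
        h3).symm
    exact g.inner_congr (congrFun h1 x) (h2 v) (h2 w)
  · intro s t x v
    have h1 : ∀ t : ℝ, volumeDensity (gt t) x v = √(sliceGram g Φ x v t).det := by
      intro t
      have h2 : (Matrix.of fun i j => (gt t).inner x (v i) (v j)) = sliceGram g Φ x v t := by
        ext i k
        exact hgt t x (v i) (v k)
      rw [volumeDensity, h2]
    rw [h1, h1, htube.det_sliceGram_eq hc hharm x v s t]
  · intro x t
    rw [MappingTorus.mk_eq_cover, hΨ]
    exact h.proj_tube hj x t

omit [IsManifold (𝓡 m) ∞ M] in
theorem isFibreEmbedding_val (σ : ∀ x : {p : M | π p = 1}, SliceChart m n {p : M | π p = 1} x) :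
    letI := SliceChart.chartedSpace σ
    IsFibreEmbedding m n π (Subtype.val : {p : M | π p = 1} → M) :=
  let _ := SliceChart.chartedSpace σ
  { contMDiff := SliceChart.contMDiff_val σ
    isEmbedding := Topology.IsEmbedding.subtypeVal
    mem_range_iff := fun p => ⟨fun ⟨x, hx⟩ => hx ▸ x.2, fun hp => ⟨⟨p, hp⟩, rfl⟩⟩
    exists_retraction := SliceChart.exists_retraction σ }

end Decomposition

/-! ### The equivalence -/

theorem theorem3p1 {m : ℕ} {M : Type u} [TopologicalSpace M] [T2Space M] [CompactSpace M]
    [ConnectedSpace M] [ChartedSpace (EuclideanSpace ℝ (Fin m)) M] [IsManifold (𝓡 m) ∞ M]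
    (g : SmoothMetric m M) (lam : ℝ) (hlam : lam < 0)
    (π : M → Circle) (hπ : ContMDiff (𝓡 m) (𝓡 1) ∞ π) :
    (IsHarmonicMap g (circleMetric (1 / |lam|) (one_div_pos.2 (abs_pos.2 hlam.ne))) π ∧
      IsRiemannianSubmersion g (circleMetric (1 / |lam|) (one_div_pos.2 (abs_pos.2 hlam.ne))) π) ↔
    ∃ (n : ℕ) (M₀ : Type u) (_ : TopologicalSpace M₀) (_ : T2Space M₀) (_ : CompactSpace M₀)
      (_ : ChartedSpace (EuclideanSpace ℝ (Fin n)) M₀) (_ : IsManifold (𝓡 n) ∞ M₀)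
      (η : Diffeomorph (𝓡 n) (𝓡 n) M₀ M₀ ∞)
      (gt : Icc (0 : ℝ) (2 * Real.pi) → SmoothMetric n M₀)
      (Ψ : Diffeomorph ((𝓡 n).prod 𝓘(ℝ, ℝ)) (𝓡 m) (MappingTorus η.toHomeomorph) M ∞),
      -- under `Ψ` the metric of `M` is `g(t) + (1 / |λ|) dt²`
      (∀ (x : M₀) (t : Icc (0 : ℝ) (2 * Real.pi)) (v w : TangentSpace (𝓡 n) x) (a b : ℝ),
        g.inner (Ψ (MappingTorus.cover η.toHomeomorph (x, (t : ℝ))))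
          (mfderiv ((𝓡 n).prod 𝓘(ℝ, ℝ)) (𝓡 m)
            (fun p : M₀ × ℝ => Ψ (MappingTorus.cover η.toHomeomorph p)) (x, (t : ℝ)) (v, a))
          (mfderiv ((𝓡 n).prod 𝓘(ℝ, ℝ)) (𝓡 m)
            (fun p : M₀ × ℝ => Ψ (MappingTorus.cover η.toHomeomorph p)) (x, (t : ℝ)) (w, b)) =
        (gt t).inner x v w + 1 / |lam| * (a * b)) ∧
      -- `η* g(2π) = g(0)`
      (∀ (x : M₀) (v w : TangentSpace (𝓡 n) x),
        (gt ⟨2 * Real.pi, right_mem_Icc.2 Real.two_pi_pos.le⟩).inner (η x)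
          (mfderiv (𝓡 n) (𝓡 n) η x v) (mfderiv (𝓡 n) (𝓡 n) η x w) =
        (gt ⟨0, left_mem_Icc.2 Real.two_pi_pos.le⟩).inner x v w) ∧
      -- the volume density of `g(t)` does not depend on `t`
      (∀ (s t : Icc (0 : ℝ) (2 * Real.pi)) (x : M₀) (v : Fin n → TangentSpace (𝓡 n) x),
        volumeDensity (gt s) x v = volumeDensity (gt t) x v) ∧
      -- `π [x, t] = e^{it}`
      (∀ (x : M₀) (t : Icc (0 : ℝ) (2 * Real.pi)),
        π (Ψ (MappingTorus.mk η.toHomeomorph (x, t))) = Circle.exp t) := by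
  have hc : 0 < 1 / |lam| := one_div_pos.2 (abs_pos.2 hlam.ne)
  constructor
  · rintro ⟨hharm, hsub⟩
    obtain ⟨X, hXs, hX⟩ := exists_dual_vectorField g (1 / |lam|) hπ
    have hX1 := hsub.angleForm_dual g hX
    obtain ⟨φ, hφs, hφ0, hφadd, hφ⟩ := exists_flow hXs
    have hflow : IsAngleFlow m π φ := ⟨hφs, hφ0, hφadd, proj_flow hπ hφ0 hφ hX1⟩
    -- The fibre has dimension m − 1. The case m = 0 is excluded because M has a point, at which
    -- α(X) = 1 gives a nonzero tangent vector.
    obtain ⟨n, hn⟩ : ∃ n, n + 1 = m := by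
      obtain ⟨p⟩ : Nonempty M := inferInstance
      rcases m with _ | n
      · exfalso
        have h1 := hX1 p
        have h2 : X p = 0 := Subsingleton.elim (α := EuclideanSpace ℝ (Fin 0)) _ _
        rw [h2, map_zero] at h1
        exact zero_ne_one h1
      · exact ⟨n, rfl⟩
    let σ : ∀ x : {p : M | π p = 1}, SliceChart m n {p : M | π p = 1} x := fun x =>
      (exists_sliceChart hn hπ hsub.surjective x).some
    let _ := SliceChart.chartedSpace σ
    have := SliceChart.isManifold σ
    have hj : IsFibreEmbedding m n π (Subtype.val : {p : M | π p = 1} → M) := isFibreEmbedding_val σ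
    have hcomp : CompactSpace {p : M | π p = 1} := isCompact_iff_compactSpace.1
      ((isClosed_singleton (x := (1 : Circle))).preimage hπ.continuous).isCompact
    exact ⟨n, {p : M | π p = 1}, inferInstance, inferInstance, hcomp, inferInstance, this,
      hflow.exists_mappingTorus hj hc hharm (hflow.isHorizontalTube hj hπ hX hX1 hφ)⟩
  · rintro ⟨n, M₀, _, _, _, _, _, η, gt, Ψ, hg, -, hvol, hexp⟩
    exact MappingTorus.isHarmonicMap_and_isRiemannianSubmersion hc hπ hg hvol hexp
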